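/- **Conventions.** A *modulus* is a continuous, concave, non-decreasing function $\eta:(0,\infty)\to(0,\infty)$ with $\lim_{r\to0^+}\eta(r)=0$; it is an *Osgood modulus* if moreover $\int_0^1\frac{dr}{\eta(r)}=+\infty$. For $S\subseteq\mathbb R^n$ put $\|f\|_{C^0(S)}=\sup_S|f|$, $\|f\|_{C^1(S)}=\sup_S|f|+\sup_S|\nabla f|$ and $\|f\|_{C^\eta(S)}=\sup_S|f|+\sup_{x\ne y\in S}\frac{|f(x)-f(y)|}{\eta(|x-y|)}$. $U\Subset V$ means that $\overline U$ is compact and contained in $V$. $C^\eta_{\rm loc}(\Omega)$ is the set of continuous $f$ on $\Omega$ with $\|f\|_{C^\eta(\Omega')}<\infty$ for all open $\Omega'\Subset\Omega$; $C^{0,\alpha}$ is the case $\eta(r)=r^\alpha$, $0<\alpha<1$. *Distributional bracket.* $[X,Y]=X\cdot\nabla Y-Y\cdot\nabla X$ is $0$ on $\Omega$ in the sense of distributions if there are $\frac12<\beta<1$ and smooth vector fields $A_k\to X$, $B_k\to Y$ in $C^{0,\beta}_{\rm loc}(\Omega)$ with $\int\varphi\,[A_k,B_k]\,dx\to0$ for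 every $\varphi\in C_c^\infty(\Omega)$ (the limit does not depend on the approximations). *Littlewood–Paley operators.* With $\hat f(\xi)=\int f(x)e^{-ix\cdot\xi}dx$, fix a real-valued Schwartz function $\phi$ on $\mathbb R^n$ such that $\hat\phi$ is even, has values in $[0,1]$ and support in $\{\frac12<|\xi|<2\}$, and $\sum_{j\in\mathbb Z}\hat\phi(2^{-j}\xi)=1$ for $\xi\neq0$. Let $\hat\phi_j(\xi)=\hat\phi(2^{-j}\xi)$ for $j\ge1$, $\hat\phi_0(\xi)=1-\sum_{j\ge1}\hat\phi(2^{-j}\xi)$, and $\mathsf S_\nu f=\sum_{k=0}^\nu\phi_k*f$. *Flows.* For a vector field $V$ on an open set $M\subseteq\mathbb R^n$, $\mathfrak F_V^t(p)$ is the value at time $t$ of a solution of $\gamma'=V(\gamma)$, $\gamma(0)=p$ in $M$; it is said to be defined if such a solution exists up to time $t$ and its value at time $t$ is unique. **Proposition.** Let $U_0\Subset\Omega\subseteq\mathbb R^n$ be open sets, let $\eta$ be an Osgood modulus, and let $X,Y\in C^\eta_{\rm loc}(\Omega,\mathbb R^n)$ satisfy $[X,Y]=0$ on $\Omega$ in the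 sense of distributions. Let $\chi\in C_c^\infty(\Omega,[0,1])$ be equal to $1$ on $U_0+B(0,\delta)$ for some $\delta>0$, and define $X_\nu=\mathsf S_\nu(\chi X)$, $Y_\nu=\mathsf S_\nu(\chi Y)$ on $\mathbb R^n$ for integers $\nu\ge1$. Then $X_\nu,Y_\nu$ are smooth on $\mathbb R^n$, and: 1. There is $C>0$ such that $\|X_\nu\|_{C^1(U_0)}+\|Y_\nu\|_{C^1(U_0)}\le C\,2^\nu\eta(2^{-\nu})$ for all $\nu\ge1$. 2. For every $0<\gamma<1$ such that $X,Y\in C^{0,(1+\gamma)/2}_{\rm loc}(\Omega,\mathbb R^n)$ there is $C_\gamma>0$ such that $\|[X_\nu,Y_\nu]\|_{C^0(U_0)}\le C_\gamma2^{-\gamma\nu}$ for all $\nu\ge1$. (In particular this holds for every $0<\gamma<1$ if $\eta(r)=O(r^\alpha)$ as $r\to0^+$ for every $\alpha<1$, for instance in the log-Lipschitz case.) 3. There is an Osgood modulus $\zeta$ such that $\lim_{\nu\to\infty}\|X_\nu-X\|_{C^\zeta(U_0)}=\lim_{\nu\to\infty}\|Y_\nu-Y\|_{C^\zeta(U_0)}=0$.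 4. For every $U\Subset U_0$ there is $T>0$ such that for all $|t|<T$, $p\in U$ and $\nu\ge1$ the flows $\mathfrak F^t_X(p),\mathfrak F^t_Y(p)$ (in $\Omega$) and $\mathfrak F^t_{X_\nu}(p),\mathfrak F^t_{Y_\nu}(p)$ (in $\mathbb R^n$) are defined, and $\lim_{\nu\to\infty}\sup_{|t|<T}\|\mathfrak F^t_{X_\nu}-\mathfrak F^t_X\|_{C^0(U)}=\lim_{\nu\to\infty}\sup_{|t|<T}\|\mathfrak F^t_{Y_\nu}-\mathfrak F^t_Y\|_{C^0(U)}=0$. -/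

import Mathlib

open MeasureTheory Filter Topology Set
open scoped ContDiff FourierTransform SchwartzMap ENNReal

namespace OsgoodLP

noncomputable section

/-- `ℝⁿ` with its Euclidean norm. -/
abbrev Eucl (n : ℕ) : Type := EuclideanSpace ℝ (Fin n)

/-- `U ⋐ V`: the closure of `U` is compact and contained in `V`. -/
def CompactlyContained {n : ℕ} (U V : Set (Eucl n)) : Prop :=
  IsCompact (closure U) ∧ closure U ⊆ V

/-! ### Moduli of continuity and the spaces they define -/

/-- A modulus of continuity `(0,∞) → (0,∞)`: continuous, concave, non-decreasing, with limit `0`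
at `0⁺`. The values of `η` on `(-∞,0]` play no role. -/
structure IsModulus (η : ℝ → ℝ) : Prop where
  pos : ∀ r, 0 < r → 0 < η r
  continuousOn : ContinuousOn η (Ioi 0)
  concaveOn : ConcaveOn ℝ (Ioi 0) η
  monotoneOn : MonotoneOn η (Ioi 0)
  tendsto_zero : Tendsto η (𝓝[>] 0) (𝓝 0)

/-- An Osgood modulus: `∫₀¹ dr / η(r) = +∞`. -/
structure IsOsgoodModulus (η : ℝ → ℝ) : Prop extends IsModulus η where
  lintegral_eq_top : ∫⁻ r in Ioo (0 : ℝ) 1, ENNReal.ofReal (1 / η r) = ⊤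

/-- `‖f‖_{C⁰(S)} = sup_S |f|`, with values in `[0,∞]`. -/
def c0Norm {n : ℕ} {F : Type*} [NormedAddCommGroup F] (S : Set (Eucl n)) (f : Eucl n → F) :
    ℝ≥0∞ :=
  ⨆ x ∈ S, ‖f x‖ₑ

/-- `‖f‖_{C¹(S)} = sup_S |f| + sup_S |∇f|`, with values in `[0,∞]` (used for smooth `f`). -/
def c1Norm {n : ℕ} (S : Set (Eucl n)) (f : Eucl n → Eucl n) : ℝ≥0∞ :=
  c0Norm S f + c0Norm S (fderiv ℝ f)

/-- `‖f‖_{C^η(S)} = sup_S |f| + sup_{x ≠ y ∈ S} |f x - f y| / η(|x - y|)`, with values in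
`[0,∞]`. -/
def modNorm {n : ℕ} (η : ℝ → ℝ) (S : Set (Eucl n)) (f : Eucl n → Eucl n) : ℝ≥0∞ :=
  c0Norm S f + ⨆ x ∈ S, ⨆ y ∈ S, ⨆ _ : x ≠ y, ‖f x - f y‖ₑ / ENNReal.ofReal (η ‖x - y‖)

/-- `f ∈ C^η_loc(Ω, ℝⁿ)`: `f` is continuous on `Ω` and `‖f‖_{C^η(Ω')} < ∞` for every open
`Ω' ⋐ Ω`. -/
def MemModLoc {n : ℕ} (η : ℝ → ℝ) (Ω : Set (Eucl n)) (f : Eucl n → Eucl n) : Prop :=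
  ContinuousOn f Ω ∧
    ∀ Ω' : Set (Eucl n), IsOpen Ω' → CompactlyContained Ω' Ω → modNorm η Ω' f < ⊤

/-- `‖f‖_{C^{0,α}(S)}`: the case `η(r) = r^α`. -/
def holderNorm {n : ℕ} (α : ℝ) (S : Set (Eucl n)) (f : Eucl n → Eucl n) : ℝ≥0∞ :=
  modNorm (fun r => r ^ α) S f

/-- `f ∈ C^{0,α}_loc(Ω, ℝⁿ)`: the case `η(r) = r^α`. -/
def MemHolderLoc {n : ℕ} (α : ℝ) (Ω : Set (Eucl n)) (f : Eucl n → Eucl n) : Prop :=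
  MemModLoc (fun r => r ^ α) Ω f

/-! ### Lie brackets of Hölder vector fields as distributions -/

/-- `φ ∈ C_c^∞(Ω, ℝ)`. -/
structure IsTestFunction {n : ℕ} (Ω : Set (Eucl n)) (φ : Eucl n → ℝ) : Prop where
  contDiff : ContDiff ℝ ∞ φ
  hasCompactSupport : HasCompactSupport φ
  tsupport_subset : tsupport φ ⊆ Ω

/-- The smooth vector fields `A k` converge to `X` in `C^{0,β}_loc(Ω)`. -/
def SmoothHolderApprox {n : ℕ} (β : ℝ) (Ω : Set (Eucl n)) (A : ℕ → Eucl n → Eucl n)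
    (X : Eucl n → Eucl n) : Prop :=
  (∀ k, ContDiff ℝ ∞ (A k)) ∧
    ∀ Ω' : Set (Eucl n), IsOpen Ω' → CompactlyContained Ω' Ω →
      Tendsto (fun k => holderNorm β Ω' (fun x => A k x - X x)) atTop (𝓝 0)

/-- The distribution `T` (vector valued, written as a functional on scalar test functions) is the
Lie bracket `[X,Y] = X · ∇Y - Y · ∇X` on `Ω`. For Hölder fields of an exponent above `1/2` the
products of a `C^{0,β}` function with a first derivative of another one, `β > 1/2`, are defined as
distributional limits along smooth approximations converging in `C^{0,β}_loc`; the limit does not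
depend on the approximations (nor on `β`), so it is enough to name one pair of them. -/
def HasDistribLieBracket {n : ℕ} (Ω : Set (Eucl n)) (X Y : Eucl n → Eucl n)
    (T : (Eucl n → ℝ) → Eucl n) : Prop :=
  ∃ β : ℝ, 1 / 2 < β ∧ β < 1 ∧ ∃ A B : ℕ → Eucl n → Eucl n,
    SmoothHolderApprox β Ω A X ∧ SmoothHolderApprox β Ω B Y ∧
    ∀ φ : Eucl n → ℝ, IsTestFunction Ω φ →
      Tendsto (fun k => ∫ x, φ x • VectorField.lieBracket ℝ (A k) (B k) x) atTop (𝓝 (T φ))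

/-- `[X,Y] = 0` on `Ω` in the sense of distributions. -/
def DistribLieBracketEqZero {n : ℕ} (Ω : Set (Eucl n)) (X Y : Eucl n → Eucl n) : Prop :=
  HasDistribLieBracket Ω X Y (fun _ => 0)

/-! ### Littlewood-Paley operators -/

/-- `f̂(ξ) = ∫ f(x) e^{-i x·ξ} dx`, through Mathlib's `𝓕 f (ξ) = ∫ f(x) e^{-2π i x·ξ} dx`. -/
def hat {n : ℕ} (f : Eucl n → ℝ) (ξ : Eucl n) : ℂ :=
  𝓕 (fun x => (f x : ℂ)) ((2 * Real.pi)⁻¹ • ξ)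

/-- `φ` is a Littlewood-Paley character function. That `φ̂` is smooth and compactly supported
follows from `φ` being Schwartz and from the condition on the support. -/
structure IsLPChar {n : ℕ} (φ : 𝓢(Eucl n, ℝ)) : Prop where
  hat_im : ∀ ξ, (hat φ ξ).im = 0
  hat_mem : ∀ ξ, (hat φ ξ).re ∈ Icc (0 : ℝ) 1
  hat_even : ∀ ξ, hat φ (-ξ) = hat φ ξ
  hat_support : tsupport (hat φ) ⊆ {ξ | 1 / 2 < ‖ξ‖ ∧ ‖ξ‖ < 2}
  hat_sum : ∀ ξ, ξ ≠ 0 → HasSum (fun j : ℤ => hat φ ((2 : ℝ) ^ (-j) • ξ)) 1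

/-- The symbols of the associated sequence: `φ̂_j(ξ) = φ̂(2^{-j} ξ)` for `j > 0`, and
`φ̂_0(ξ) = 1 - ∑_{j ≥ 1} φ̂(2^{-j} ξ)` (a finite sum for each `ξ`). -/
def lpSymbol {n : ℕ} (φ : 𝓢(Eucl n, ℝ)) : ℕ → Eucl n → ℂ
  | 0, ξ => 1 - ∑' j : ℕ, hat φ ((2 : ℝ) ^ (-((j : ℤ) + 1)) • ξ)
  | j + 1, ξ => hat φ ((2 : ℝ) ^ (-((j : ℤ) + 1)) • ξ)

/-- `φ_j`, the inverse transform of `φ̂_j` (real-valued, as its symbol is real and even). -/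
def lpSeq {n : ℕ} (φ : 𝓢(Eucl n, ℝ)) (j : ℕ) (x : Eucl n) : ℝ :=
  (𝓕⁻ (fun ξ => lpSymbol φ j ((2 * Real.pi) • ξ)) x).re

/-- `P_j f = φ_j ∗ f`. -/
def lpBlock {n : ℕ} (φ : 𝓢(Eucl n, ℝ)) (j : ℕ) (f : Eucl n → Eucl n) : Eucl n → Eucl n :=
  convolution (lpSeq φ j) f (ContinuousLinearMap.lsmul ℝ ℝ) volume

/-- `S_ν f = ∑_{k=0}^ν P_k f`. -/
def lpSum {n : ℕ} (φ : 𝓢(Eucl n, ℝ)) (ν : ℕ) (f : Eucl n → Eucl n) (x : Eucl n) : Eucl n :=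
  ∑ k ∈ Finset.range (ν + 1), lpBlock φ k f x

/-! ### Flows -/

/-- `γ` solves `γ' = V(γ)`, `γ(0) = p` in `M` on the open interval `I ∋ 0`. -/
structure IsSolution {n : ℕ} (M : Set (Eucl n)) (V : Eucl n → Eucl n) (p : Eucl n) (I : Set ℝ)
    (γ : ℝ → Eucl n) : Prop where
  isOpen : IsOpen I
  ordConnected : I.OrdConnected
  zero_mem : (0 : ℝ) ∈ I
  initial : γ 0 = p
  mem : ∀ t ∈ I, γ t ∈ M
  hasDerivAt : ∀ t ∈ I, HasDerivAt γ (V (γ t)) t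

/-- Some solution of `γ' = V(γ)` in `M` that starts at `p` is at the point `q` at time `t`. -/
def Reaches {n : ℕ} (M : Set (Eucl n)) (V : Eucl n → Eucl n) (t : ℝ) (p q : Eucl n) : Prop :=
  ∃ (I : Set ℝ) (γ : ℝ → Eucl n), IsSolution M V p I γ ∧ t ∈ I ∧ γ t = q

/-- The flow domain `𝒟_V ⊆ ℝ × M` of the vector field `V` on `M`: a solution starting at `p` exists
up to time `t`, and its position at time `t` is uniquely determined. -/
def flowDomain {n : ℕ} (M : Set (Eucl n)) (V : Eucl n → Eucl n) : Set (ℝ × Eucl n) :=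
  {z | ∃! q, Reaches M V z.1 z.2 q}

open Classical in
/-- The flow `𝔉_V^t(p)` of the vector field `V` on `M` (with the value `p` off the flow domain). -/
def flow {n : ℕ} (M : Set (Eucl n)) (V : Eucl n → Eucl n) (t : ℝ) (p : Eucl n) : Eucl n :=
  if h : ∃! q, Reaches M V t p q then h.choose else p

/-- `sup_{|t|<T} ‖𝔉_V^t - 𝔉_W^t‖_{C⁰(U)}` for vector fields `V` on `M` and `W` on `N`. -/
def flowDist {n : ℕ} (M : Set (Eucl n)) (V : Eucl n → Eucl n) (N : Set (Eucl n))
    (W : Eucl n → Eucl n) (T : ℝ) (U : Set (Eucl n)) : ℝ≥0∞ :=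
  ⨆ t ∈ Ioo (-T) T, c0Norm U (fun p => flow M V t p - flow N W t p)

end

end OsgoodLP

open OsgoodLP

/-!
`S_ν` is mollification at scale `s = 2^{-ν}`: the symbols of the Littlewood-Paley sequence
telescope, so `S_ν f = moll Φ (2^{-ν}) f` for one fixed Schwartz kernel `Φ` of integral one
(`lpSum_eq_moll`). With `f = χX` and `g = χY`, which have modulus `η` on the whole space and compact
support, everything is a statement about `f_s = moll Φ s f` and `g_s = moll Φ s g`.

The bound on gradients follows from `∫ ∇Φ = 0` and the modulus of `f`
(`exists_c1Norm_moll_le`), and `f_s` has the modulus `η` with a constant independent of `s`, while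
`f_s → f` uniformly. Convergence in `C^ζ` then holds as soon as `η = o(ζ)`; every Osgood modulus
has such an Osgood majorant, a sum of truncations `min (η, η r_k)` along scales `r_k` that decrease
so fast that `1 / ζ` still has a divergent integral (`IsOsgoodModulus.exists_isLittleO`).

Convergence of the flows is the quantitative form of Osgood's uniqueness theorem: integral
curves of two uniformly close fields from the same point stay close
(`IsOsgoodModulus.exists_stability`). Applied to the flows of two mollifications this shows that
they form a Cauchy sequence, whose limit solves the limit equation; applied to two exact solutions
it gives uniqueness (`IsOsgoodModulus.flow_convergence`).

The commutator estimate compares `[f_s, g_s](x)` with the bracket in which the fields that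
differentiate are frozen at `f x` and `g x`; by Hölder continuity of exponent `α = (1 + γ) / 2` the
difference is `O(s^{2α - 1}) = O(s^γ)`. In the frozen expression the derivatives may be put on the
kernel, which is cut off at a fixed distance at the cost of `O(s)`, so that it is a test function
supported where `χ = 1` (`exists_norm_lieBracket_moll_le`). Against a test function the bracket of
`f_r` and `g_r` tends to zero as `r → 0` because `[X,Y] = 0`
(`DistribLieBracketEqZero.tendsto_moll`), and the pairings with `f_r - f x` and `g_r - g x` are
summed over dyadic scales `r = 2^{-J}`, `J ≥ ν`: passing from `r` to `r / 2` costs `r⁻¹ (r^α)²`,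
after an integration by parts where the increment is the factor that is differentiated
(`norm_advect_moll_sub_le`). The same telescoping shows that the pairing of a derivative
of a Hölder field with another is stable under mollification, uniformly along the approximating
sequences in the definition of the distributional bracket (`exists_norm_advect_sub_moll_le`).
-/

namespace OsgoodLP

noncomputable section

variable {n : ℕ}

/-! ### Moduli of continuity -/

/-- Concavity in the multiplicative form in which it is used: `η (a b) ≤ (1 + a) η b`. -/
lemma IsModulus.mul_le {η : ℝ → ℝ} (hη : IsModulus η) {a b : ℝ} (ha : 0 < a) (hb : 0 < b) :
    η (a * b) ≤ (1 + a) * η b := by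
  have hpos := hη.pos b hb
  rcases le_or_gt a 1 with h1 | h1
  · have := hη.monotoneOn (mem_Ioi.2 (mul_pos ha hb)) (mem_Ioi.2 hb) (by nlinarith)
    nlinarith
  · -- `b` is the convex combination of `b / a` and `a * b` with weight `1 / (1 + a)` at `a * b`
    have h := hη.concaveOn.2 (mem_Ioi.2 (mul_pos ha hb)) (mem_Ioi.2 (div_pos hb ha))
      (show 0 ≤ 1 / (1 + a) by positivity) (show 0 ≤ a / (1 + a) by positivity)
      (by field_simp)
    have he : (1 / (1 + a)) • (a * b) + (a / (1 + a)) • (b / a) = b := by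
      simp only [smul_eq_mul]; field_simp; ring
    rw [he] at h
    simp only [smul_eq_mul] at h
    have h2 : 0 ≤ a / (1 + a) * η (b / a) :=
      mul_nonneg (by positivity) (hη.pos _ (div_pos hb ha)).le
    have h3 : 1 / (1 + a) * η (a * b) ≤ η b := by linarith
    rw [one_div, inv_mul_le_iff₀ (by positivity)] at h3
    exact h3

lemma isModulus_rpow {α : ℝ} (h0 : 0 < α) (h1 : α ≤ 1) : IsModulus (fun r => r ^ α) where
  pos r hr := Real.rpow_pos_of_pos hr α
  continuousOn := fun x hx =>
    (Real.continuousAt_rpow_const x α (Or.inl (ne_of_gt hx))).continuousWithinAt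
  concaveOn := (Real.concaveOn_rpow h0.le h1).subset Ioi_subset_Ici_self (convex_Ioi 0)
  monotoneOn := fun x hx y _ hxy => Real.rpow_le_rpow (le_of_lt hx) hxy h0.le
  tendsto_zero := by
    have : Tendsto (fun r : ℝ => r ^ α) (𝓝 0) (𝓝 (0 ^ α)) :=
      (Real.continuousAt_rpow_const 0 α (Or.inr h0.le)).tendsto
    rw [Real.zero_rpow h0.ne'] at this
    exact this.mono_left nhdsWithin_le_nhds

/-- `min r 1` is controlled by any modulus. -/
lemma IsModulus.le_of_le_min {η : ℝ → ℝ} (hη : IsModulus η) {r A B a : ℝ} (hr : 0 < r)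
    (hA : 0 ≤ A) (hB : 0 ≤ B) (h1 : a ≤ A * r) (h2 : a ≤ B) :
    a ≤ (2 * A + B) / η 1 * η r := by
  have hη1 := hη.pos 1 one_pos
  have hηr := hη.pos r hr
  rw [div_mul_eq_mul_div, le_div_iff₀ hη1]
  rcases le_or_gt r 1 with h | h
  · have := hη.mul_le (inv_pos.2 hr) hr
    rw [inv_mul_cancel₀ hr.ne'] at this
    have h3 : r * η 1 ≤ 2 * η r := by
      have h4 : r * η 1 ≤ r * ((1 + r⁻¹) * η r) := by gcongr
      have h5 : r * ((1 + r⁻¹) * η r) = (r + 1) * η r := by field_simp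
      rw [h5] at h4
      nlinarith
    nlinarith [mul_le_mul_of_nonneg_left h3 hA, mul_nonneg hB hηr.le]
  · have := hη.monotoneOn (mem_Ioi.2 one_pos) (mem_Ioi.2 hr) h.le
    nlinarith [mul_le_mul_of_nonneg_left this hB, mul_nonneg hA hηr.le,
      mul_le_mul_of_nonneg_right h2 hη1.le]

/-- `f` has modulus of continuity `H η` on the whole space. -/
def HasMod {F : Type*} [NormedAddCommGroup F] (η : ℝ → ℝ) (H : ℝ) (f : Eucl n → F) : Prop :=
  ∀ x y, x ≠ y → ‖f x - f y‖ ≤ H * η ‖x - y‖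

section HasMod

variable {F : Type*} [NormedAddCommGroup F] {η : ℝ → ℝ} {H : ℝ} {f : Eucl n → F}

lemma HasMod.mono (hf : HasMod η H f) (hη : IsModulus η) {H' : ℝ} (h : H ≤ H') :
    HasMod η H' f := fun x y hxy =>
  (hf x y hxy).trans
    (mul_le_mul_of_nonneg_right h (hη.pos _ (norm_pos_iff.2 (sub_ne_zero.2 hxy))).le)

lemma HasMod.continuous (hf : HasMod η H f) (hη : IsModulus η) : Continuous f := by
  rw [continuous_iff_continuousAt]
  intro x
  rw [← continuousWithinAt_compl_self, ContinuousWithinAt, tendsto_iff_norm_sub_tendsto_zero]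
  have h1 : Tendsto (fun y => H * η ‖y - x‖) (𝓝[≠] x) (𝓝 0) := by
    simpa using (hη.tendsto_zero.comp (tendsto_norm_sub_self_nhdsNE x)).const_mul H
  refine squeeze_zero' (Eventually.of_forall fun y => norm_nonneg _) ?_ h1
  filter_upwards [self_mem_nhdsWithin] with y hy using hf y x hy

lemma HasMod.norm_sub_smul_le (hf : HasMod η H f) (hη : IsModulus η) (hH : 0 ≤ H) {s : ℝ}
    (hs : 0 < s) (x z : Eucl n) : ‖f (x - s • z) - f x‖ ≤ (1 + ‖z‖) * (H * η s) := by
  rcases eq_or_ne z 0 with rfl | hz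
  · simp only [smul_zero, sub_zero, sub_self, norm_zero, add_zero, one_mul]
    exact mul_nonneg hH (hη.pos s hs).le
  · have h := hf (x - s • z) x (by simp [hz, hs.ne'])
    have h2 : ‖x - s • z - x‖ = ‖z‖ * s := by
      rw [sub_sub_cancel_left, norm_neg, norm_smul, Real.norm_of_nonneg hs.le, mul_comm]
    rw [h2] at h
    calc _ ≤ _ := h
      _ ≤ H * ((1 + ‖z‖) * η s) := by
        gcongr
        exact hη.mul_le (norm_pos_iff.2 hz) hs
      _ = _ := by ring

lemma HasMod.add {H' : ℝ} {g : Eucl n → F} (hf : HasMod η H f) (hg : HasMod η H' g) :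
    HasMod η (H + H') (fun x => f x + g x) := fun x y hxy => by
  have := norm_add_le (f x - f y) (g x - g y)
  rw [add_sub_add_comm]
  linarith [hf x y hxy, hg x y hxy, add_mul H H' (η ‖x - y‖)]

lemma HasMod.sub {H' : ℝ} {g : Eucl n → F} (hf : HasMod η H f) (hg : HasMod η H' g) :
    HasMod η (H + H') (fun x => f x - g x) := fun x y hxy => by
  have := norm_sub_le (f x - f y) (g x - g y)
  rw [sub_sub_sub_comm]
  linarith [hf x y hxy, hg x y hxy, add_mul H H' (η ‖x - y‖)]

end HasMod

/-- A compactly supported `C¹` function has every modulus of continuity. -/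
lemma exists_hasMod_of_contDiff {F : Type*} [NormedAddCommGroup F] [NormedSpace ℝ F]
    {η : ℝ → ℝ} (hη : IsModulus η) {f : Eucl n → F}
    (hf : ContDiff ℝ 1 f) (hc : HasCompactSupport f) : ∃ H, 0 ≤ H ∧ HasMod η H f := by
  obtain ⟨A, hA⟩ := ContDiff.lipschitzWith_of_hasCompactSupport hc hf one_ne_zero
  obtain ⟨B, hB⟩ := hc.exists_bound_of_continuous hf.continuous
  have hB0 : 0 ≤ B := (norm_nonneg _).trans (hB 0)
  refine ⟨(2 * A + 2 * B) / η 1, div_nonneg (by positivity) (hη.pos 1 one_pos).le,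
    fun x y hxy => ?_⟩
  have h2 : ‖f x - f y‖ ≤ 2 * B := by
    linarith [norm_sub_le (f x) (f y), hB x, hB y]
  have h1 := hA.dist_le_mul x y
  rw [dist_eq_norm, dist_eq_norm] at h1
  exact hη.le_of_le_min (norm_pos_iff.2 (sub_ne_zero.2 hxy)) A.2 (by positivity) h1 h2

/-! ### Norms on sets and localisation -/

lemma c0Norm_le_iff {F : Type*} [NormedAddCommGroup F] {S : Set (Eucl n)} {f : Eucl n → F} {M : ℝ}
    (hM : 0 ≤ M) : c0Norm S f ≤ ENNReal.ofReal M ↔ ∀ x ∈ S, ‖f x‖ ≤ M := by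
  simp only [c0Norm, iSup_le_iff]
  refine forall₂_congr fun x _ => ?_
  rw [← ofReal_norm, ENNReal.ofReal_le_ofReal_iff hM]

lemma modNorm_le {η : ℝ → ℝ} (hη : IsModulus η) {S : Set (Eucl n)} {f : Eucl n → Eucl n}
    {M H : ℝ} (hM : 0 ≤ M) (hH : 0 ≤ H) (h1 : ∀ x ∈ S, ‖f x‖ ≤ M)
    (h2 : ∀ x ∈ S, ∀ y ∈ S, x ≠ y → ‖f x - f y‖ ≤ H * η ‖x - y‖) :
    modNorm η S f ≤ ENNReal.ofReal (M + H) := by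
  rw [modNorm, ENNReal.ofReal_add hM hH]
  refine add_le_add ((c0Norm_le_iff hM).2 h1) (iSup₂_le fun x hx => iSup₂_le fun y hy =>
    iSup_le fun hxy => ?_)
  have hp := hη.pos _ (norm_pos_iff.2 (sub_ne_zero.2 hxy))
  rw [ENNReal.div_le_iff (by simpa using hp) ENNReal.ofReal_ne_top, ← ofReal_norm,
    ← ENNReal.ofReal_mul hH]
  exact ENNReal.ofReal_le_ofReal (h2 x hx y hy hxy)

lemma le_of_modNorm_le {η : ℝ → ℝ} (hη : IsModulus η) {S : Set (Eucl n)} {f : Eucl n → Eucl n}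
    {M : ℝ} (hM : 0 ≤ M) (h : modNorm η S f ≤ ENNReal.ofReal M) :
    (∀ x ∈ S, ‖f x‖ ≤ M) ∧
      ∀ x ∈ S, ∀ y ∈ S, x ≠ y → ‖f x - f y‖ ≤ M * η ‖x - y‖ := by
  refine ⟨(c0Norm_le_iff hM).1 (le_self_add.trans h), fun x hx y hy hxy => ?_⟩
  have hp := hη.pos _ (norm_pos_iff.2 (sub_ne_zero.2 hxy))
  have h2 : ‖f x - f y‖ₑ / ENNReal.ofReal (η ‖x - y‖) ≤ ENNReal.ofReal M := by
    refine le_trans ?_ (le_add_self.trans h)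
    exact le_iSup₂_of_le x hx (le_iSup₂_of_le y hy (le_iSup_of_le hxy le_rfl))
  rw [ENNReal.div_le_iff (by simpa using hp) ENNReal.ofReal_ne_top, ← ofReal_norm,
    ← ENNReal.ofReal_mul hM, ENNReal.ofReal_le_ofReal_iff (mul_nonneg hM hp.le)] at h2
  exact h2

/-- Multiplication by a test function maps `C^η(Ω')` to globally `C^η` functions, with a
constant that is uniform in the function. -/
lemma exists_hasMod_cutoff {η : ℝ → ℝ} (hη : IsModulus η) {Ω' : Set (Eucl n)} (hΩ' : IsOpen Ω')
    {χ : Eucl n → ℝ} (hχ : IsTestFunction Ω' χ) :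
    ∃ C, 0 ≤ C ∧ ∀ (f : Eucl n → Eucl n) (M : ℝ), 0 ≤ M →
      modNorm η Ω' f ≤ ENNReal.ofReal M →
      (∀ x, ‖χ x • f x‖ ≤ C * M) ∧ HasMod η (C * M) (fun x => χ x • f x) := by
  obtain ⟨B, hB⟩ := hχ.hasCompactSupport.exists_bound_of_continuous hχ.contDiff.continuous
  have hB0 : 0 ≤ B := (norm_nonneg _).trans (hB 0)
  obtain ⟨A, hA0, hA⟩ := exists_hasMod_of_contDiff hη (hχ.contDiff.of_le (by simp))
    hχ.hasCompactSupport
  obtain ⟨d, hd, hdsub⟩ := hχ.hasCompactSupport.isCompact.exists_thickening_subset_open hΩ'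
    hχ.tsupport_subset
  have hηd := hη.pos d hd
  refine ⟨A + B + B / η d, by positivity, fun f M hM hf => ?_⟩
  obtain ⟨hf1, hf2⟩ := le_of_modNorm_le hη hM hf
  have hsupp : ∀ x, χ x ≠ 0 → x ∈ tsupport χ := fun x hx => subset_tsupport _ hx
  have hbd : ∀ x, ‖χ x • f x‖ ≤ B * M := by
    intro x
    by_cases hx : χ x = 0
    · rw [hx, zero_smul, norm_zero]; positivity
    · rw [norm_smul]
      exact mul_le_mul (hB x) (hf1 x (hχ.tsupport_subset (hsupp x hx))) (norm_nonneg _) hB0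
  -- one point in the support of `χ`, the other one anywhere
  have key : ∀ x y, x ≠ y → χ x ≠ 0 →
      ‖χ x • f x - χ y • f y‖ ≤ (A + B + B / η d) * M * η ‖x - y‖ := by
    intro x y hxy hx
    have hxy' := norm_pos_iff.2 (sub_ne_zero.2 hxy)
    have hp := hη.pos _ hxy'
    have hxS := hsupp x hx
    by_cases hy : y ∈ Ω'
    · have e : χ x • f x - χ y • f y = χ x • (f x - f y) + (χ x - χ y) • f y := by
        rw [smul_sub, sub_smul]; abel
      rw [e]
      have h1 : ‖χ x • (f x - f y)‖ ≤ B * (M * η ‖x - y‖) := by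
        rw [norm_smul]
        exact mul_le_mul (hB x) (hf2 x (hχ.tsupport_subset hxS) y hy hxy) (norm_nonneg _) hB0
      have h2 : ‖(χ x - χ y) • f y‖ ≤ A * η ‖x - y‖ * M := by
        rw [norm_smul]
        exact mul_le_mul (hA x y hxy) (hf1 y hy) (norm_nonneg _) (by positivity)
      have h3 : 0 ≤ B / η d * M * η ‖x - y‖ := by positivity
      linarith [norm_add_le (χ x • (f x - f y)) ((χ x - χ y) • f y)]
    -- here `‖x - y‖` is at least the distance `d` of the support of `χ` to the complement of `Ω'`
    · have hy0 : χ y = 0 := by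
        by_contra h
        exact hy (hχ.tsupport_subset (hsupp y h))
      have hdist : d ≤ ‖x - y‖ := by
        by_contra! h
        refine hy (hdsub (Metric.mem_thickening_iff.2 ⟨x, hxS, ?_⟩))
        rw [dist_comm, dist_eq_norm]; exact h
      have hm := hη.monotoneOn (mem_Ioi.2 hd) (mem_Ioi.2 hxy') hdist
      rw [hy0, zero_smul, sub_zero]
      have h1 : B * M ≤ B / η d * M * η ‖x - y‖ := by
        rw [div_mul_eq_mul_div, div_mul_eq_mul_div, le_div_iff₀ hηd]
        gcongr
      have h2 : 0 ≤ (A + B) * M * η ‖x - y‖ := by positivity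
      linarith [hbd x]
  refine ⟨fun x => (hbd x).trans ?_, fun x y hxy => ?_⟩
  · have : 0 ≤ (A + B / η d) * M := by positivity
    linarith
  by_cases hx : χ x = 0
  · by_cases hy : χ y = 0
    · have hp := hη.pos _ (norm_pos_iff.2 (sub_ne_zero.2 hxy))
      simp only [hx, hy, zero_smul, sub_self, norm_zero]
      positivity
    · rw [norm_sub_rev, norm_sub_rev x y]
      exact key y x hxy.symm hy
  · exact key x y hxy hx

/-- A test function of `Ω` is a test function of some open set compactly contained in `Ω`. -/
lemma IsTestFunction.exists_compactlyContained {Ω : Set (Eucl n)} (hΩ : IsOpen Ω)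
    {χ : Eucl n → ℝ} (hχ : IsTestFunction Ω χ) :
    ∃ Ω', IsOpen Ω' ∧ CompactlyContained Ω' Ω ∧ IsTestFunction Ω' χ := by
  obtain ⟨V, hV, h1, h2, h3⟩ := exists_open_between_and_isCompact_closure
    hχ.hasCompactSupport.isCompact hΩ hχ.tsupport_subset
  exact ⟨V, hV, ⟨h3, h2⟩, ⟨hχ.contDiff, hχ.hasCompactSupport, h1⟩⟩

lemma MemModLoc.exists_hasMod {η : ℝ → ℝ} (hη : IsModulus η) {Ω : Set (Eucl n)} (hΩ : IsOpen Ω)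
    {X : Eucl n → Eucl n} (hX : MemModLoc η Ω X) {χ : Eucl n → ℝ} (hχ : IsTestFunction Ω χ) :
    ∃ H, 0 ≤ H ∧ (∀ x, ‖χ x • X x‖ ≤ H) ∧ HasMod η H (fun x => χ x • X x) := by
  obtain ⟨Ω', hΩ', hc, hχ'⟩ := hχ.exists_compactlyContained hΩ
  obtain ⟨C, hC, h⟩ := exists_hasMod_cutoff hη hΩ' hχ'
  have hfin := hX.2 Ω' hΩ' hc
  have := h X (modNorm η Ω' X).toReal ENNReal.toReal_nonneg (ENNReal.ofReal_toReal hfin.ne).ge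
  exact ⟨_, mul_nonneg hC ENNReal.toReal_nonneg, this.1, this.2⟩

/-! ### Mollification by a Schwartz kernel -/

section Moll

variable {G : Type*} [NormedAddCommGroup G] [NormedSpace ℝ G]
variable {F : Type*} [NormedAddCommGroup F] [NormedSpace ℝ F]

/-- The second absolute moment `∫ (1 + |z|)² |Φ z| dz` of a Schwartz function. It dominates the
mass and the first moment. -/
def mass (Φ : 𝓢(Eucl n, G)) : ℝ := ∫ z, (1 + ‖z‖) ^ 2 * ‖Φ z‖

lemma integrable_mass (Φ : 𝓢(Eucl n, G)) :
    Integrable (fun z => (1 + ‖z‖) ^ 2 * ‖Φ z‖) := by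
  have h0 := Φ.integrable_pow_mul volume 0
  have h1 := Φ.integrable_pow_mul volume 1
  have h2 := Φ.integrable_pow_mul volume 2
  refine ((h0.add (h1.const_mul 2)).add h2).congr (Eventually.of_forall fun z => ?_)
  simp only [Pi.add_apply]
  ring

lemma mass_nonneg (Φ : 𝓢(Eucl n, G)) : 0 ≤ mass Φ :=
  integral_nonneg fun z => by positivity

/-- A function with values controlled by `w |Φ|`, `w ≤ M (1 + |z|)²`, has an integral bounded by
`M * mass Φ`. -/
lemma norm_integral_le_mass (Φ : 𝓢(Eucl n, G)) {g : Eucl n → F} {M : ℝ}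
    (h : ∀ z, ‖g z‖ ≤ M * ((1 + ‖z‖) ^ 2 * ‖Φ z‖)) : ‖∫ z, g z‖ ≤ mass Φ * M := by
  have := norm_integral_le_of_norm_le ((integrable_mass Φ).const_mul M)
    (Eventually.of_forall h)
  rwa [integral_const_mul, mul_comm] at this

lemma one_le_weight (z : Eucl n) : 1 ≤ (1 + ‖z‖) ^ 2 := by nlinarith [norm_nonneg z]

lemma one_add_le_weight (z : Eucl n) : 1 + ‖z‖ ≤ (1 + ‖z‖) ^ 2 := by nlinarith [norm_nonneg z]

/-- The mollification `∫ Φ(z) f(x - s z) dz` of `f` at scale `s`. For `s > 0` it is the convolution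
of `f` with `s⁻ⁿ Φ(· / s)`. -/
def moll (Φ : 𝓢(Eucl n, ℝ)) (s : ℝ) (f : Eucl n → F) (x : Eucl n) : F :=
  ∫ z, Φ z • f (x - s • z)

variable {Φ : 𝓢(Eucl n, ℝ)} {s : ℝ} {f g : Eucl n → F} {M H : ℝ} {η : ℝ → ℝ}

lemma integrable_smul_bounded (Φ : 𝓢(Eucl n, ℝ)) (hf : Continuous f) (hM : ∀ x, ‖f x‖ ≤ M)
    (s : ℝ) (x : Eucl n) : Integrable (fun z => Φ z • f (x - s • z)) :=
  (Φ.integrable.norm.mul_const M).mono' (Continuous.aestronglyMeasurable (by fun_prop))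
    (Eventually.of_forall fun z => by
      rw [norm_smul]
      exact mul_le_mul_of_nonneg_left (hM _) (norm_nonneg _))

lemma norm_moll_le (hM : ∀ x, ‖f x‖ ≤ M) (x : Eucl n) : ‖moll Φ s f x‖ ≤ mass Φ * M := by
  refine norm_integral_le_mass Φ fun z => ?_
  rw [norm_smul, mul_comm]
  have hM0 : 0 ≤ M := (norm_nonneg _).trans (hM 0)
  calc ‖f (x - s • z)‖ * ‖Φ z‖ ≤ M * (1 * ‖Φ z‖) := by
        rw [one_mul]; gcongr; exact hM _
    _ ≤ _ := by gcongr; exact one_le_weight z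

lemma moll_sub (hf : Continuous f) (hg : Continuous g) {M' : ℝ}
    (hM : ∀ x, ‖f x‖ ≤ M) (hM' : ∀ x, ‖g x‖ ≤ M') (x : Eucl n) :
    moll Φ s (fun y => f y - g y) x = moll Φ s f x - moll Φ s g x := by
  simp only [moll, smul_sub]
  exact integral_sub (integrable_smul_bounded Φ hf hM s x) (integrable_smul_bounded Φ hg hM' s x)

lemma hasMod_moll (hη : IsModulus η) (hH : 0 ≤ H) (hf : HasMod η H f) (hM : ∀ x, ‖f x‖ ≤ M) :
    HasMod η (mass Φ * H) (moll Φ s f) := by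
  intro x y hxy
  have hc := hf.continuous hη
  have hp := hη.pos _ (norm_pos_iff.2 (sub_ne_zero.2 hxy))
  rw [moll, moll, ← integral_sub (integrable_smul_bounded Φ hc hM s x)
    (integrable_smul_bounded Φ hc hM s y), mul_assoc]
  refine norm_integral_le_mass Φ fun z => ?_
  rw [← smul_sub, norm_smul, mul_comm]
  have h := hf (x - s • z) (y - s • z) (by simpa using hxy)
  rw [sub_sub_sub_cancel_right] at h
  calc ‖f (x - s • z) - f (y - s • z)‖ * ‖Φ z‖ ≤ H * η ‖x - y‖ * (1 * ‖Φ z‖) := by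
        rw [one_mul]; gcongr
    _ ≤ _ := by gcongr; exact one_le_weight z

variable [CompleteSpace F]

lemma norm_moll_sub_smul_le (hη : IsModulus η) (hH : 0 ≤ H) (hf : HasMod η H f)
    (hM : ∀ x, ‖f x‖ ≤ M) (hs : 0 < s) (x : Eucl n) :
    ‖moll Φ s f x - (∫ z, Φ z) • f x‖ ≤ mass Φ * (H * η s) := by
  have hηs := hη.pos s hs
  rw [moll, ← integral_smul_const, ← integral_sub
    (integrable_smul_bounded Φ (hf.continuous hη) hM s x) (Φ.integrable.smul_const _)]
  refine norm_integral_le_mass Φ fun z => ?_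
  rw [← smul_sub, norm_smul, mul_comm]
  calc ‖f (x - s • z) - f x‖ * ‖Φ z‖ ≤ (1 + ‖z‖) * (H * η s) * ‖Φ z‖ := by
        gcongr; exact hf.norm_sub_smul_le hη hH hs x z
    _ = H * η s * ((1 + ‖z‖) * ‖Φ z‖) := by ring
    _ ≤ _ := by gcongr; exact one_add_le_weight z

lemma norm_moll_sub_le (hΦ : ∫ z, Φ z = 1) (hη : IsModulus η) (hH : 0 ≤ H) (hf : HasMod η H f)
    (hM : ∀ x, ‖f x‖ ≤ M) (hs : 0 < s) (x : Eucl n) :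
    ‖moll Φ s f x - f x‖ ≤ mass Φ * (H * η s) := by
  simpa [hΦ] using norm_moll_sub_smul_le (Φ := Φ) hη hH hf hM hs x

/-- The derivative of a Schwartz function in the direction `u`. -/
def dirDeriv (Φ : 𝓢(Eucl n, ℝ)) (u : Eucl n) : 𝓢(Eucl n, ℝ) :=
  (SchwartzMap.fderivCLM ℝ (Eucl n) ℝ Φ).postcompCLM (ContinuousLinearMap.apply ℝ ℝ u)

@[simp] lemma dirDeriv_apply (Φ : 𝓢(Eucl n, ℝ)) (u z : Eucl n) :
    dirDeriv Φ u z = fderiv ℝ Φ z u := rfl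

end Moll

/-! ### Differentiating mollifications -/

section MollDeriv

variable {F : Type*} [NormedAddCommGroup F] [NormedSpace ℝ F]
variable {Φ : 𝓢(Eucl n, ℝ)} {s : ℝ} {f : Eucl n → F} {M H : ℝ} {η : ℝ → ℝ}

/-- Change of variables `z = (x - y) / s`. -/
lemma integral_comp_inv_smul_sub (g : Eucl n → F) (hs : 0 < s) (x : Eucl n) :
    ∫ y, g (s⁻¹ • (x - y)) = s ^ n • ∫ z, g z := by
  rw [integral_sub_left_eq_self (fun y => g (s⁻¹ • y)) volume x,
    Measure.integral_comp_inv_smul_of_nonneg volume g hs.le, finrank_euclideanSpace_fin]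

lemma moll_eq_integral_kernel (hs : 0 < s) (f : Eucl n → F) (x : Eucl n) :
    moll Φ s f x = (s ^ n)⁻¹ • ∫ y, Φ (s⁻¹ • (x - y)) • f y := by
  have := integral_comp_inv_smul_sub (fun z => Φ z • f (x - s • z)) hs x
  simp only [smul_inv_smul₀ hs.ne', sub_sub_cancel] at this
  rw [this, inv_smul_smul₀ (pow_ne_zero _ hs.ne'), moll]

lemma exists_norm_fderiv_le (Φ : 𝓢(Eucl n, ℝ)) : ∃ C, ∀ z, ‖fderiv ℝ Φ z‖ ≤ C := by
  obtain ⟨C, -, hC⟩ := (SchwartzMap.fderivCLM ℝ (Eucl n) ℝ Φ).decay 0 0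
  exact ⟨C, fun z => by simpa using hC z⟩

lemma hasFDerivAt_moll (hs : 0 < s) (hf : Continuous f) (hfc : HasCompactSupport f)
    (x : Eucl n) :
    HasFDerivAt (moll Φ s f) (s⁻¹ • ∫ z, (fderiv ℝ Φ z).smulRight (f (x - s • z))) x := by
  obtain ⟨C, hC⟩ := exists_norm_fderiv_le Φ
  obtain ⟨M, hM⟩ := hfc.exists_bound_of_continuous hf
  have hcont : Continuous (fderiv ℝ Φ) := (Φ.smooth 1).continuous_fderiv one_ne_zero
  have key : HasFDerivAt (fun x => ∫ y, Φ (s⁻¹ • (x - y)) • f y)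
      (∫ y, s⁻¹ • (fderiv ℝ Φ (s⁻¹ • (x - y))).smulRight (f y)) x := by
    refine hasFDerivAt_integral_of_dominated_of_fderiv_le (s := univ)
      (F' := fun x y => s⁻¹ • (fderiv ℝ Φ (s⁻¹ • (x - y))).smulRight (f y))
      (bound := fun y => s⁻¹ * (C * ‖f y‖)) univ_mem ?_ ?_ ?_ ?_ ?_ ?_
    · exact Eventually.of_forall fun x => by fun_prop
    · exact Continuous.integrable_of_hasCompactSupport (by fun_prop) hfc.smul_left
    · have : SecondCountableTopologyEither (Eucl n) (Eucl n →L[ℝ] F) := ⟨Or.inl inferInstance⟩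
      refine Continuous.aestronglyMeasurable ?_
      have : Continuous fun y => (fderiv ℝ Φ (s⁻¹ • (x - y))) :=
        hcont.comp (by fun_prop)
      fun_prop
    · refine Eventually.of_forall fun y x _ => ?_
      rw [norm_smul, ContinuousLinearMap.norm_smulRight_apply, Real.norm_of_nonneg (by positivity)]
      gcongr
      exact hC _
    · exact ((hf.norm.integrable_of_hasCompactSupport hfc.norm).const_mul C).const_mul _
    · refine Eventually.of_forall fun y x _ => ?_
      have h1 : HasFDerivAt (fun x : Eucl n => s⁻¹ • (x - y))
          (s⁻¹ • ContinuousLinearMap.id ℝ (Eucl n)) x :=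
        ((hasFDerivAt_id x).sub_const y).const_smul s⁻¹
      have h2 := ((Φ.differentiableAt (x := s⁻¹ • (x - y))).hasFDerivAt.comp x h1).smul_const (f y)
      refine h2.congr_fderiv ?_
      ext u
      simp [smul_smul]
  have h := key.const_smul (s ^ n)⁻¹
  have e := integral_comp_inv_smul_sub
    (fun z => s⁻¹ • (fderiv ℝ Φ z).smulRight (f (x - s • z))) hs x
  simp only [smul_inv_smul₀ hs.ne', sub_sub_cancel] at e
  rw [e, inv_smul_smul₀ (pow_ne_zero _ hs.ne'), integral_smul] at h
  refine h.congr_of_eventuallyEq (Eventually.of_forall fun x => ?_)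
  rw [moll_eq_integral_kernel hs]
  rfl

lemma fderiv_moll_apply [CompleteSpace F] (hs : 0 < s) (hf : Continuous f)
    (hfc : HasCompactSupport f)
    (x u : Eucl n) : fderiv ℝ (moll Φ s f) x u = s⁻¹ • moll (dirDeriv Φ u) s f x := by
  obtain ⟨M, hM⟩ := hfc.exists_bound_of_continuous hf
  have hcont : Continuous (fderiv ℝ Φ) := (Φ.smooth 1).continuous_fderiv one_ne_zero
  rw [(hasFDerivAt_moll hs hf hfc x).fderiv, _root_.smul_apply,
    ContinuousLinearMap.integral_apply, moll]
  · rfl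
  · have hM0 : 0 ≤ M := (norm_nonneg _).trans (hM 0)
    have hint : Integrable (fun z => ‖fderiv ℝ Φ z‖ * M) :=
      ((SchwartzMap.fderivCLM ℝ (Eucl n) ℝ Φ).integrable (μ := volume)).norm.mul_const M
    refine hint.mono' (Continuous.aestronglyMeasurable (by fun_prop))
      (Eventually.of_forall fun z => ?_)
    rw [ContinuousLinearMap.norm_smulRight_apply]
    gcongr
    exact hM _

lemma contDiff_moll [CompleteSpace F] (hs : 0 < s) (hf : Continuous f)
    (hfc : HasCompactSupport f) : ContDiff ℝ ∞ (moll Φ s f) := by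
  rw [contDiff_infty]
  intro m
  induction m generalizing Φ with
  | zero =>
    exact contDiff_zero.2 (continuous_iff_continuousAt.2 fun x =>
      (hasFDerivAt_moll hs hf hfc x).continuousAt)
  | succ m ih =>
    rw [Nat.cast_succ, contDiff_succ_iff_fderiv_apply]
    refine ⟨fun x => (hasFDerivAt_moll hs hf hfc x).differentiableAt, by simp, fun u => ?_⟩
    simp only [fderiv_moll_apply hs hf hfc]
    exact (ih (Φ := dirDeriv Φ u)).const_smul _

lemma norm_fderiv_moll_le (hs : 0 < s) (hf : Continuous f) (hfc : HasCompactSupport f)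
    (hM : ∀ x, ‖f x‖ ≤ M) (x : Eucl n) :
    ‖fderiv ℝ (moll Φ s f) x‖ ≤ s⁻¹ * (mass (SchwartzMap.fderivCLM ℝ (Eucl n) ℝ Φ) * M) := by
  have hM0 : 0 ≤ M := (norm_nonneg _).trans (hM 0)
  rw [(hasFDerivAt_moll hs hf hfc x).fderiv, norm_smul, Real.norm_of_nonneg (by positivity)]
  gcongr
  refine norm_integral_le_mass _ fun z => ?_
  rw [ContinuousLinearMap.norm_smulRight_apply, mul_comm, SchwartzMap.fderivCLM_apply]
  calc ‖f (x - s • z)‖ * ‖fderiv ℝ Φ z‖ ≤ M * (1 * ‖fderiv ℝ Φ z‖) := by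
        rw [one_mul]; gcongr; exact hM _
    _ ≤ _ := by gcongr; exact one_le_weight z

lemma integral_fderiv_schwartz (Φ : 𝓢(Eucl n, ℝ)) : ∫ z, fderiv ℝ Φ z = 0 := by
  ext u
  have hi : Integrable (fun z => fderiv ℝ Φ z) :=
    (SchwartzMap.fderivCLM ℝ (Eucl n) ℝ Φ).integrable (μ := volume)
  rw [ContinuousLinearMap.integral_apply hi]
  have hiu : Integrable (fun z => fderiv ℝ Φ z u) := (dirDeriv Φ u).integrable (μ := volume)
  have := integral_mul_fderiv_eq_neg_fderiv_mul_of_integrable (μ := volume) (v := u)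
    (f := fun _ : Eucl n => (1 : ℝ)) (g := Φ) (by simp) (by simpa using hiu)
    (by simpa using Φ.integrable) (by fun_prop) (fun x _ => Φ.differentiableAt)
  simpa using this

/-- The gradient of the mollification of a function with modulus `η` grows at most like
`η(s) / s`; this uses `∫ ∇Φ = 0`. -/
lemma norm_fderiv_moll_le_of_hasMod [CompleteSpace F] (hη : IsModulus η) (hH : 0 ≤ H)
    (hfH : HasMod η H f) (hs : 0 < s) (hfc : HasCompactSupport f) (x : Eucl n) :
    ‖fderiv ℝ (moll Φ s f) x‖ ≤
      s⁻¹ * (mass (SchwartzMap.fderivCLM ℝ (Eucl n) ℝ Φ) * (H * η s)) := by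
  have hηs := hη.pos s hs
  have hf := hfH.continuous hη
  obtain ⟨M, hM⟩ := hfc.exists_bound_of_continuous hf
  have hM0 : 0 ≤ M := (norm_nonneg _).trans (hM 0)
  have hcont : Continuous (fderiv ℝ Φ) := (Φ.smooth 1).continuous_fderiv one_ne_zero
  have hi : Integrable (fun z => fderiv ℝ Φ z) :=
    (SchwartzMap.fderivCLM ℝ (Eucl n) ℝ Φ).integrable (μ := volume)
  have h0 : ∫ z, (fderiv ℝ Φ z).smulRight (f x) = 0 := by
    have := (ContinuousLinearMap.smulRightL ℝ (Eucl n) F).flip (f x) |>.integral_comp_comm hi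
    simpa [integral_fderiv_schwartz] using this
  have hint1 : Integrable (fun z => (fderiv ℝ Φ z).smulRight (f (x - s • z))) := by
    refine (hi.norm.mul_const M).mono' (Continuous.aestronglyMeasurable (by fun_prop))
      (Eventually.of_forall fun z => ?_)
    rw [ContinuousLinearMap.norm_smulRight_apply]
    gcongr
    exact hM _
  have hint2 : Integrable (fun z => (fderiv ℝ Φ z).smulRight (f x)) := by
    refine (hi.norm.mul_const M).mono' (Continuous.aestronglyMeasurable (by fun_prop))
      (Eventually.of_forall fun z => ?_)
    rw [ContinuousLinearMap.norm_smulRight_apply]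
    gcongr
    exact hM _
  rw [(hasFDerivAt_moll hs hf hfc x).fderiv, norm_smul, Real.norm_of_nonneg (by positivity),
    ← sub_zero (∫ z, _), ← h0, ← integral_sub hint1 hint2]
  gcongr
  refine norm_integral_le_mass _ fun z => ?_
  have e : (fderiv ℝ Φ z).smulRight (f (x - s • z)) - (fderiv ℝ Φ z).smulRight (f x) =
      (fderiv ℝ Φ z).smulRight (f (x - s • z) - f x) := by
    ext u; simp [smul_sub]
  rw [e, ContinuousLinearMap.norm_smulRight_apply, mul_comm, SchwartzMap.fderivCLM_apply]
  calc ‖f (x - s • z) - f x‖ * ‖fderiv ℝ Φ z‖ ≤ (1 + ‖z‖) * (H * η s) * ‖fderiv ℝ Φ z‖ := by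
        gcongr; exact hfH.norm_sub_smul_le hη hH hs x z
    _ = H * η s * ((1 + ‖z‖) * ‖fderiv ℝ Φ z‖) := by ring
    _ ≤ _ := by gcongr; exact one_add_le_weight z

lemma fderiv_moll_eq_moll_fderiv (hf : ContDiff ℝ 1 f) (hfc : HasCompactSupport f) (x : Eucl n) :
    fderiv ℝ (moll Φ s f) x = moll Φ s (fderiv ℝ f) x := by
  obtain ⟨M, hM⟩ := hfc.exists_bound_of_continuous hf.continuous
  obtain ⟨C, hC⟩ := (hfc.fderiv ℝ).exists_bound_of_continuous (hf.continuous_fderiv one_ne_zero)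
  have hfd := hf.continuous_fderiv one_ne_zero
  have hfc' := hf.continuous
  refine HasFDerivAt.fderiv ?_
  refine hasFDerivAt_integral_of_dominated_of_fderiv_le (s := univ)
    (F' := fun x z => Φ z • fderiv ℝ f (x - s • z))
    (bound := fun z => ‖Φ z‖ * C) univ_mem ?_ ?_ ?_ ?_ ?_ ?_
  · exact Eventually.of_forall fun x => by fun_prop
  · exact integrable_smul_bounded Φ hf.continuous hM s x
  · fun_prop
  · refine Eventually.of_forall fun y x _ => ?_
    rw [norm_smul]
    gcongr
    exact hC _
  · exact Φ.integrable.norm.mul_const C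
  · refine Eventually.of_forall fun z x _ => ?_
    have h := ((hf.differentiable one_ne_zero (x - s • z)).hasFDerivAt.comp x
      ((hasFDerivAt_id x).sub_const (s • z))).const_smul (Φ z)
    refine h.congr_fderiv ?_
    ext u
    simp

end MollDeriv

/-! ### Littlewood-Paley sums are mollifications -/

section LP

variable {φ : 𝓢(Eucl n, ℝ)}

lemma contDiff_hat (φ : 𝓢(Eucl n, ℝ)) : ContDiff ℝ ∞ (hat φ) := by
  have h : hat φ = fun ξ => 𝓕 (φ.postcompCLM Complex.ofRealCLM) ((2 * Real.pi)⁻¹ • ξ) := rfl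
  rw [h]
  exact ((𝓕 (φ.postcompCLM Complex.ofRealCLM)).smooth _).comp (contDiff_const_smul _)

lemma IsLPChar.hat_eq_zero (hφ : IsLPChar φ) {ξ : Eucl n} (h : ‖ξ‖ ≤ 1 / 2 ∨ 2 ≤ ‖ξ‖) :
    hat φ ξ = 0 := by
  by_contra h0
  have := hφ.hat_support (subset_tsupport _ h0)
  simp only [mem_ofPred_eq] at this
  rcases h with h | h <;> linarith [this.1, this.2]

lemma norm_dyadic_smul (j : ℕ) (ξ : Eucl n) :
    ‖(2 : ℝ) ^ (-((j : ℤ) + 1)) • ξ‖ = ((2 : ℝ) ^ (j + 1))⁻¹ * ‖ξ‖ := by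
  rw [norm_smul, Real.norm_of_nonneg (by positivity), zpow_neg]
  norm_cast

lemma IsLPChar.hat_dyadic_eq_zero (hφ : IsLPChar φ) {ξ : Eucl n} {N j : ℕ}
    (hξ : ‖ξ‖ ≤ 2 ^ N) (hj : N ≤ j) : hat φ ((2 : ℝ) ^ (-((j : ℤ) + 1)) • ξ) = 0 := by
  refine hφ.hat_eq_zero (Or.inl ?_)
  rw [norm_dyadic_smul, inv_mul_le_iff₀ (by positivity)]
  calc ‖ξ‖ ≤ 2 ^ N := hξ
    _ ≤ 2 ^ j := by gcongr; norm_num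
    _ = _ := by rw [pow_succ]; ring

/-- Near any point the symbol `φ̂₀` is a finite sum. -/
lemma IsLPChar.lpSymbol_zero_eq (hφ : IsLPChar φ) {ξ : Eucl n} {N : ℕ} (hξ : ‖ξ‖ ≤ 2 ^ N) :
    lpSymbol φ 0 ξ = 1 - ∑ j ∈ Finset.range N, hat φ ((2 : ℝ) ^ (-((j : ℤ) + 1)) • ξ) := by
  rw [lpSymbol, tsum_eq_sum]
  intro j hj
  exact hφ.hat_dyadic_eq_zero hξ (by simpa using hj)

lemma IsLPChar.lpSymbol_zero_eq_zero (hφ : IsLPChar φ) {ξ : Eucl n} (hξ : 2 ≤ ‖ξ‖) :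
    lpSymbol φ 0 ξ = 0 := by
  have h := hφ.hat_sum ξ (by rintro rfl; norm_num at hξ)
  have hinj : Function.Injective (fun j : ℕ => (j : ℤ) + 1) := fun a b hab => by
    simpa using hab
  rw [← hinj.hasSum_iff] at h
  · rw [lpSymbol, sub_eq_zero]
    exact h.tsum_eq.symm
  · intro j hj
    refine hφ.hat_eq_zero (Or.inr ?_)
    have hj0 : j ≤ 0 := by
      by_contra! h0
      exact hj ⟨(j - 1).toNat, by simp only; omega⟩
    rw [norm_smul, Real.norm_of_nonneg (by positivity)]
    have : 1 ≤ (2 : ℝ) ^ (-j) := one_le_zpow₀ (by norm_num) (by omega)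
    nlinarith [norm_nonneg ξ]

lemma IsLPChar.contDiff_lpSymbol (hφ : IsLPChar φ) (k : ℕ) : ContDiff ℝ ∞ (lpSymbol φ k) := by
  rcases k with _ | k
  · rw [contDiff_iff_contDiffAt]
    intro ξ
    obtain ⟨N, hN⟩ := pow_unbounded_of_one_lt ‖ξ‖ (one_lt_two (α := ℝ))
    have hev : lpSymbol φ 0 =ᶠ[𝓝 ξ] fun ξ =>
        1 - ∑ j ∈ Finset.range N, hat φ ((2 : ℝ) ^ (-((j : ℤ) + 1)) • ξ) := by
      filter_upwards [continuous_norm.continuousAt.eventually_lt continuousAt_const hN] with ζ hζ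
      exact hφ.lpSymbol_zero_eq hζ.le
    refine ContDiffAt.congr_of_eventuallyEq ?_ hev
    exact (contDiff_const.sub (ContDiff.sum fun j _ =>
      (contDiff_hat φ).comp (contDiff_const_smul _))).contDiffAt
  · exact (contDiff_hat φ).comp (contDiff_const_smul _)

lemma IsLPChar.hasCompactSupport_lpSymbol (hφ : IsLPChar φ) (k : ℕ) :
    HasCompactSupport (lpSymbol φ k) := by
  refine HasCompactSupport.of_support_subset_isCompact
    (isCompact_closedBall (0 : Eucl n) (2 ^ (k + 1))) fun ξ hξ => ?_
  rw [mem_closedBall_zero_iff]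
  by_contra! h
  refine hξ ?_
  rcases k with _ | k
  · exact hφ.lpSymbol_zero_eq_zero (by simpa using h.le)
  · refine hφ.hat_eq_zero (Or.inr ?_)
    rw [norm_dyadic_smul, le_inv_mul_iff₀ (by positivity)]
    rw [pow_succ] at h
    exact h.le

/-- The partial sums of the dyadic partition telescope to dilates of `φ̂₀`. -/
lemma IsLPChar.sum_lpSymbol (hφ : IsLPChar φ) (ν : ℕ) (ξ : Eucl n) :
    ∑ k ∈ Finset.range (ν + 1), lpSymbol φ k ξ = lpSymbol φ 0 (((2 : ℝ) ^ ν)⁻¹ • ξ) := by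
  induction ν with
  | zero => simp
  | succ ν ih =>
    rw [Finset.sum_range_succ, ih]
    obtain ⟨N, hN⟩ := pow_unbounded_of_one_lt ‖((2 : ℝ) ^ ν)⁻¹ • ξ‖ (one_lt_two (α := ℝ))
    have h2 : ((2 : ℝ) ^ (ν + 1))⁻¹ • ξ = (2 : ℝ)⁻¹ • ((2 : ℝ) ^ ν)⁻¹ • ξ := by
      rw [smul_smul, pow_succ, mul_inv, mul_comm]
    have h3 : (2 : ℝ) ^ (-((ν : ℤ) + 1)) • ξ = (2 : ℝ)⁻¹ • ((2 : ℝ) ^ ν)⁻¹ • ξ := by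
      rw [← h2, zpow_neg]; norm_cast
    rw [h2, show lpSymbol φ (ν + 1) ξ = hat φ ((2 : ℝ) ^ (-((ν : ℤ) + 1)) • ξ) from rfl, h3]
    set ζ := ((2 : ℝ) ^ ν)⁻¹ • ξ
    have hN' : ‖(2 : ℝ)⁻¹ • ζ‖ ≤ 2 ^ N := by
      rw [norm_smul, Real.norm_of_nonneg (by positivity)]
      linarith [norm_nonneg ζ]
    rw [hφ.lpSymbol_zero_eq (N := N + 1) (hN.le.trans (by gcongr <;> norm_num)),
      hφ.lpSymbol_zero_eq hN', Finset.sum_range_succ']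
    have e : ∀ j : ℕ, (2 : ℝ) ^ (-((j : ℤ) + 1)) • (2 : ℝ)⁻¹ • ζ =
        (2 : ℝ) ^ (-(((j + 1 : ℕ) : ℤ) + 1)) • ζ := by
      intro j
      rw [smul_smul, ← zpow_neg_one, ← zpow_add₀ two_ne_zero]
      congr 2
    simp only [e]
    rw [show (2 : ℝ) ^ (-(((0 : ℕ) : ℤ) + 1)) = 2⁻¹ by norm_num]
    ring

/-- The inverse Fourier transform of the `k`-th symbol as a Schwartz function. -/
def lpSchwartz (hφ : IsLPChar φ) (k : ℕ) : 𝓢(Eucl n, ℂ) :=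
  𝓕⁻ (HasCompactSupport.toSchwartzMap (f := fun ξ => lpSymbol φ k ((2 * Real.pi) • ξ))
    ((hφ.hasCompactSupport_lpSymbol k).comp_smul (by positivity))
    ((hφ.contDiff_lpSymbol k).comp (contDiff_const_smul _)))

/-- The kernel `φ₀` as a Schwartz function. -/
def lpKernel (hφ : IsLPChar φ) : 𝓢(Eucl n, ℝ) :=
  (lpSchwartz hφ 0).postcompCLM Complex.reCLM

lemma lpSeq_eq_re (hφ : IsLPChar φ) (k : ℕ) (x : Eucl n) :
    lpSeq φ k x = (lpSchwartz hφ k x).re := by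
  rw [lpSeq, lpSchwartz, SchwartzMap.fourierInv_coe]
  rfl

lemma lpKernel_apply (hφ : IsLPChar φ) (x : Eucl n) :
    lpKernel hφ x = (𝓕⁻ (fun ξ => lpSymbol φ 0 ((2 * Real.pi) • ξ)) x).re := by
  rw [← lpSeq, lpSeq_eq_re hφ]
  rfl

lemma continuous_lpSeq (hφ : IsLPChar φ) (k : ℕ) : Continuous (lpSeq φ k) := by
  have : lpSeq φ k = fun x => (lpSchwartz hφ k x).re := funext (lpSeq_eq_re hφ k)
  rw [this]
  exact Complex.continuous_re.comp (lpSchwartz hφ k).continuous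

lemma integral_lpKernel (hφ : IsLPChar φ) : ∫ z, lpKernel hφ z = 1 := by
  have h1 : ∫ z, lpKernel hφ z = (∫ z, lpSchwartz hφ 0 z).re :=
    Complex.reCLM.integral_comp_comm (lpSchwartz hφ 0).integrable
  have h2 : ∫ z, lpSchwartz hφ 0 z = 𝓕 (lpSchwartz hφ 0) 0 := by
    rw [SchwartzMap.fourier_coe, Real.fourier_eq']
    simp
  rw [h1, h2, lpSchwartz, FourierTransform.fourier_fourierInv_eq]
  have h3 : lpSymbol φ 0 ((2 * Real.pi) • (0 : Eucl n)) = 1 := by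
    rw [hφ.lpSymbol_zero_eq (N := 0) (by simp)]; simp
  have : (HasCompactSupport.toSchwartzMap (f := fun ξ => lpSymbol φ 0 ((2 * Real.pi) • ξ))
    ((hφ.hasCompactSupport_lpSymbol 0).comp_smul (by positivity))
    ((hφ.contDiff_lpSymbol 0).comp (contDiff_const_smul _))) (0 : Eucl n) =
      lpSymbol φ 0 ((2 * Real.pi) • (0 : Eucl n)) := rfl
  rw [this, h3, Complex.one_re]

lemma fourierInv_comp_smul (g : Eucl n → ℂ) {s : ℝ} (hs : 0 < s) (x : Eucl n) :
    𝓕⁻ (fun ξ => g (s • ξ)) x = (s ^ n)⁻¹ • 𝓕⁻ g (s⁻¹ • x) := by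
  rw [Real.fourierInv_eq', Real.fourierInv_eq']
  have := Measure.integral_comp_smul_of_nonneg volume
    (fun v : Eucl n => Complex.exp (↑(2 * Real.pi * inner ℝ v (s⁻¹ • x)) * Complex.I) • g v) s
    (hR := hs.le)
  rw [finrank_euclideanSpace_fin] at this
  rw [← this]
  refine integral_congr_ae (Eventually.of_forall fun v => ?_)
  simp only [inner_smul_left, inner_smul_right, conj_trivial, inv_mul_cancel_left₀ hs.ne']

/-- The kernel of `S_ν` is the dilate by `2^ν` of `φ₀`. -/
lemma sum_lpSeq (hφ : IsLPChar φ) (ν : ℕ) (x : Eucl n) :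
    ∑ k ∈ Finset.range (ν + 1), lpSeq φ k x =
      (((2 : ℝ) ^ (-(ν : ℤ))) ^ n)⁻¹ * lpKernel hφ (((2 : ℝ) ^ (-(ν : ℤ)))⁻¹ • x) := by
  set s : ℝ := (2 : ℝ) ^ (-(ν : ℤ)) with hs
  have hs0 : 0 < s := by positivity
  have hs' : ((2 : ℝ) ^ ν)⁻¹ = s := by rw [hs, zpow_neg]; norm_cast
  have h1 : ∑ k ∈ Finset.range (ν + 1), 𝓕⁻ (fun ξ => lpSymbol φ k ((2 * Real.pi) • ξ)) x =
      𝓕⁻ (fun ξ => lpSymbol φ 0 ((2 * Real.pi) • s • ξ)) x := by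
    simp only [Real.fourierInv_eq']
    rw [← integral_finsetSum]
    · refine integral_congr_ae (Eventually.of_forall fun ξ => ?_)
      simp only
      rw [← Finset.smul_sum, hφ.sum_lpSymbol, hs', smul_comm]
    · intro k _
      have hc : Continuous (lpSymbol φ k) := (hφ.contDiff_lpSymbol k).continuous
      refine Continuous.integrable_of_hasCompactSupport (by fun_prop) ?_
      have hk := (hφ.hasCompactSupport_lpSymbol k).comp_smul
        (show (2 * Real.pi) ≠ 0 by positivity)
      refine hk.mono fun ξ hξ h0 => hξ ?_
      simp only [h0, smul_zero]
  have h2 := fourierInv_comp_smul (fun ξ : Eucl n => lpSymbol φ 0 ((2 * Real.pi) • ξ)) hs0 x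
  rw [h2] at h1
  simp only [lpSeq]
  rw [← Complex.re_sum, h1, lpKernel_apply, Complex.smul_re, smul_eq_mul]

/-- `S_ν` is the mollification at scale `2^{-ν}` with the kernel `φ₀`. -/
theorem lpSum_eq_moll (hφ : IsLPChar φ) (ν : ℕ) {f : Eucl n → Eucl n} (hf : Continuous f)
    (hfc : HasCompactSupport f) :
    lpSum φ ν f = moll (lpKernel hφ) ((2 : ℝ) ^ (-(ν : ℤ))) f := by
  funext x
  have hs0 : 0 < (2 : ℝ) ^ (-(ν : ℤ)) := by positivity
  rw [moll_eq_integral_kernel hs0]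
  simp only [lpSum, lpBlock, convolution, ContinuousLinearMap.lsmul_apply]
  rw [← integral_finsetSum, ← integral_smul, ← integral_sub_left_eq_self _ volume x]
  · refine integral_congr_ae (Eventually.of_forall fun y => ?_)
    simp only [sub_sub_cancel]
    rw [← Finset.sum_smul, sum_lpSeq hφ, smul_smul]
  · intro k _
    refine Continuous.integrable_of_hasCompactSupport
      ((continuous_lpSeq hφ k).smul (by fun_prop)) ?_
    have hk := hfc.comp_homeomorph (Homeomorph.subLeft x)
    refine hk.mono fun y hy h0 => hy ?_
    have h0' : f (x - y) = 0 := h0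
    simp only [h0', smul_zero]

end LP

/-! ### Osgood moduli -/

section Osgood

variable {η : ℝ → ℝ}

lemma IsModulus.continuousOn_one_div (hη : IsModulus η) : ContinuousOn (fun r => 1 / η r) (Ioi 0) :=
  continuousOn_const.div hη.continuousOn fun r hr => (hη.pos r hr).ne'

lemma IsModulus.intervalIntegrable_one_div (hη : IsModulus η) {a b : ℝ} (ha : 0 < a) (hb : 0 < b) :
    IntervalIntegrable (fun r => 1 / η r) volume a b :=
  (hη.continuousOn_one_div.mono fun _ hx =>
    lt_of_lt_of_le (lt_min ha hb) hx.1).intervalIntegrable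

lemma IsModulus.lintegral_one_div (hη : IsModulus η) {a b : ℝ} (ha : 0 < a) (hab : a ≤ b) :
    ∫⁻ r in Ioo a b, ENNReal.ofReal (1 / η r) = ENNReal.ofReal (∫ r in a..b, 1 / η r) := by
  have hi := (intervalIntegrable_iff_integrableOn_Ioo_of_le hab).1
    (hη.intervalIntegrable_one_div ha (ha.trans_le hab))
  rw [intervalIntegral.integral_of_le hab, integral_Ioc_eq_integral_Ioo,
    ofReal_integral_eq_lintegral_ofReal hi]
  refine (ae_restrict_iff' measurableSet_Ioo).2 (Eventually.of_forall fun r hr => ?_)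
  exact one_div_nonneg.2 (hη.pos r (ha.trans hr.1)).le

/-- The divergence of `∫ dr / η(r)` takes place at `0`. -/
lemma IsOsgoodModulus.lintegral_Ioo_eq_top (hη : IsOsgoodModulus η) {r : ℝ} (hr : 0 < r) :
    ∫⁻ x in Ioo 0 r, ENNReal.ofReal (1 / η x) = ⊤ := by
  rcases le_or_gt 1 r with h | h
  · refine top_le_iff.1 ?_
    rw [← hη.lintegral_eq_top]
    exact lintegral_mono_set (Ioo_subset_Ioo_right h)
  · by_contra hne
    have h1 : ∫⁻ x in Ico r 1, ENNReal.ofReal (1 / η x) < ⊤ := by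
      refine setLIntegral_lt_top_of_le_nnreal (by simp) ⟨(1 / η r).toNNReal, fun x hx => ?_⟩
      refine ENNReal.ofReal_le_ofReal ?_
      exact one_div_le_one_div_of_le (hη.pos r hr)
        (hη.monotoneOn (mem_Ioi.2 hr) (mem_Ioi.2 (hr.trans_le hx.1)) hx.1)
    have h2 := lintegral_union_le (μ := volume) (fun x => ENNReal.ofReal (1 / η x)) (Ioo 0 r) (Ico r 1)
    rw [Ioo_union_Ico_eq_Ioo hr h.le, hη.lintegral_eq_top, top_le_iff,
      ENNReal.add_eq_top] at h2
    exact h2.elim hne h1.ne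

lemma IsOsgoodModulus.exists_lt_integral (hη : IsOsgoodModulus η) {r : ℝ} (hr : 0 < r) (L : ℝ) :
    ∃ ε, 0 < ε ∧ ε < r ∧ L < ∫ x in ε..r, 1 / η x := by
  have hU : Ioo 0 r = ⋃ k : ℕ, Ioo (r / (k + 2)) r := by
    ext x
    simp only [mem_Ioo, mem_iUnion]
    constructor
    · rintro ⟨h0, h1⟩
      obtain ⟨k, hk⟩ := exists_nat_gt (r / x)
      refine ⟨k, ?_, h1⟩
      rw [div_lt_iff₀ h0] at hk
      rw [div_lt_iff₀ (by positivity)]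
      nlinarith
    · rintro ⟨k, h0, h1⟩
      exact ⟨lt_trans (by positivity) h0, h1⟩
  have htop := hη.lintegral_Ioo_eq_top hr
  have hmono : Monotone fun k : ℕ => Ioo (r / ((k : ℝ) + 2)) r := fun a b hab =>
    Ioo_subset_Ioo_left (by gcongr)
  rw [hU, setLIntegral_iUnion_of_directed _ hmono.directed_le] at htop
  obtain ⟨k, hk⟩ := lt_iSup_iff.1 (htop ▸ ENNReal.ofReal_lt_top : ENNReal.ofReal L < _)
  have h0 : 0 < r / ((k : ℝ) + 2) := by positivity
  have h1 : r / ((k : ℝ) + 2) < r := div_lt_self hr (by linarith [Nat.cast_nonneg (α := ℝ) k])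
  rw [hη.lintegral_one_div h0 h1.le] at hk
  exact ⟨_, h0, h1, (ENNReal.ofReal_lt_ofReal_iff'.1 hk).1⟩

end Osgood

section OsgoodMajorant

variable {η : ℝ → ℝ}

lemma IsOsgoodModulus.exists_next (hη : IsOsgoodModulus η) {r : ℝ} (hr : 0 < r) (L : ℝ) :
    ∃ r', 0 < r' ∧ r' < r ∧ η r' ≤ η r / 2 ∧ L ≤ ∫ x in r'..r, 1 / η x := by
  obtain ⟨ε, h0, h1, h2⟩ := hη.exists_lt_integral hr L
  have hev : ∀ᶠ x in 𝓝[>] (0 : ℝ), η x < η r / 2 :=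
    hη.tendsto_zero.eventually_lt_const (half_pos (hη.pos r hr))
  obtain ⟨r', ⟨h3, h4⟩⟩ := (hev.and (Ioo_mem_nhdsGT h0)).exists
  refine ⟨r', h4.1, h4.2.trans h1, h3.le, h2.le.trans ?_⟩
  rw [← intervalIntegral.integral_add_adjacent_intervals
    (hη.intervalIntegrable_one_div h4.1 h0) (hη.intervalIntegrable_one_div h0 hr)]
  have : 0 ≤ ∫ x in r'..ε, 1 / η x := by
    refine intervalIntegral.integral_nonneg h4.2.le fun x hx => ?_
    exact one_div_nonneg.2 (hη.pos x (h4.1.trans_le hx.1)).le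
  linarith

/-- Scales at which `η` at least halves, while `∫ dr / η(r)` gains `k + 3` from one to the
next. -/
lemma IsOsgoodModulus.exists_scales (hη : IsOsgoodModulus η) :
    ∃ r : ℕ → ℝ, r 0 = 1 ∧ (∀ k, 0 < r k) ∧ (∀ k, r (k + 1) < r k) ∧
      (∀ k, η (r (k + 1)) ≤ η (r k) / 2) ∧
      ∀ k : ℕ, (k : ℝ) + 3 ≤ ∫ x in r (k + 1)..r k, 1 / η x := by
  choose! g g1 g2 g3 g4 using fun (r : ℝ) (L : ℝ) (hr : 0 < r) => hη.exists_next hr L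
  let r : ℕ → ℝ := fun k => Nat.rec 1 (fun k x => g x ((k : ℝ) + 3)) k
  have hr : ∀ k, 0 < r k := by
    intro k
    induction k with
    | zero => exact one_pos
    | succ k ih => exact g1 _ _ ih
  exact ⟨r, rfl, hr, fun k => g2 _ _ (hr k), fun k => g3 _ _ (hr k), fun k => g4 _ _ (hr k)⟩

/-- Every Osgood modulus is negligible near `0` against another one. With scales `r_k` as above,
`ζ = ∑ k, min η (η (r k))` is concave as a sum of minima of concave functions, and on
`(r (k+1), r k)` it lies between `k η` and `(k + 3) η`. -/
theorem IsOsgoodModulus.exists_isLittleO (hη : IsOsgoodModulus η) :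
    ∃ ζ : ℝ → ℝ, IsOsgoodModulus ζ ∧
      ∀ c, 0 < c → ∃ r₀, 0 < r₀ ∧ ∀ r, 0 < r → r < r₀ → η r ≤ c * ζ r := by
  obtain ⟨r, hr0, hrpos, hrlt, hhalf, hint⟩ := hη.exists_scales
  have hanti : Antitone r := antitone_nat_of_succ_le fun k => (hrlt k).le
  have hpos : ∀ k, 0 < η (r k) := fun k => hη.pos _ (hrpos k)
  have hgeom : ∀ m i, η (r (m + i)) ≤ η (r m) * (1 / 2) ^ i := by
    intro m i
    induction i with
    | zero => simp
    | succ i ih =>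
      calc η (r (m + i + 1)) ≤ η (r (m + i)) / 2 := hhalf _
        _ ≤ η (r m) * (1 / 2) ^ i / 2 := by gcongr
        _ = _ := by rw [pow_succ]; ring
  have hsum : ∀ m, Summable fun i => η (r (m + i)) := fun m =>
    Summable.of_nonneg_of_le (fun i => (hpos _).le) (hgeom m)
      ((summable_geometric_of_lt_one (by norm_num) (by norm_num)).mul_left _)
  have hsum0 : Summable fun k => η (r k) := by simpa using hsum 0
  have hs : ∀ x, 0 < x → Summable fun k => min (η x) (η (r k)) := fun x hx =>
    Summable.of_nonneg_of_le (fun k => le_min (hη.pos x hx).le (hpos k).le)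
      (fun k => min_le_right _ _) hsum0
  have hnn : ∀ x, 0 < x → ∀ k, 0 ≤ min (η x) (η (r k)) := fun x hx k =>
    le_min (hη.pos x hx).le (hpos k).le
  -- the lower bound `k η ≤ ζ` below `r k`
  have hlow : ∀ (K : ℕ) (x : ℝ), 0 < x → x < r K →
      (K : ℝ) * η x ≤ ∑' k, min (η x) (η (r k)) := by
    intro K x hx hxK
    have h1 : ∑ k ∈ Finset.range K, min (η x) (η (r k)) = (K : ℝ) * η x := by
      rw [Finset.sum_congr rfl (g := fun _ => η x)]
      · simp
      · intro k hk
        have hle : x ≤ r k := hxK.le.trans (hanti (Finset.mem_range.1 hk).le)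
        exact min_eq_left (hη.monotoneOn (mem_Ioi.2 hx) (mem_Ioi.2 (hrpos k)) hle)
    rw [← h1]
    exact (hs x hx).sum_le_tsum _ fun k _ => hnn x hx k
  -- the upper bound `ζ ≤ (k + 3) η` above `r (k + 1)`
  have hup : ∀ (k : ℕ) (x : ℝ), r (k + 1) < x →
      ∑' k, min (η x) (η (r k)) ≤ ((k : ℝ) + 3) * η x := by
    intro k x hx
    have hx0 := (hrpos (k + 1)).trans hx
    rw [← (hs x hx0).sum_add_tsum_nat_add (k + 1)]
    have h1 : ∑ i ∈ Finset.range (k + 1), min (η x) (η (r i)) ≤ ((k : ℝ) + 1) * η x := by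
      refine (Finset.sum_le_sum fun i _ => min_le_left (η x) (η (r i))).trans ?_
      simp
    have h2 : ∑' i, min (η x) (η (r (i + (k + 1)))) ≤ 2 * η x := by
      have h3 : ∀ i, min (η x) (η (r (i + (k + 1)))) ≤ η (r (k + 1)) * (1 / 2) ^ i := fun i => by
        rw [add_comm i]
        exact (min_le_right _ _).trans (hgeom (k + 1) i)
      have h4 := Summable.tsum_le_tsum h3 ((summable_nat_add_iff (k + 1)).2 (hs x hx0))
        ((summable_geometric_of_lt_one (by norm_num) (by norm_num)).mul_left _)
      rw [tsum_mul_left, tsum_geometric_of_lt_one (by norm_num) (by norm_num)] at h4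
      have h5 := hη.monotoneOn (mem_Ioi.2 (hrpos (k + 1))) (mem_Ioi.2 hx0) hx.le
      norm_num at h4
      linarith
    linarith
  have hζpos : ∀ x, 0 < x → 0 < ∑' k, min (η x) (η (r k)) := fun x hx =>
    (hs x hx).tsum_pos (hnn x hx) 0 (lt_min (hη.pos x hx) (hpos 0))
  refine ⟨fun x => ∑' k, min (η x) (η (r k)), ⟨⟨hζpos, ?_, ?_, ?_, ?_⟩, ?_⟩, ?_⟩
  · refine continuousOn_tsum (fun k => hη.continuousOn.inf continuousOn_const) hsum0 ?_
    intro k x hx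
    rw [Real.norm_of_nonneg (hnn x hx k)]
    exact min_le_right _ _
  · refine ⟨convex_Ioi 0, fun x hx y hy a b ha hb hab => ?_⟩
    have hxy := (convex_Ioi (0 : ℝ)) hx hy ha hb hab
    simp only [smul_eq_mul]
    rw [← tsum_mul_left, ← tsum_mul_left,
      ← ((hs x hx).mul_left a).tsum_add ((hs y hy).mul_left b)]
    refine Summable.tsum_le_tsum (fun k => ?_)
      (((hs x hx).mul_left a).add ((hs y hy).mul_left b)) (hs _ hxy)
    exact (hη.concaveOn.inf (concaveOn_const (η (r k)) (convex_Ioi 0))).2 hx hy ha hb hab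
  · intro x hx y hy hxy
    exact Summable.tsum_le_tsum (fun k => min_le_min_right _ (hη.monotoneOn hx hy hxy))
      (hs x hx) (hs y hy)
  · have h : Tendsto (fun x => ∑' k, min (η x) (η (r k))) (𝓝[>] (0 : ℝ))
        (𝓝 (∑' _ : ℕ, (0 : ℝ))) := by
      refine tendsto_tsum_of_dominated_convergence hsum0 (fun k => ?_) ?_
      · have := hη.tendsto_zero.min (tendsto_const_nhds (x := η (r k)))
        rwa [min_eq_left (hpos k).le] at this
      · filter_upwards [self_mem_nhdsWithin] with x hx k
        rw [Real.norm_of_nonneg (hnn x hx k)]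
        exact min_le_right _ _
    simpa using h
  -- each interval between two scales contributes at least `1` to `∫ dr / ζ(r)`
  · have hsub : (⋃ k, Ioo (r (k + 1)) (r k)) ⊆ Ioo 0 1 := iUnion_subset fun k x hx =>
      ⟨(hrpos _).trans hx.1, hx.2.trans_le (hr0 ▸ hanti (Nat.zero_le k))⟩
    refine top_le_iff.1 (le_trans ?_ (lintegral_mono_set hsub))
    rw [lintegral_iUnion (fun k => measurableSet_Ioo)
      (by simpa using hanti.pairwise_disjoint_on_Ioo_succ)]
    have h1 : ∀ k, (1 : ℝ≥0∞) ≤ ∫⁻ x in Ioo (r (k + 1)) (r k),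
        ENNReal.ofReal (1 / ∑' k, min (η x) (η (r k))) := by
      intro k
      have hk3 : (0 : ℝ) < (k : ℝ) + 3 := by positivity
      calc (1 : ℝ≥0∞) = ENNReal.ofReal ((1 / ((k : ℝ) + 3)) * ((k : ℝ) + 3)) := by
            rw [one_div_mul_cancel hk3.ne', ENNReal.ofReal_one]
        _ ≤ ENNReal.ofReal ((1 / ((k : ℝ) + 3)) * ∫ x in r (k + 1)..r k, 1 / η x) := by
            gcongr; exact hint k
        _ = ∫⁻ x in Ioo (r (k + 1)) (r k),
              ENNReal.ofReal (1 / ((k : ℝ) + 3)) * ENNReal.ofReal (1 / η x) := by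
            rw [lintegral_const_mul' _ _ ENNReal.ofReal_ne_top,
              hη.lintegral_one_div (hrpos _) (hrlt k).le, ENNReal.ofReal_mul (by positivity)]
        _ ≤ _ := by
            refine setLIntegral_mono' measurableSet_Ioo fun x hx => ?_
            have hx0 := (hrpos (k + 1)).trans hx.1
            rw [← ENNReal.ofReal_mul (by positivity), one_div_mul_one_div]
            exact ENNReal.ofReal_le_ofReal
              (one_div_le_one_div_of_le (hζpos x hx0) (hup k x hx.1))
    refine le_trans ?_ (ENNReal.tsum_le_tsum h1)
    rw [ENNReal.tsum_const_eq_top_of_ne_zero one_ne_zero]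
  · intro c hc
    obtain ⟨K, hK⟩ := exists_nat_gt (1 / c)
    refine ⟨r K, hrpos K, fun x hx hxK => ?_⟩
    rw [div_lt_iff₀ hc] at hK
    have h1 := mul_le_mul_of_nonneg_left (hlow K x hx hxK) hc.le
    nlinarith [hη.pos x hx]

end OsgoodMajorant

/-! ### Flows of Osgood vector fields -/

section Flow

variable {η : ℝ → ℝ}

/-- Osgood's stability estimate. If `V` has modulus `C η` and `W` is uniformly close to `V`, then
their integral curves from the same point stay close up to a given time. The curves are compared
through `N = (|γ₁ - γ₂|² + d²)^{1/2}`, which is differentiable and satisfies `|N'| ≤ (C + 1) η(N)`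
when `|V - W| ≤ η d`. -/
theorem IsOsgoodModulus.exists_stability (hη : IsOsgoodModulus η) {C : ℝ} (hC : 0 ≤ C) (T : ℝ)
    {c : ℝ} (hc : 0 < c) :
    ∃ ε, 0 < ε ∧ ∀ V W : Eucl n → Eucl n, HasMod η C V → (∀ x, ‖V x - W x‖ ≤ ε) →
      ∀ (S : Set ℝ) (γ₁ γ₂ : ℝ → Eucl n), S.OrdConnected → 0 ∈ S → γ₁ 0 = γ₂ 0 →
        (∀ s ∈ S, HasDerivAt γ₁ (V (γ₁ s)) s) → (∀ s ∈ S, HasDerivAt γ₂ (W (γ₂ s)) s) →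
        ∀ t ∈ S, |t| ≤ T → ‖γ₁ t - γ₂ t‖ ≤ c := by
  obtain ⟨d, hd, hdc, hint⟩ := hη.exists_lt_integral hc ((C + 1) * T)
  refine ⟨η d, hη.pos d hd, fun V W hV hVW S γ₁ γ₂ hS h0 hinit h₁ h₂ t ht htT => ?_⟩
  set u : ℝ → Eucl n := fun s => γ₁ s - γ₂ s with hu
  set N : ℝ → ℝ := fun s => Real.sqrt (‖u s‖ ^ 2 + d ^ 2) with hN
  have hNd : ∀ s, d ≤ N s := fun s => Real.le_sqrt_of_sq_le (by nlinarith [sq_nonneg ‖u s‖])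
  have hNu : ∀ s, ‖u s‖ ≤ N s := fun s => Real.le_sqrt_of_sq_le (by nlinarith [sq_nonneg d])
  have hN0 : ∀ s, 0 < N s := fun s => hd.trans_le (hNd s)
  have hderiv : ∀ s ∈ S, HasDerivWithinAt (fun s => ∫ r in d..N s, 1 / η r)
      (1 / η (N s) * (inner ℝ (u s) (V (γ₁ s) - W (γ₂ s)) / N s)) S s := by
    intro s hs
    have hud : HasDerivAt u (V (γ₁ s) - W (γ₂ s)) s :=
      (h₁ s hs).sub (h₂ s hs)
    have hsq := ((hud.norm_sq).add_const (d ^ 2)).sqrt (by positivity)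
    have hNder : HasDerivAt N (inner ℝ (u s) (V (γ₁ s) - W (γ₂ s)) / N s) s := by
      convert hsq using 1
      simp only [hN]
      rw [mul_div_mul_left _ _ two_ne_zero]
    have hG : HasDerivAt (fun y => ∫ r in d..y, 1 / η r) (1 / η (N s)) (N s) := by
      have hcont := hη.continuousOn_one_div
      refine intervalIntegral.integral_hasDerivAt_right
        (hη.intervalIntegrable_one_div hd (hN0 s)) ?_
        (hcont.continuousAt (Ioi_mem_nhds (hN0 s)))
      exact hcont.stronglyMeasurableAtFilter isOpen_Ioi _ (hN0 s)
    exact (hG.comp s hNder).hasDerivWithinAt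
  -- `∫_d^N dr / η(r)` changes at speed at most `C + 1`, but has to exceed `(C + 1) T` for `N ≥ c`
  have hbound : ∀ s ∈ S,
      ‖1 / η (N s) * (inner ℝ (u s) (V (γ₁ s) - W (γ₂ s)) / N s)‖ ≤ C + 1 := by
    intro s _
    have hηN := hη.pos _ (hN0 s)
    have h3 : ‖V (γ₁ s) - W (γ₂ s)‖ ≤ (C + 1) * η (N s) := by
      have h4 : ‖V (γ₁ s) - V (γ₂ s)‖ ≤ C * η (N s) := by
        rcases eq_or_ne (γ₁ s) (γ₂ s) with h | h
        · rw [h, sub_self, norm_zero]; positivity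
        · refine (hV _ _ h).trans ?_
          gcongr
          exact hη.monotoneOn (mem_Ioi.2 (norm_pos_iff.2 (sub_ne_zero.2 h)))
            (mem_Ioi.2 (hN0 s)) (hNu s)
      have h5 : η d ≤ η (N s) :=
        hη.monotoneOn (mem_Ioi.2 hd) (mem_Ioi.2 (hN0 s)) (hNd s)
      have h6 := norm_add_le (V (γ₁ s) - V (γ₂ s)) (V (γ₂ s) - W (γ₂ s))
      rw [sub_add_sub_cancel] at h6
      linarith [hVW (γ₂ s)]
    have h7 : |inner ℝ (u s) (V (γ₁ s) - W (γ₂ s))| ≤ N s * ((C + 1) * η (N s)) :=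
      (abs_real_inner_le_norm _ _).trans
        (mul_le_mul (hNu s) h3 (norm_nonneg _) (hN0 s).le)
    rw [Real.norm_eq_abs, abs_mul, abs_div (inner ℝ _ _), abs_of_pos (hN0 s),
      abs_of_pos (one_div_pos.2 hηN), one_div_mul_eq_div, div_le_iff₀ hηN, div_le_iff₀ (hN0 s)]
    linarith
  have hmv := hS.convex.norm_image_sub_le_of_norm_hasDerivWithin_le hderiv hbound h0 ht
  have hN00 : N 0 = d := by
    simp only [hN, hu, hinit, sub_self, norm_zero]
    rw [zero_pow two_ne_zero, zero_add, Real.sqrt_sq hd.le]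
  simp only [hN00, intervalIntegral.integral_same, sub_zero, Real.norm_eq_abs] at hmv
  by_contra! hlt
  have hcN : c ≤ N t := hlt.le.trans (hNu t)
  have h8 : ∫ r in d..c, 1 / η r ≤ ∫ r in d..N t, 1 / η r := by
    rw [← intervalIntegral.integral_add_adjacent_intervals
      (hη.intervalIntegrable_one_div hd hc) (hη.intervalIntegrable_one_div hc (hN0 t))]
    have : 0 ≤ ∫ x in c..N t, 1 / η x := by
      refine intervalIntegral.integral_nonneg hcN fun x hx => ?_
      exact one_div_nonneg.2 (hη.pos x (hc.trans_le hx.1)).le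
    linarith
  have h9 : (C + 1) * |t| ≤ (C + 1) * T := by gcongr
  linarith [le_abs_self (∫ r in d..N t, 1 / η r)]

end Flow

section FlowConvergence

variable {η : ℝ → ℝ}

/-- Smooth cut-off functions. -/
lemma exists_testFunction_eq_one {K Ω : Set (Eucl n)} (hK : IsCompact K) (hΩ : IsOpen Ω)
    (h : K ⊆ Ω) : ∃ χ : Eucl n → ℝ, IsTestFunction Ω χ ∧ ∀ x ∈ K, χ x = 1 := by
  obtain ⟨V, hV, h1, h2, h3⟩ := exists_open_between_and_isCompact_closure hK hΩ h
  obtain ⟨f, hf0, hf1, -⟩ := exists_contMDiffMap_zero_one_of_isClosed (n := (⊤ : ℕ∞))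
    (modelWithCornersSelf ℝ (Eucl n)) hV.isClosed_compl hK.isClosed
    (disjoint_compl_left_iff_subset.2 h1)
  have hsupp : tsupport f ⊆ closure V := closure_mono fun x hx => by
    by_contra hxV
    exact hx (hf0 hxV)
  exact ⟨f, ⟨f.contMDiff.contDiff, h3.of_isClosed_subset (isClosed_tsupport _) hsupp,
    hsupp.trans h2⟩, fun x hx => hf1 hx⟩

lemma HasMod.uniformContinuous {F : Type*} [NormedAddCommGroup F] {H : ℝ} {f : Eucl n → F}
    (hf : HasMod η H f) (hη : IsModulus η) : UniformContinuous f := by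
  rw [Metric.uniformContinuous_iff]
  intro ε hε
  have h1 : Tendsto (fun r => H * η r) (𝓝[>] 0) (𝓝 0) := by
    simpa using hη.tendsto_zero.const_mul H
  obtain ⟨d, hd, hsub⟩ := mem_nhdsGT_iff_exists_Ioo_subset.1 (h1.eventually_lt_const hε)
  refine ⟨d, hd, fun x y hxy => ?_⟩
  rcases eq_or_ne x y with rfl | hne
  · simpa using hε
  · rw [dist_eq_norm] at hxy ⊢
    exact (hf x y hne).trans_lt (hsub ⟨norm_pos_iff.2 (sub_ne_zero.2 hne), hxy⟩)

/-- Global existence, on a prescribed time interval, for bounded `C¹` vector fields. -/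
lemma exists_isSolution_of_contDiff {V : Eucl n → Eucl n} (hV : ContDiff ℝ 1 V) {M : ℝ}
    (hM : ∀ x, ‖V x‖ ≤ M) {T : ℝ} (hT : 0 < T) (p : Eucl n) :
    ∃ γ, IsSolution univ V p (Ioo (-T) T) γ := by
  have hM0 : 0 ≤ M := (norm_nonneg _).trans (hM 0)
  let M' : NNReal := ⟨M, hM0⟩
  -- on the ball of radius `M' T` around `p` the curve cannot run out before time `T`
  let T' : NNReal := ⟨T, hT.le⟩
  obtain ⟨K, hK⟩ := hV.contDiffOn.exists_lipschitzOnWith one_ne_zero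
    (convex_closedBall p (M' * T' : NNReal)) (isCompact_closedBall _ _)
  have hpl : IsPicardLindelof (fun _ => V) (tmin := -T) (tmax := T)
      ⟨0, by constructor <;> linarith⟩ p (M' * T') 0 M' K := by
    refine IsPicardLindelof.of_time_independent (fun x _ => hM x) hK ?_
    simp only [sub_zero, zero_sub, neg_neg, max_self, NNReal.coe_mul, NNReal.coe_zero]
    exact le_rfl
  obtain ⟨γ, h0, hγ⟩ := hpl.exists_eq_forall_mem_Icc_hasDerivWithinAt₀
  exact ⟨γ, isOpen_Ioo, ordConnected_Ioo, ⟨by linarith, hT⟩, h0, fun _ _ => mem_univ _,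
    fun t ht => (hγ t (Ioo_subset_Icc_self ht)).hasDerivAt (Icc_mem_nhds ht.1 ht.2)⟩

/-- Integral curves of an Osgood vector field are unique. -/
lemma IsOsgoodModulus.eq_of_hasMod (hη : IsOsgoodModulus η) {C : ℝ} (hC : 0 ≤ C)
    {V : Eucl n → Eucl n} (hV : HasMod η C V) {S : Set ℝ} {γ₁ γ₂ : ℝ → Eucl n}
    (hS : S.OrdConnected) (h0 : 0 ∈ S) (hinit : γ₁ 0 = γ₂ 0)
    (h₁ : ∀ s ∈ S, HasDerivAt γ₁ (V (γ₁ s)) s) (h₂ : ∀ s ∈ S, HasDerivAt γ₂ (V (γ₂ s)) s)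
    {t : ℝ} (ht : t ∈ S) : γ₁ t = γ₂ t := by
  rw [← sub_eq_zero, ← norm_le_zero_iff]
  refine le_of_forall_pos_le_add fun c hc => ?_
  obtain ⟨ε, hε, h⟩ := hη.exists_stability (n := n) hC |t| hc
  rw [zero_add]
  exact h V V hV (fun x => by simpa using hε.le) S γ₁ γ₂ hS h0 hinit h₁ h₂ t ht le_rfl

/-- Uniqueness for local Osgood fields, by cutting the field off outside a neighbourhood of the two
curves. -/
lemma IsOsgoodModulus.eq_of_isSolution (hη : IsOsgoodModulus η) {Ω : Set (Eucl n)}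
    (hΩ : IsOpen Ω) {X : Eucl n → Eucl n} (hX : MemModLoc η Ω X) {p : Eucl n} {I J : Set ℝ}
    {γ₁ γ₂ : ℝ → Eucl n} (h₁ : IsSolution Ω X p I γ₁) (h₂ : IsSolution Ω X p J γ₂) {t : ℝ}
    (htI : t ∈ I) (htJ : t ∈ J) : γ₁ t = γ₂ t := by
  have hI : uIcc 0 t ⊆ I := h₁.ordConnected.uIcc_subset h₁.zero_mem htI
  have hJ : uIcc 0 t ⊆ J := h₂.ordConnected.uIcc_subset h₂.zero_mem htJ
  have hc₁ : ContinuousOn γ₁ (uIcc 0 t) := fun s hs =>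
    (h₁.hasDerivAt s (hI hs)).continuousAt.continuousWithinAt
  have hc₂ : ContinuousOn γ₂ (uIcc 0 t) := fun s hs =>
    (h₂.hasDerivAt s (hJ hs)).continuousAt.continuousWithinAt
  have hK : IsCompact (γ₁ '' uIcc 0 t ∪ γ₂ '' uIcc 0 t) :=
    (isCompact_uIcc.image_of_continuousOn hc₁).union (isCompact_uIcc.image_of_continuousOn hc₂)
  have hKΩ : γ₁ '' uIcc 0 t ∪ γ₂ '' uIcc 0 t ⊆ Ω := by
    rintro _ (⟨s, hs, rfl⟩ | ⟨s, hs, rfl⟩)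
    exacts [h₁.mem s (hI hs), h₂.mem s (hJ hs)]
  obtain ⟨χ, hχ, hχ1⟩ := exists_testFunction_eq_one hK hΩ hKΩ
  obtain ⟨H, hH, -, hmod⟩ := hX.exists_hasMod hη.toIsModulus hΩ hχ
  refine hη.eq_of_hasMod hH hmod (S := uIcc 0 t) ordConnected_uIcc left_mem_uIcc
    (h₁.initial.trans h₂.initial.symm) (fun s hs => ?_) (fun s hs => ?_) right_mem_uIcc
  · rw [hχ1 _ (Or.inl ⟨s, hs, rfl⟩), one_smul]
    exact h₁.hasDerivAt s (hI hs)
  · rw [hχ1 _ (Or.inr ⟨s, hs, rfl⟩), one_smul]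
    exact h₂.hasDerivAt s (hJ hs)

lemma mem_flowDomain_of_unique {M : Set (Eucl n)} {V : Eucl n → Eucl n} {p : Eucl n} {I : Set ℝ}
    {γ : ℝ → Eucl n} (h : IsSolution M V p I γ) {t : ℝ} (ht : t ∈ I)
    (huniq : ∀ J γ', IsSolution M V p J γ' → t ∈ J → γ' t = γ t) :
    (t, p) ∈ flowDomain M V ∧ flow M V t p = γ t := by
  have hex : ∃! q, Reaches M V t p q := by
    refine ⟨γ t, ⟨I, γ, h, ht, rfl⟩, ?_⟩
    rintro q ⟨J, γ', h', ht', rfl⟩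
    exact huniq J γ' h' ht'
  refine ⟨hex, ?_⟩
  rw [flow, dif_pos hex]
  exact hex.unique hex.choose_spec.1 ⟨I, γ, h, ht, rfl⟩

/-- Existence for a continuous Osgood field `f`: integral curves of fields with a common Osgood
modulus that converge uniformly to `f` form a Cauchy sequence by stability, and their limit is an
integral curve of `f`. -/
lemma IsOsgoodModulus.exists_isSolution_limit (hη : IsOsgoodModulus η) {C : ℝ} (hC : 0 ≤ C)
    {f : Eucl n → Eucl n} {G : ℕ → Eucl n → Eucl n} (hf : HasMod η C f)
    (hG : ∀ ν, HasMod η C (G ν))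
    (hlim : ∀ ε > 0, ∃ N, ∀ ν ≥ N, ∀ x, ‖G ν x - f x‖ ≤ ε) {T : ℝ}
    (hT : 0 < T) {p : Eucl n} {γ : ℕ → ℝ → Eucl n}
    (hγ : ∀ ν, IsSolution univ (G ν) p (Ioo (-T) T) (γ ν)) :
    ∃ γ₀, IsSolution univ f p (Ioo (-T) T) γ₀ := by
  have h0 : (0 : ℝ) ∈ Ioo (-T) T := ⟨by linarith, hT⟩
  have hcauchy : ∀ c > 0, ∃ N, ∀ ν ≥ N, ∀ μ ≥ N, ∀ t ∈ Ioo (-T) T, ‖γ ν t - γ μ t‖ ≤ c := by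
    intro c hc
    obtain ⟨ε, hε, hstab⟩ := hη.exists_stability (n := n) hC T hc
    obtain ⟨N, hN⟩ := hlim (ε / 2) (half_pos hε)
    refine ⟨N, fun ν hν μ hμ t ht => hstab (G ν) (G μ) (hG ν) (fun x => ?_) (Ioo (-T) T) _ _
      ordConnected_Ioo h0 ((hγ ν).initial.trans (hγ μ).initial.symm) (hγ ν).hasDerivAt
      (hγ μ).hasDerivAt t ht (abs_le.2 ⟨ht.1.le, ht.2.le⟩)⟩
    have h1 := norm_sub_le (G ν x - f x) (G μ x - f x)
    rw [sub_sub_sub_cancel_right] at h1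
    linarith [hN ν hν x, hN μ hμ x]
  have hpt : ∀ t ∈ Ioo (-T) T, ∃ y, Tendsto (fun ν => γ ν t) atTop (𝓝 y) := by
    intro t ht
    refine cauchySeq_tendsto_of_complete (Metric.cauchySeq_iff.2 fun c hc => ?_)
    obtain ⟨N, hN⟩ := hcauchy (c / 2) (half_pos hc)
    refine ⟨N, fun ν hν μ hμ => ?_⟩
    rw [dist_eq_norm]
    exact (hN ν hν μ hμ t ht).trans_lt (half_lt_self hc)
  choose! γ₀ hγ₀ using hpt
  have hunif : TendstoUniformlyOn γ γ₀ atTop (Ioo (-T) T) := by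
    rw [Metric.tendstoUniformlyOn_iff]
    intro c hc
    obtain ⟨N, hN⟩ := hcauchy (c / 2) (half_pos hc)
    filter_upwards [eventually_ge_atTop N] with ν hν t ht
    rw [dist_comm, dist_eq_norm]
    refine lt_of_le_of_lt ?_ (half_lt_self hc)
    refine le_of_tendsto ((hγ₀ t ht).const_sub (γ ν t)).norm ?_
    filter_upwards [eventually_ge_atTop N] with μ hμ using hN ν hν μ hμ t ht
  have hderiv : TendstoUniformlyOn (fun ν t => G ν (γ ν t)) (fun t => f (γ₀ t)) atTop
      (Ioo (-T) T) := by
    have h1 := (hf.uniformContinuous hη.toIsModulus).comp_tendstoUniformlyOn hunif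
    rw [Metric.tendstoUniformlyOn_iff] at h1 ⊢
    intro c hc
    obtain ⟨N, hN⟩ := hlim (c / 2) (half_pos hc)
    filter_upwards [eventually_ge_atTop N, h1 (c / 2) (half_pos hc)] with ν hν h2 t ht
    have h3 := h2 t ht
    have h4 := hN ν hν (γ ν t)
    rw [← dist_eq_norm, dist_comm] at h4
    have h5 := dist_triangle (f (γ₀ t)) (f (γ ν t)) (G ν (γ ν t))
    simp only [Function.comp_apply] at h3
    linarith
  refine ⟨γ₀, isOpen_Ioo, ordConnected_Ioo, h0, ?_, fun _ _ => mem_univ _, fun t ht => ?_⟩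
  · refine tendsto_nhds_unique (hγ₀ 0 h0) ?_
    simp only [fun ν => (hγ ν).initial]
    exact tendsto_const_nhds
  · exact hasDerivAt_of_tendstoUniformlyOn isOpen_Ioo hderiv
      (Eventually.of_forall fun ν => (hγ ν).hasDerivAt) hγ₀ ht

/-- Convergence of flows: if `X` agrees on `U₀` with a globally Osgood field `f`, and the smooth
bounded fields `G ν` tend to `f` uniformly with a common modulus `C η`, then all flows are defined
on `U ⋐ U₀` for a common time, and they converge uniformly. -/
theorem IsOsgoodModulus.flow_convergence (hη : IsOsgoodModulus η) {Ω U₀ U : Set (Eucl n)}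
    (hΩ : IsOpen Ω) (hU₀ : IsOpen U₀) (hU₀Ω : U₀ ⊆ Ω) (hU : CompactlyContained U U₀)
    {X : Eucl n → Eucl n} (hX : MemModLoc η Ω X) {C : ℝ} (hC : 0 ≤ C)
    {f : Eucl n → Eucl n} {G : ℕ → Eucl n → Eucl n} (hf : HasMod η C f)
    (hG : ∀ ν, HasMod η C (G ν)) (hGsmooth : ∀ ν, ContDiff ℝ 1 (G ν)) {M : ℝ}
    (hfM : ∀ x, ‖f x‖ ≤ M) (hGM : ∀ ν x, ‖G ν x‖ ≤ M)
    (hfX : ∀ x ∈ U₀, f x = X x)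
    (hlim : ∀ ε > 0, ∃ N, ∀ ν ≥ N, ∀ x, ‖G ν x - f x‖ ≤ ε) :
    ∃ T₀, 0 < T₀ ∧ ∀ T, 0 < T → T ≤ T₀ →
      Ioo (-T) T ×ˢ U ⊆ flowDomain Ω X ∧
      (∀ ν, Ioo (-T) T ×ˢ U ⊆ flowDomain univ (G ν)) ∧
      Tendsto (fun ν => flowDist univ (G ν) Ω X T U) atTop (𝓝 0) := by
  have hM0 : 0 ≤ M := (norm_nonneg _).trans (hfM 0)
  obtain ⟨d, hd, hsub⟩ := hU.1.exists_thickening_subset_open hU₀ hU.2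
  refine ⟨d / (M + 1), by positivity, fun T hT hTd => ?_⟩
  have h0 : (0 : ℝ) ∈ Ioo (-T) T := ⟨by linarith, hT⟩
  choose γ hγ using fun (p : Eucl n) (ν : ℕ) =>
    exists_isSolution_of_contDiff (hGsmooth ν) (hGM ν) hT p
  choose γ₀ hγ₀ using fun p => hη.exists_isSolution_limit hC hf hG hlim hT (hγ p)
  -- up to time `T` the curves that start in `U` stay in `U₀`
  have hstay : ∀ p ∈ U, ∀ t ∈ Ioo (-T) T, γ₀ p t ∈ U₀ := by
    intro p hp t ht
    refine hsub (Metric.mem_thickening_iff.2 ⟨p, subset_closure hp, ?_⟩)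
    have h1 := (convex_Ioo (-T) T).norm_image_sub_le_of_norm_hasDerivWithin_le
      (fun s hs => ((hγ₀ p).hasDerivAt s hs).hasDerivWithinAt) (fun s _ => hfM (γ₀ p s)) h0 ht
    rw [(hγ₀ p).initial, sub_zero, Real.norm_eq_abs] at h1
    rw [dist_eq_norm]
    have h2 : |t| < T := abs_lt.2 ht
    rw [le_div_iff₀ (by positivity)] at hTd
    have h3 : M * |t| ≤ M * T := by gcongr
    linarith
  have hsol : ∀ p ∈ U, IsSolution Ω X p (Ioo (-T) T) (γ₀ p) := fun p hp =>
    ⟨isOpen_Ioo, ordConnected_Ioo, h0, (hγ₀ p).initial,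
      fun t ht => hU₀Ω (hstay p hp t ht), fun t ht => by
        rw [← hfX _ (hstay p hp t ht)]
        exact (hγ₀ p).hasDerivAt t ht⟩
  have hflowX : ∀ p ∈ U, ∀ t ∈ Ioo (-T) T,
      (t, p) ∈ flowDomain Ω X ∧ flow Ω X t p = γ₀ p t := fun p hp t ht =>
    mem_flowDomain_of_unique (hsol p hp) ht fun J γ' h' ht' =>
      hη.eq_of_isSolution hΩ hX h' (hsol p hp) ht' ht
  have hflowG : ∀ ν p, ∀ t ∈ Ioo (-T) T,
      (t, p) ∈ flowDomain univ (G ν) ∧ flow univ (G ν) t p = γ p ν t := fun ν p t ht =>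
    mem_flowDomain_of_unique (hγ p ν) ht fun J γ' h' ht' =>
      hη.eq_of_hasMod hC (hG ν) (h'.ordConnected.inter ordConnected_Ioo) ⟨h'.zero_mem, h0⟩
        (h'.initial.trans (hγ p ν).initial.symm) (fun s hs => h'.hasDerivAt s hs.1)
        (fun s hs => (hγ p ν).hasDerivAt s hs.2) ⟨ht', ht⟩
  refine ⟨fun z hz => (hflowX z.2 hz.2 z.1 hz.1).1, fun ν z hz => (hflowG ν z.2 z.1 hz.1).1, ?_⟩
  rw [ENNReal.tendsto_atTop_zero]
  intro c hc
  obtain ⟨c', hc', hcc⟩ : ∃ c' : ℝ, 0 < c' ∧ ENNReal.ofReal c' ≤ c := by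
    obtain ⟨q, hq0, hq⟩ := ENNReal.lt_iff_exists_real_btwn.1 hc
    exact ⟨q, by simpa using hq.1, hq.2.le⟩
  obtain ⟨ε, hε, hstab⟩ := hη.exists_stability (n := n) hC T hc'
  obtain ⟨N, hN⟩ := hlim ε hε
  refine ⟨N, fun ν hν => le_trans (iSup₂_le fun t ht => ?_) hcc⟩
  refine (c0Norm_le_iff hc'.le).2 fun p hp => ?_
  rw [(hflowX p hp t ht).2, (hflowG ν p t ht).2, norm_sub_rev]
  refine hstab f (G ν) hf (fun x => ?_) (Ioo (-T) T) _ _ ordConnected_Ioo h0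
    ((hγ₀ p).initial.trans (hγ p ν).initial.symm) (hγ₀ p).hasDerivAt (hγ p ν).hasDerivAt t ht
    (abs_le.2 ⟨ht.1.le, ht.2.le⟩)
  rw [norm_sub_rev]
  exact hN ν hν x

end FlowConvergence

/-! ### Dyadic mollifications of a function with a modulus of continuity -/

section Dyadic

variable {η : ℝ → ℝ}

lemma two_zpow_neg_pos (ν : ℕ) : 0 < (2 : ℝ) ^ (-(ν : ℤ)) := by positivity

lemma two_zpow_neg_le_one (ν : ℕ) : (2 : ℝ) ^ (-(ν : ℤ)) ≤ 1 :=
  zpow_le_one_of_nonpos₀ one_le_two (by simp)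

lemma inv_two_zpow_neg (ν : ℕ) : ((2 : ℝ) ^ (-(ν : ℤ)))⁻¹ = 2 ^ ν := by
  rw [zpow_neg, inv_inv, zpow_natCast]

lemma tendsto_two_zpow_neg : Tendsto (fun ν : ℕ => (2 : ℝ) ^ (-(ν : ℤ))) atTop (𝓝[>] 0) := by
  refine tendsto_nhdsWithin_iff.2 ⟨?_, Eventually.of_forall two_zpow_neg_pos⟩
  have : (fun ν : ℕ => (2 : ℝ) ^ (-(ν : ℤ))) = fun ν => (1 / 2 : ℝ) ^ ν := by
    funext ν; rw [zpow_neg, zpow_natCast, one_div, inv_pow]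
  rw [this]
  exact tendsto_pow_atTop_nhds_zero_of_lt_one (by norm_num) (by norm_num)

lemma exists_norm_moll_sub_le {Φ : 𝓢(Eucl n, ℝ)} (hΦ : ∫ z, Φ z = 1) (hη : IsModulus η) {H M : ℝ}
    (hH : 0 ≤ H) {F : Type*} [NormedAddCommGroup F] [NormedSpace ℝ F] [CompleteSpace F]
    {f : Eucl n → F} (hf : HasMod η H f) (hM : ∀ x, ‖f x‖ ≤ M) :
    ∀ ε > 0, ∃ N : ℕ, ∀ ν ≥ N, ∀ x, ‖moll Φ ((2 : ℝ) ^ (-(ν : ℤ))) f x - f x‖ ≤ ε := by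
  intro ε hε
  have h : Tendsto (fun ν : ℕ => mass Φ * (H * η ((2 : ℝ) ^ (-(ν : ℤ))))) atTop (𝓝 0) := by
    simpa using ((hη.tendsto_zero.comp tendsto_two_zpow_neg).const_mul H).const_mul (mass Φ)
  obtain ⟨N, hN⟩ := eventually_atTop.1 (h.eventually_lt_const hε)
  exact ⟨N, fun ν hν x =>
    (norm_moll_sub_le hΦ hη hH hf hM (two_zpow_neg_pos ν) x).trans (hN ν hν).le⟩

lemma exists_c1Norm_moll_le (Φ : 𝓢(Eucl n, ℝ)) (hη : IsModulus η) {H M : ℝ} (hH : 0 ≤ H)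
    {f : Eucl n → Eucl n} (hf : HasMod η H f) (hfc : HasCompactSupport f)
    (hM : ∀ x, ‖f x‖ ≤ M) (S : Set (Eucl n)) :
    ∃ C, 0 < C ∧ ∀ ν : ℕ, c1Norm S (moll Φ ((2 : ℝ) ^ (-(ν : ℤ))) f) ≤
      ENNReal.ofReal (C * (2 : ℝ) ^ ν * η ((2 : ℝ) ^ (-(ν : ℤ)))) := by
  have hM0 : 0 ≤ M := (norm_nonneg _).trans (hM 0)
  have hη1 := hη.pos 1 one_pos
  set K := mass (SchwartzMap.fderivCLM ℝ (Eucl n) ℝ Φ) with hK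
  have hK0 : 0 ≤ K := mass_nonneg _
  have hm := mass_nonneg Φ
  refine ⟨mass Φ * M * 2 / η 1 + K * H + 1, by positivity, fun ν => ?_⟩
  set s := (2 : ℝ) ^ (-(ν : ℤ)) with hs
  have hs0 : 0 < s := two_zpow_neg_pos ν
  have hηs := hη.pos s hs0
  have h2 : (2 : ℝ) ^ ν = s⁻¹ := (inv_two_zpow_neg ν).symm
  have h1s : 1 ≤ s⁻¹ := by rw [← h2]; exact one_le_pow₀ one_le_two
  have h1 : η 1 ≤ 2 * (s⁻¹ * η s) := by
    have := hη.mul_le (inv_pos.2 hs0) hs0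
    rw [inv_mul_cancel₀ hs0.ne'] at this
    nlinarith
  have hsup : c0Norm S (moll Φ s f) ≤ ENNReal.ofReal (mass Φ * M) :=
    (c0Norm_le_iff (by positivity)).2 fun x _ => norm_moll_le hM x
  have hgrad : c0Norm S (fderiv ℝ (moll Φ s f)) ≤ ENNReal.ofReal (s⁻¹ * (K * (H * η s))) :=
    (c0Norm_le_iff (by positivity)).2 fun x _ =>
      norm_fderiv_moll_le_of_hasMod hη hH hf hs0 hfc x
  refine (add_le_add hsup hgrad).trans ?_
  rw [← ENNReal.ofReal_add (by positivity) (by positivity), h2]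
  refine ENNReal.ofReal_le_ofReal ?_
  have h3 : mass Φ * M ≤ mass Φ * M * 2 / η 1 * (s⁻¹ * η s) := by
    rw [div_mul_eq_mul_div, le_div_iff₀ hη1]
    nlinarith [mul_le_mul_of_nonneg_left h1 (mul_nonneg hm hM0)]
  have h4 : 0 < s⁻¹ * η s := by positivity
  nlinarith

/-- Uniform convergence with a common modulus `C η` is convergence in `C^ζ` as soon as
`η = o(ζ)` at `0`. -/
lemma tendsto_modNorm_of_isLittleO {ζ : ℝ → ℝ} (hζ : IsModulus ζ)
    (hηζ : ∀ c, 0 < c → ∃ r₀, 0 < r₀ ∧ ∀ r, 0 < r → r < r₀ → η r ≤ c * ζ r) {C : ℝ} (hC : 0 ≤ C)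
    {f X : Eucl n → Eucl n} {G : ℕ → Eucl n → Eucl n} (hf : HasMod η C f)
    (hG : ∀ ν, HasMod η C (G ν)) {S : Set (Eucl n)} (hfX : ∀ x ∈ S, f x = X x)
    (hlim : ∀ ε > 0, ∃ N, ∀ ν ≥ N, ∀ x, ‖G ν x - f x‖ ≤ ε) :
    Tendsto (fun ν => modNorm ζ S (fun x => G ν x - X x)) atTop (𝓝 0) := by
  rw [ENNReal.tendsto_atTop_zero]
  intro c hc
  obtain ⟨c', hc', hcc⟩ : ∃ c' : ℝ, 0 < c' ∧ ENNReal.ofReal c' ≤ c := by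
    obtain ⟨q, hq0, hq⟩ := ENNReal.lt_iff_exists_real_btwn.1 hc
    exact ⟨q, by simpa using hq.1, hq.2.le⟩
  obtain ⟨r₀, hr₀, hr⟩ := hηζ (c' / 2 / (2 * C + 1)) (by positivity)
  have hζ₀ := hζ.pos r₀ hr₀
  obtain ⟨N, hN⟩ := hlim (min (c' / 2) (c' / 4 * ζ r₀)) (by positivity)
  refine ⟨N, fun ν hν => le_trans ?_ hcc⟩
  have e : c' = c' / 2 + c' / 2 := by ring
  rw [e]
  refine modNorm_le hζ (by positivity) (by positivity) (fun x hx => ?_) fun x hx y hy hxy => ?_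
  · rw [← hfX x hx]
    exact (hN ν hν x).trans (min_le_left _ _)
  · rw [← hfX x hx, ← hfX y hy]
    have hpos := norm_pos_iff.2 (sub_ne_zero.2 hxy)
    have hζp := hζ.pos _ hpos
    rcases lt_or_ge ‖x - y‖ r₀ with hlt | hge
    · refine (((hG ν).sub hf) x y hxy).trans ?_
      have h1 := hr _ hpos hlt
      calc (C + C) * η ‖x - y‖ ≤ (C + C) * (c' / 2 / (2 * C + 1) * ζ ‖x - y‖) := by gcongr
        _ = c' / 2 * ζ ‖x - y‖ * ((2 * C) / (2 * C + 1)) := by ring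
        _ ≤ c' / 2 * ζ ‖x - y‖ * 1 := by
          gcongr
          rw [div_le_one (by positivity)]
          linarith
        _ = _ := by ring
    · have h1 := norm_sub_le (G ν x - f x) (G ν y - f y)
      have h2 := (hN ν hν x).trans (min_le_right _ _)
      have h3 := (hN ν hν y).trans (min_le_right _ _)
      have h4 := hζ.monotoneOn (mem_Ioi.2 hr₀) (mem_Ioi.2 hpos) hge
      nlinarith

end Dyadic

/-! ### The pairing `∫ ψ (V · ∇) W` -/

section Pairing

/-- The pairing `∫ ψ (V · ∇) W` of a test function with a directional derivative. -/
def advect (ψ : Eucl n → ℝ) (V W : Eucl n → Eucl n) : Eucl n :=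
  ∫ y, ψ y • fderiv ℝ W y (V y)

variable {ψ : Eucl n → ℝ} {V V' W W' : Eucl n → Eucl n}

lemma integrable_advect (hψ : Continuous ψ) (hψc : HasCompactSupport ψ) (hV : Continuous V)
    (hW : ContDiff ℝ 1 W) : Integrable (fun y => ψ y • fderiv ℝ W y (V y)) := by
  have h := hW.continuous_fderiv one_ne_zero
  refine Continuous.integrable_of_hasCompactSupport (hψ.smul (h.clm_apply hV)) ?_
  refine hψc.mono fun y hy h0 => hy ?_
  simp only [h0, zero_smul]

lemma advect_sub_left (hψ : Continuous ψ) (hψc : HasCompactSupport ψ) (hV : Continuous V)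
    (hV' : Continuous V') (hW : ContDiff ℝ 1 W) :
    advect ψ (fun y => V y - V' y) W = advect ψ V W - advect ψ V' W := by
  simp only [advect, map_sub, smul_sub]
  exact integral_sub (integrable_advect hψ hψc hV hW) (integrable_advect hψ hψc hV' hW)

lemma advect_sub_right (hψ : Continuous ψ) (hψc : HasCompactSupport ψ) (hV : Continuous V)
    (hW : ContDiff ℝ 1 W) (hW' : ContDiff ℝ 1 W') :
    advect ψ V (fun y => W y - W' y) = advect ψ V W - advect ψ V W' := by
  rw [advect, advect, advect, ← integral_sub (integrable_advect hψ hψc hV hW)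
    (integrable_advect hψ hψc hV hW')]
  refine integral_congr_ae (Eventually.of_forall fun y => ?_)
  simp only
  rw [fderiv_fun_sub (hW.differentiable one_ne_zero y) (hW'.differentiable one_ne_zero y),
    ← smul_sub]
  rfl

lemma integral_smul_lieBracket (hψ : Continuous ψ) (hψc : HasCompactSupport ψ)
    (hV : ContDiff ℝ 1 V) (hW : ContDiff ℝ 1 W) :
    ∫ y, ψ y • VectorField.lieBracket ℝ V W y = advect ψ V W - advect ψ W V := by
  simp only [VectorField.lieBracket, smul_sub]
  exact integral_sub (integrable_advect hψ hψc hV.continuous hW)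
    (integrable_advect hψ hψc hW.continuous hV)

lemma norm_advect_le_of_bound (hψ : Continuous ψ) (hψc : HasCompactSupport ψ)
    {w : Eucl n → ℝ} (hw : Continuous w) {a b : ℝ} (ha : 0 ≤ a)
    (hV : ∀ y, ‖V y‖ ≤ w y * b) (hW : ∀ y, ‖fderiv ℝ W y‖ ≤ a) :
    ‖advect ψ V W‖ ≤ a * b * ∫ y, w y * ‖ψ y‖ := by
  have hi : Integrable (fun y => w y * ‖ψ y‖) := by
    refine Continuous.integrable_of_hasCompactSupport (by fun_prop) ?_
    exact hψc.mono fun y hy h0 => hy (by simp only [h0, norm_zero, mul_zero])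
  have := norm_integral_le_of_norm_le (hi.const_mul (a * b)) (f := fun y =>
    ψ y • fderiv ℝ W y (V y)) (Eventually.of_forall fun y => ?_)
  · rwa [integral_const_mul] at this
  · rw [norm_smul]
    have h1 : ‖fderiv ℝ W y (V y)‖ ≤ a * (w y * b) :=
      ((fderiv ℝ W y).le_opNorm (V y)).trans
        (mul_le_mul (hW y) (hV y) (norm_nonneg _) ha)
    calc ‖ψ y‖ * ‖fderiv ℝ W y (V y)‖ ≤ ‖ψ y‖ * (a * (w y * b)) := by gcongr
      _ = _ := by ring

/-- Integration by parts in the pairing: all derivatives are moved away from `W`. -/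
lemma norm_advect_le_of_parts (hψ : ContDiff ℝ 1 ψ) (hψc : HasCompactSupport ψ)
    (hV : ContDiff ℝ 1 V) (hW : ContDiff ℝ 1 W) {A D : ℝ} (hWA : ∀ y, ‖W y‖ ≤ A)
    (hVD : ∀ y, ‖fderiv ℝ V y‖ ≤ D) :
    ‖advect ψ V W‖ ≤ n * (A * ((∫ y, ‖fderiv ℝ ψ y‖ * ‖V y‖) + D * ∫ y, ‖ψ y‖)) := by
  have hA0 : 0 ≤ A := (norm_nonneg _).trans (hWA 0)
  have hD0 : 0 ≤ D := (norm_nonneg _).trans (hVD 0)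
  set e : Fin n → Eucl n := fun i => EuclideanSpace.single i 1 with he
  have hVi : ∀ i, ContDiff ℝ 1 fun y => V y i := fun i =>
    contDiff_euclidean.1 hV i
  have hψV : ∀ i, ContDiff ℝ 1 fun y => ψ y * V y i := fun i => hψ.mul (hVi i)
  have hψVc : ∀ i, HasCompactSupport fun y => ψ y * V y i := fun i =>
    hψc.mono fun y hy h0 => hy (by simp only [h0, zero_mul])
  have hWd := hW.continuous_fderiv one_ne_zero
  have hψd := hψ.continuous_fderiv one_ne_zero
  have hVc := hV.continuous
  have hψcont := hψ.continuous
  have hint : ∀ i, Integrable fun y => (ψ y * V y i) • fderiv ℝ W y (e i) := fun i =>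
    Continuous.integrable_of_hasCompactSupport
      ((hψV i).continuous.smul (hWd.clm_apply continuous_const))
      ((hψVc i).mono fun y hy h0 => hy (by simp only [h0, zero_smul]))
  have hsum : advect ψ V W = ∑ i, ∫ y, (ψ y * V y i) • fderiv ℝ W y (e i) := by
    rw [← integral_finsetSum _ fun i _ => hint i]
    refine integral_congr_ae (Eventually.of_forall fun y => ?_)
    have hy : V y = ∑ i, V y i • e i := by
      conv_lhs => rw [← (EuclideanSpace.basisFun (Fin n) ℝ).sum_repr (V y)]
      simp [he]
    simp only
    conv_lhs => rw [hy, map_sum, Finset.smul_sum]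
    refine Finset.sum_congr rfl fun i _ => ?_
    rw [map_smul, smul_smul]
  have hi1 : Integrable fun y => ‖fderiv ℝ ψ y‖ * ‖V y‖ :=
    Continuous.integrable_of_hasCompactSupport (by fun_prop)
      ((hψc.fderiv ℝ).mono fun y hy h0 => hy (by simp only [h0, norm_zero, zero_mul]))
  have hi2 : Integrable fun y => ‖ψ y‖ := hψcont.norm.integrable_of_hasCompactSupport hψc.norm
  have hterm : ∀ i, ‖∫ y, (ψ y * V y i) • fderiv ℝ W y (e i)‖ ≤
      A * ((∫ y, ‖fderiv ℝ ψ y‖ * ‖V y‖) + D * ∫ y, ‖ψ y‖) := by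
    intro i
    have hdc : HasCompactSupport fun y => fderiv ℝ (fun y => ψ y * V y i) y :=
      (hψVc i).fderiv ℝ
    rw [integral_smul_fderiv_eq_neg_fderiv_smul_of_integrable
      (Continuous.integrable_of_hasCompactSupport
        ((((hψV i).continuous_fderiv one_ne_zero).clm_apply continuous_const).smul hW.continuous)
        (hdc.mono fun y hy h0 => hy (by simp [h0])))
      (hint i)
      (Continuous.integrable_of_hasCompactSupport ((hψV i).continuous.smul hW.continuous)
        ((hψVc i).mono fun y hy h0 => hy (by simp only [h0, zero_smul])))
      (fun y _ => (hψV i).differentiable one_ne_zero y)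
      (fun y _ => hW.differentiable one_ne_zero y), norm_neg, ← integral_const_mul,
      ← integral_add hi1 (hi2.const_mul D), ← integral_const_mul]
    refine norm_integral_le_of_norm_le ((hi1.add (hi2.const_mul D)).const_mul A)
      (Eventually.of_forall fun y => ?_)
    have hV1 : HasFDerivAt (fun y => V y i)
        ((EuclideanSpace.proj i : Eucl n →L[ℝ] ℝ).comp (fderiv ℝ V y)) y :=
      (EuclideanSpace.proj i : Eucl n →L[ℝ] ℝ).hasFDerivAt.comp y
        (hV.differentiable one_ne_zero y).hasFDerivAt
    have hfd : fderiv ℝ (fun y => ψ y * V y i) y = _ :=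
      ((hψ.differentiable one_ne_zero y).hasFDerivAt.mul hV1).fderiv
    rw [hfd, norm_smul, mul_comm]
    have he1 : ‖e i‖ = 1 := by simp [he]
    have h1 : ‖fderiv ℝ V y (e i) i‖ ≤ D := by
      refine (PiLp.norm_apply_le _ i).trans (((fderiv ℝ V y).le_opNorm _).trans ?_)
      rw [he1, mul_one]; exact hVD y
    have h2 : ‖fderiv ℝ ψ y (e i)‖ ≤ ‖fderiv ℝ ψ y‖ := by
      simpa [he1] using (fderiv ℝ ψ y).le_opNorm (e i)
    have h3 : ‖V y i‖ ≤ ‖V y‖ := PiLp.norm_apply_le _ i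
    refine mul_le_mul (hWA y) ?_ (norm_nonneg _) hA0
    simp only [_root_.add_apply, _root_.smul_apply, ContinuousLinearMap.comp_apply,
      smul_eq_mul]
    refine (norm_add_le _ _).trans ?_
    rw [norm_mul, norm_mul]
    have h4 : ‖ψ y‖ * ‖(EuclideanSpace.proj i : Eucl n →L[ℝ] ℝ) (fderiv ℝ V y (e i))‖ ≤
        ‖ψ y‖ * D := mul_le_mul_of_nonneg_left h1 (norm_nonneg _)
    have h5 : ‖V y i‖ * ‖fderiv ℝ ψ y (e i)‖ ≤ ‖V y‖ * ‖fderiv ℝ ψ y‖ := by gcongr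
    linarith
  rw [hsum]
  refine (norm_sum_le _ _).trans ((Finset.sum_le_sum fun i _ => hterm i).trans ?_)
  simp

/-- The pairing is continuous under bounded pointwise convergence of `V` and `∇W`. -/
lemma tendsto_advect (hψ : Continuous ψ) (hψc : HasCompactSupport ψ)
    {Vs Ws : ℕ → Eucl n → Eucl n} (hVs : ∀ k, Continuous (Vs k)) (hWs : ∀ k, ContDiff ℝ 1 (Ws k))
    {a b : ℝ} (hVa : ∀ k y, ‖Vs k y‖ ≤ a) (hWb : ∀ k y, ‖fderiv ℝ (Ws k) y‖ ≤ b)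
    (hV : ∀ y, Tendsto (fun k => Vs k y) atTop (𝓝 (V y)))
    (hW : ∀ y, Tendsto (fun k => fderiv ℝ (Ws k) y) atTop (𝓝 (fderiv ℝ W y))) :
    Tendsto (fun k => advect ψ (Vs k) (Ws k)) atTop (𝓝 (advect ψ V W)) := by
  have hb : 0 ≤ b := (norm_nonneg _).trans (hWb 0 0)
  refine tendsto_integral_of_dominated_convergence (fun y => ‖ψ y‖ * (b * a))
    (fun k => (integrable_advect hψ hψc (hVs k) (hWs k)).aestronglyMeasurable)
    ((hψ.norm.integrable_of_hasCompactSupport hψc.norm).mul_const _)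
    (fun k => Eventually.of_forall fun y => ?_) (Eventually.of_forall fun y => ?_)
  · rw [norm_smul]
    gcongr
    exact ((fderiv ℝ (Ws k) y).le_opNorm _).trans
      (mul_le_mul (hWb k y) (hVa k y) (norm_nonneg _) hb)
  · have h := (isBoundedBilinearMap_apply (𝕜 := ℝ) (E := Eucl n) (F := Eucl n)).continuous.tendsto
      (fderiv ℝ W y, V y)
    exact (h.comp ((hW y).prodMk_nhds (hV y))).const_smul _

end Pairing

/-! ### Telescoping over dyadic scales -/

section Telescope

variable {η : ℝ → ℝ}

lemma IsModulus.inv_half_mul_le (hη : IsModulus η) {s : ℝ} (hs : 0 < s) :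
    (s / 2)⁻¹ * η (s / 2) ≤ 2 * (s⁻¹ * η s) := by
  have h1 : η (s / 2) ≤ η s :=
    hη.monotoneOn (mem_Ioi.2 (half_pos hs)) (mem_Ioi.2 hs) (by linarith)
  have h2 : (s / 2)⁻¹ = 2 * s⁻¹ := by rw [inv_div]; rfl
  rw [h2, mul_assoc]
  gcongr

/-- One step of the telescoping: replacing the scale `s / 2` by `s` in `∫ ψ ((f_s - c) · ∇) g_s`.
The hypothesis `hB` bounds the only term in which the derivative falls on `ψ`. -/
lemma norm_advect_moll_half_sub_le {Φ : 𝓢(Eucl n, ℝ)} (hΦ : ∫ z, Φ z = 1) (hη : IsModulus η)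
    {H : ℝ} (hH : 0 ≤ H) {f g : Eucl n → Eucl n} (hf : HasMod η H f) (hg : HasMod η H g)
    (hfc : HasCompactSupport f) (hgc : HasCompactSupport g) {ψ : Eucl n → ℝ}
    (hψ : ContDiff ℝ 1 ψ) (hψc : HasCompactSupport ψ) (c : Eucl n) {s B : ℝ} (hs : 0 < s)
    (hB : ∫ y, ‖fderiv ℝ ψ y‖ * ‖moll Φ s f y - c‖ ≤ B * (s⁻¹ * η s)) :
    ‖advect ψ (fun y => moll Φ (s / 2) f y - c) (moll Φ (s / 2) g) -
        advect ψ (fun y => moll Φ s f y - c) (moll Φ s g)‖ ≤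
      (4 * mass (SchwartzMap.fderivCLM ℝ (Eucl n) ℝ Φ) * mass Φ * H ^ 2 * (∫ y, ‖ψ y‖) +
        2 * n * mass Φ * H * (B + mass (SchwartzMap.fderivCLM ℝ (Eucl n) ℝ Φ) * H * ∫ y, ‖ψ y‖))
        * (s⁻¹ * η s ^ 2) := by
  set K := mass (SchwartzMap.fderivCLM ℝ (Eucl n) ℝ Φ) with hKdef
  have hK : 0 ≤ K := mass_nonneg _
  have hm : 0 ≤ mass Φ := mass_nonneg _
  obtain ⟨Mf, hMf⟩ := hfc.exists_bound_of_continuous (hf.continuous hη)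
  obtain ⟨Mg, hMg⟩ := hgc.exists_bound_of_continuous (hg.continuous hη)
  have hs2 : 0 < s / 2 := half_pos hs
  have hηs := hη.pos s hs
  have hηs2 := hη.pos _ hs2
  have hη2 : η (s / 2) ≤ η s := hη.monotoneOn (mem_Ioi.2 hs2) (mem_Ioi.2 hs) (by linarith)
  have hI0 : 0 ≤ ∫ y, ‖ψ y‖ := integral_nonneg fun y => norm_nonneg _
  have hsm : ∀ {r : ℝ} {h : Eucl n → Eucl n}, 0 < r → HasMod η H h → HasCompactSupport h →
      ContDiff ℝ 1 (moll Φ r h) := fun hr hh hhc =>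
    (contDiff_moll hr (hh.continuous hη) hhc).of_le (by simp)
  have hf1 := hsm hs hf hfc
  have hf2 := hsm hs2 hf hfc
  have hg1 := hsm hs hg hgc
  have hg2 := hsm hs2 hg hgc
  have hcs : Continuous ψ := hψ.continuous
  have hdiff : ∀ {h : Eucl n → Eucl n} {M : ℝ}, HasMod η H h → (∀ x, ‖h x‖ ≤ M) → ∀ y,
      ‖moll Φ (s / 2) h y - moll Φ s h y‖ ≤ 2 * mass Φ * H * η s := by
    intro h M hh hM y
    have h1 := norm_moll_sub_le hΦ hη hH hh hM hs2 y
    have h2 := norm_moll_sub_le hΦ hη hH hh hM hs y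
    have h3 := norm_sub_le (moll Φ (s / 2) h y - h y) (moll Φ s h y - h y)
    rw [sub_sub_sub_cancel_right] at h3
    have h4 : mass Φ * (H * η (s / 2)) ≤ mass Φ * (H * η s) := by gcongr
    linarith
  have hsplit : advect ψ (fun y => moll Φ (s / 2) f y - c) (moll Φ (s / 2) g) -
        advect ψ (fun y => moll Φ s f y - c) (moll Φ s g) =
      advect ψ (fun y => moll Φ (s / 2) f y - moll Φ s f y) (moll Φ (s / 2) g) +
        advect ψ (fun y => moll Φ s f y - c) (fun y => moll Φ (s / 2) g y - moll Φ s g y) := by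
    have e : (fun y => moll Φ (s / 2) f y - moll Φ s f y) =
        fun y => (moll Φ (s / 2) f y - c) - (moll Φ s f y - c) := by
      funext y; abel
    have hc1 : Continuous fun y => moll Φ s f y - c := hf1.continuous.sub continuous_const
    have hc2 : Continuous fun y => moll Φ (s / 2) f y - c := hf2.continuous.sub continuous_const
    rw [e, advect_sub_left hcs hψc hc2 hc1 hg2, advect_sub_right hcs hψc hc1 hg2 hg1]
    abel
  -- increment of the field: both factors are estimated as they stand
  have hA : ‖advect ψ (fun y => moll Φ (s / 2) f y - moll Φ s f y) (moll Φ (s / 2) g)‖ ≤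
      (s / 2)⁻¹ * (K * (H * η (s / 2))) * (2 * mass Φ * H * η s) * ∫ y, 1 * ‖ψ y‖ :=
    norm_advect_le_of_bound hcs hψc continuous_const (by positivity)
      (fun y => by rw [one_mul]; exact hdiff hf hMf y)
      (fun y => norm_fderiv_moll_le_of_hasMod hη hH hg hs2 hgc y)
  have hA' : (s / 2)⁻¹ * (K * (H * η (s / 2))) * (2 * mass Φ * H * η s) * ∫ y, 1 * ‖ψ y‖ ≤
      4 * K * mass Φ * H ^ 2 * (∫ y, ‖ψ y‖) * (s⁻¹ * η s ^ 2) := by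
    simp only [one_mul]
    calc _ = ((s / 2)⁻¹ * η (s / 2)) * (2 * K * mass Φ * H ^ 2 * (∫ y, ‖ψ y‖) * η s) := by ring
      _ ≤ (2 * (s⁻¹ * η s)) * (2 * K * mass Φ * H ^ 2 * (∫ y, ‖ψ y‖) * η s) := by
        exact mul_le_mul_of_nonneg_right (hη.inv_half_mul_le hs) (by positivity)
      _ = _ := by ring
  -- increment under the derivative: integrate by parts, so that only `∇f_s` and `∇ψ` are left
  have hC := norm_advect_le_of_parts hψ hψc (hf1.sub contDiff_const) (hg2.sub hg1)
    (V := fun y => moll Φ s f y - c) (W := fun y => moll Φ (s / 2) g y - moll Φ s g y)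
    (A := 2 * mass Φ * H * η s) (D := s⁻¹ * (K * (H * η s))) (hdiff hg hMg) (fun y => by
      rw [fderiv_sub_const]
      exact norm_fderiv_moll_le_of_hasMod hη hH hf hs hfc y)
  have hC' : n * (2 * mass Φ * H * η s * ((∫ y, ‖fderiv ℝ ψ y‖ * ‖moll Φ s f y - c‖) +
      s⁻¹ * (K * (H * η s)) * ∫ y, ‖ψ y‖)) ≤
      2 * n * mass Φ * H * (B + K * H * ∫ y, ‖ψ y‖) * (s⁻¹ * η s ^ 2) := by
    calc _ ≤ n * (2 * mass Φ * H * η s * (B * (s⁻¹ * η s) +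
          s⁻¹ * (K * (H * η s)) * ∫ y, ‖ψ y‖)) := by gcongr
      _ = _ := by ring
  rw [hsplit]
  refine (norm_add_le _ _).trans ?_
  rw [add_mul]
  exact add_le_add (hA.trans hA') (hC.trans hC')

lemma norm_sub_le_of_le_geometric {F : Type*} [NormedAddCommGroup F] {a : ℕ → F} {Q q : ℝ}
    (hQ : 0 ≤ Q) (hq0 : 0 ≤ q) (hq1 : q < 1) {ν : ℕ}
    (h : ∀ J ≥ ν, ‖a (J + 1) - a J‖ ≤ Q * q ^ J) {J : ℕ} (hJ : ν ≤ J) :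
    ‖a J - a ν‖ ≤ Q / (1 - q) * q ^ ν := by
  have h1q : 0 < 1 - q := by linarith
  have key : ‖a J - a ν‖ ≤ Q / (1 - q) * (q ^ ν - q ^ J) := by
    induction J, hJ using Nat.le_induction with
    | base => simp
    | succ J hJ ih =>
      have h1 := norm_add_le (a (J + 1) - a J) (a J - a ν)
      rw [sub_add_sub_cancel] at h1
      have h2 := h J hJ
      have h3 : Q / (1 - q) * (q ^ ν - q ^ (J + 1)) =
          Q * q ^ J + Q / (1 - q) * (q ^ ν - q ^ J) := by
        field_simp; ring
      linarith
  refine key.trans ?_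
  gcongr
  linarith [pow_nonneg hq0 J]

lemma two_zpow_neg_succ (J : ℕ) : (2 : ℝ) ^ (-((J + 1 : ℕ) : ℤ)) = (2 : ℝ) ^ (-(J : ℤ)) / 2 := by
  rw [zpow_neg, zpow_neg, zpow_natCast, zpow_natCast, pow_succ, mul_inv]
  rfl

lemma two_zpow_neg_rpow (J : ℕ) (a : ℝ) :
    ((2 : ℝ) ^ (-(J : ℤ))) ^ a = ((2 : ℝ) ^ (-a)) ^ J := by
  rw [← Real.rpow_intCast, ← Real.rpow_mul two_pos.le, ← Real.rpow_natCast ((2 : ℝ) ^ (-a)),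
    ← Real.rpow_mul two_pos.le]
  congr 1
  push_cast; ring

lemma inv_mul_rpow_sq {s : ℝ} (hs : 0 < s) (α : ℝ) :
    s⁻¹ * (s ^ α) ^ 2 = s ^ (2 * α - 1) := by
  rw [Real.rpow_sub hs, Real.rpow_one, mul_comm 2 α, Real.rpow_mul hs.le, Real.rpow_two]
  field_simp

/-- The pairings `∫ ψ ((f_J - c) · ∇) g_J` of dyadic mollifications of `C^{0,α}` functions,
`α > 1/2`, converge geometrically. -/
theorem norm_advect_moll_sub_le {Φ : 𝓢(Eucl n, ℝ)} (hΦ : ∫ z, Φ z = 1) {α : ℝ}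
    (hα : 1 / 2 < α) (hα1 : α < 1) {H : ℝ} (hH : 0 ≤ H) {f g : Eucl n → Eucl n}
    (hf : HasMod (fun r => r ^ α) H f) (hg : HasMod (fun r => r ^ α) H g)
    (hfc : HasCompactSupport f) (hgc : HasCompactSupport g) {ψ : Eucl n → ℝ}
    (hψ : ContDiff ℝ 1 ψ) (hψc : HasCompactSupport ψ) (c : Eucl n) {ν : ℕ} {B I : ℝ} (hB0 : 0 ≤ B)
    (hI : ∫ y, ‖ψ y‖ ≤ I)
    (hB : ∀ J ≥ ν, ∫ y, ‖fderiv ℝ ψ y‖ * ‖moll Φ ((2 : ℝ) ^ (-(J : ℤ))) f y - c‖ ≤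
      B * (((2 : ℝ) ^ (-(J : ℤ)))⁻¹ * ((2 : ℝ) ^ (-(J : ℤ))) ^ α)) {J : ℕ} (hJ : ν ≤ J) :
    ‖advect ψ (fun y => moll Φ ((2 : ℝ) ^ (-(J : ℤ))) f y - c) (moll Φ ((2 : ℝ) ^ (-(J : ℤ))) g) -
        advect ψ (fun y => moll Φ ((2 : ℝ) ^ (-(ν : ℤ))) f y - c)
          (moll Φ ((2 : ℝ) ^ (-(ν : ℤ))) g)‖ ≤
      (4 * mass (SchwartzMap.fderivCLM ℝ (Eucl n) ℝ Φ) * mass Φ * H ^ 2 * I +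
        2 * n * mass Φ * H * (B + mass (SchwartzMap.fderivCLM ℝ (Eucl n) ℝ Φ) * H * I)) /
        (1 - (2 : ℝ) ^ (-(2 * α - 1))) * ((2 : ℝ) ^ (-(2 * α - 1))) ^ ν := by
  have hη := isModulus_rpow (α := α) (by linarith) hα1.le
  have hK := mass_nonneg (SchwartzMap.fderivCLM ℝ (Eucl n) ℝ Φ)
  have hm := mass_nonneg Φ
  have hI0 : 0 ≤ ∫ y, ‖ψ y‖ := integral_nonneg fun y => norm_nonneg _
  have hI0' := hI0.trans hI
  refine norm_sub_le_of_le_geometric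
    (a := fun J : ℕ => advect ψ (fun y => moll Φ ((2 : ℝ) ^ (-(J : ℤ))) f y - c)
      (moll Φ ((2 : ℝ) ^ (-(J : ℤ))) g)) (by positivity) (by positivity)
    (Real.rpow_lt_one_of_one_lt_of_neg one_lt_two (by linarith)) (fun J hJ => ?_) hJ
  have hs := two_zpow_neg_pos J
  have h1 := norm_advect_moll_half_sub_le hΦ hη hH hf hg hfc hgc hψ hψc c hs (hB J hJ)
  rw [inv_mul_rpow_sq hs, two_zpow_neg_rpow] at h1
  simp only [two_zpow_neg_succ]
  refine h1.trans ?_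
  gcongr

end Telescope

/-! ### Commuting fields in the sense of distributions -/

section Vanishing

variable {Φ : 𝓢(Eucl n, ℝ)} {ψ : Eucl n → ℝ}

lemma tendsto_of_forall_norm_sub_le {F : Type*} [NormedAddCommGroup F] {u : ℕ → F} {v : F}
    (h : ∀ ε > 0, ∃ N, ∀ k ≥ N, ‖u k - v‖ ≤ ε) : Tendsto u atTop (𝓝 v) := by
  rw [Metric.tendsto_atTop]
  intro ε hε
  obtain ⟨N, hN⟩ := h (ε / 2) (half_pos hε)
  exact ⟨N, fun k hk => by
    rw [dist_eq_norm]
    exact (hN k hk).trans_lt (half_lt_self hε)⟩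

lemma tendsto_advect_moll (hΦ : ∫ z, Φ z = 1) (hψ : Continuous ψ) (hψc : HasCompactSupport ψ)
    {a b : Eucl n → Eucl n} (ha : ContDiff ℝ ∞ a) (hac : HasCompactSupport a)
    (hb : ContDiff ℝ ∞ b) (hbc : HasCompactSupport b) :
    Tendsto (fun J : ℕ => advect ψ (moll Φ ((2 : ℝ) ^ (-(J : ℤ))) a)
      (moll Φ ((2 : ℝ) ^ (-(J : ℤ))) b)) atTop (𝓝 (advect ψ a b)) := by
  have hη := isModulus_rpow (α := 1) one_pos le_rfl
  have hb1 : ContDiff ℝ 1 b := hb.of_le (by simp)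
  have hdb1 : ContDiff ℝ 1 (fderiv ℝ b) := ((contDiff_infty_iff_fderiv.1 hb).2).of_le (by simp)
  obtain ⟨Ma, hMa⟩ := hac.exists_bound_of_continuous ha.continuous
  obtain ⟨Mb, hMb⟩ := (hbc.fderiv ℝ).exists_bound_of_continuous hdb1.continuous
  obtain ⟨Ha, hHa, hamod⟩ := exists_hasMod_of_contDiff hη (ha.of_le (by simp)) hac
  obtain ⟨Hb, hHb, hbmod⟩ := exists_hasMod_of_contDiff hη hdb1 (hbc.fderiv ℝ)
  have hsm : ∀ {h : Eucl n → Eucl n} (J : ℕ), ContDiff ℝ ∞ h → HasCompactSupport h →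
      ContDiff ℝ 1 (moll Φ ((2 : ℝ) ^ (-(J : ℤ))) h) := fun J hh hhc =>
    (contDiff_moll (two_zpow_neg_pos J) hh.continuous hhc).of_le (by simp)
  refine tendsto_advect hψ hψc (fun J => (hsm J ha hac).continuous) (fun J => hsm J hb hbc)
    (fun J y => norm_moll_le hMa y) (fun J y => ?_) (fun y => ?_) (fun y => ?_)
    (a := mass Φ * Ma) (b := mass Φ * Mb)
  · rw [fderiv_moll_eq_moll_fderiv hb1 hbc]
    exact norm_moll_le hMb y
  · refine tendsto_of_forall_norm_sub_le fun ε hε => ?_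
    obtain ⟨N, hN⟩ := exists_norm_moll_sub_le hΦ hη hHa hamod hMa ε hε
    exact ⟨N, fun k hk => hN k hk y⟩
  · refine tendsto_of_forall_norm_sub_le fun ε hε => ?_
    obtain ⟨N, hN⟩ := exists_norm_moll_sub_le hΦ hη hHb hbmod hMb ε hε
    refine ⟨N, fun k hk => ?_⟩
    rw [fderiv_moll_eq_moll_fderiv hb1 hbc]
    exact hN k hk y

lemma norm_fderiv_moll_sub_le {s : ℝ} (hs : 0 < s) {f g : Eucl n → Eucl n}
    (hf : Continuous f) (hfc : HasCompactSupport f) (hg : Continuous g)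
    (hgc : HasCompactSupport g) {ε : ℝ} (h : ∀ x, ‖f x - g x‖ ≤ ε) (x : Eucl n) :
    ‖fderiv ℝ (moll Φ s f) x - fderiv ℝ (moll Φ s g) x‖ ≤
      s⁻¹ * (mass (SchwartzMap.fderivCLM ℝ (Eucl n) ℝ Φ) * ε) := by
  obtain ⟨Mf, hMf⟩ := hfc.exists_bound_of_continuous hf
  obtain ⟨Mg, hMg⟩ := hgc.exists_bound_of_continuous hg
  have e : moll Φ s (fun y => f y - g y) = fun y => moll Φ s f y - moll Φ s g y :=
    funext (moll_sub hf hg hMf hMg)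
  have h1 := norm_fderiv_moll_le (Φ := Φ) hs (hf.sub hg) (hfc.sub hgc) h x
  rw [← fderiv_fun_sub (hasFDerivAt_moll hs hf hfc x).differentiableAt
    (hasFDerivAt_moll hs hg hgc x).differentiableAt, ← e]
  exact h1

lemma tendsto_advect_moll_of_unif {s : ℝ} (hs : 0 < s) (hψ : Continuous ψ)
    (hψc : HasCompactSupport ψ) {f g : Eucl n → Eucl n} {a b : ℕ → Eucl n → Eucl n}
    (hf : Continuous f) (hfc : HasCompactSupport f) (hg : Continuous g)
    (hgc : HasCompactSupport g) (ha : ∀ k, Continuous (a k))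
    (hac : ∀ k, HasCompactSupport (a k)) (hb : ∀ k, Continuous (b k))
    (hbc : ∀ k, HasCompactSupport (b k)) {M : ℝ} (haM : ∀ k x, ‖a k x‖ ≤ M)
    (hbM : ∀ k x, ‖b k x‖ ≤ M) (haf : ∀ ε > 0, ∃ N, ∀ k ≥ N, ∀ x, ‖a k x - f x‖ ≤ ε)
    (hbg : ∀ ε > 0, ∃ N, ∀ k ≥ N, ∀ x, ‖b k x - g x‖ ≤ ε) :
    Tendsto (fun k => advect ψ (moll Φ s (a k)) (moll Φ s (b k))) atTop
      (𝓝 (advect ψ (moll Φ s f) (moll Φ s g))) := by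
  have hm := mass_nonneg Φ
  have hK := mass_nonneg (SchwartzMap.fderivCLM ℝ (Eucl n) ℝ Φ)
  obtain ⟨Mf, hMf⟩ := hfc.exists_bound_of_continuous hf
  refine tendsto_advect hψ hψc (fun k => (contDiff_moll hs (ha k) (hac k)).continuous)
    (fun k => (contDiff_moll hs (hb k) (hbc k)).of_le (by simp))
    (fun k y => norm_moll_le (haM k) y) (fun k y => norm_fderiv_moll_le hs (hb k) (hbc k) (hbM k) y)
    (fun y => ?_) (fun y => ?_)
  · refine tendsto_of_forall_norm_sub_le fun ε hε => ?_
    obtain ⟨N, hN⟩ := haf (ε / (mass Φ + 1)) (by positivity)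
    refine ⟨N, fun k hk => ?_⟩
    rw [← moll_sub (ha k) hf (haM k) hMf]
    refine (norm_moll_le (hN k hk) y).trans ?_
    rw [mul_div_assoc', div_le_iff₀ (by positivity)]
    nlinarith
  · refine tendsto_of_forall_norm_sub_le fun ε hε => ?_
    set K := mass (SchwartzMap.fderivCLM ℝ (Eucl n) ℝ Φ)
    obtain ⟨N, hN⟩ := hbg (ε * s / (K + 1)) (by positivity)
    refine ⟨N, fun k hk => ?_⟩
    refine (norm_fderiv_moll_sub_le hs (hb k) (hbc k) hg hgc (hN k hk) y).trans ?_
    rw [inv_mul_le_iff₀ hs, mul_div_assoc', div_le_iff₀ (by positivity)]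
    nlinarith [mul_pos hε hs]

/-- For smooth `a`, `b` the pairing `∫ ψ (a · ∇) b` is approximated at the rate `2^{-(2β-1)J}` by
the one of the mollifications, with a constant that only depends on bounds in `C^{0,β}`. -/
lemma exists_norm_advect_sub_moll_le (hΦ : ∫ z, Φ z = 1) (hψ : ContDiff ℝ 1 ψ)
    (hψc : HasCompactSupport ψ) {β : ℝ} (hβ : 1 / 2 < β) (hβ1 : β < 1) {H M : ℝ} (hH : 0 ≤ H)
    (hM : 0 ≤ M) :
    ∃ C, ∀ a b : Eucl n → Eucl n, ContDiff ℝ ∞ a → HasCompactSupport a → ContDiff ℝ ∞ b →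
      HasCompactSupport b → HasMod (fun r => r ^ β) H a → HasMod (fun r => r ^ β) H b →
      (∀ x, ‖a x‖ ≤ M) → ∀ J : ℕ, ‖advect ψ a b - advect ψ (moll Φ ((2 : ℝ) ^ (-(J : ℤ))) a)
        (moll Φ ((2 : ℝ) ^ (-(J : ℤ))) b)‖ ≤ C * ((2 : ℝ) ^ (-(2 * β - 1))) ^ J := by
  have hm := mass_nonneg Φ
  have hψd := hψ.continuous_fderiv one_ne_zero
  have hint : Integrable fun y => ‖fderiv ℝ ψ y‖ :=
    hψd.norm.integrable_of_hasCompactSupport (hψc.fderiv ℝ).norm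
  have hI0 : 0 ≤ ∫ y, ‖fderiv ℝ ψ y‖ := integral_nonneg fun y => norm_nonneg _
  refine ⟨(4 * mass (SchwartzMap.fderivCLM ℝ (Eucl n) ℝ Φ) * mass Φ * H ^ 2 * (∫ y, ‖ψ y‖) +
    2 * n * mass Φ * H * ((∫ y, ‖fderiv ℝ ψ y‖) * (mass Φ * M) +
      mass (SchwartzMap.fderivCLM ℝ (Eucl n) ℝ Φ) * H * ∫ y, ‖ψ y‖)) /
    (1 - (2 : ℝ) ^ (-(2 * β - 1))), fun a b ha hac hb hbc hamod hbmod haM J => ?_⟩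
  refine le_of_tendsto ((tendsto_advect_moll hΦ hψ.continuous hψc ha hac hb hbc).sub_const _).norm
    ?_
  filter_upwards [eventually_ge_atTop J] with J' hJ'
  -- the telescoping estimate centred at `0`; the rates allow for `s^{β - 1} ≥ 1`
  have := norm_advect_moll_sub_le hΦ hβ hβ1 hH hamod hbmod hac hbc hψ hψc 0
    (B := (∫ y, ‖fderiv ℝ ψ y‖) * (mass Φ * M)) (by positivity) le_rfl (fun L _ => ?_) hJ'
  · simpa only [sub_zero] using this
  · simp only [sub_zero]
    have hs := two_zpow_neg_pos L
    have h1 : 1 ≤ ((2 : ℝ) ^ (-(L : ℤ)))⁻¹ * ((2 : ℝ) ^ (-(L : ℤ))) ^ β := by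
      rw [le_inv_mul_iff₀ hs, mul_one]
      exact Real.self_le_rpow_of_le_one hs.le (two_zpow_neg_le_one L) hβ1.le
    have h2 : ∫ y, ‖fderiv ℝ ψ y‖ * ‖moll Φ ((2 : ℝ) ^ (-(L : ℤ))) a y‖ ≤
        (∫ y, ‖fderiv ℝ ψ y‖) * (mass Φ * M) := by
      rw [← integral_mul_const]
      refine integral_mono_of_nonneg (Eventually.of_forall fun y => by positivity)
        (hint.mul_const _) (Eventually.of_forall fun y => ?_)
      exact mul_le_mul_of_nonneg_left (norm_moll_le haM y) (norm_nonneg _)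
    exact h2.trans (le_mul_of_one_le_right (by positivity) h1)

/-- If the brackets of smooth approximations in `C^{0,β}`, `β > 1/2`, tend to `0` against `ψ`, so
do the brackets of the mollifications of the limit fields. -/
theorem tendsto_bracket_moll (hΦ : ∫ z, Φ z = 1) (hψ : ContDiff ℝ 1 ψ)
    (hψc : HasCompactSupport ψ) {β : ℝ} (hβ : 1 / 2 < β) (hβ1 : β < 1) {H M : ℝ} (hH : 0 ≤ H)
    (hM : 0 ≤ M) {f g : Eucl n → Eucl n} {a b : ℕ → Eucl n → Eucl n}
    (hf : Continuous f) (hfc : HasCompactSupport f) (hg : Continuous g)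
    (hgc : HasCompactSupport g) (ha : ∀ k, ContDiff ℝ ∞ (a k))
    (hac : ∀ k, HasCompactSupport (a k)) (hb : ∀ k, ContDiff ℝ ∞ (b k))
    (hbc : ∀ k, HasCompactSupport (b k)) (haM : ∀ k x, ‖a k x‖ ≤ M)
    (hbM : ∀ k x, ‖b k x‖ ≤ M) (haH : ∀ k, HasMod (fun r => r ^ β) H (a k))
    (hbH : ∀ k, HasMod (fun r => r ^ β) H (b k))
    (haf : ∀ ε > 0, ∃ N, ∀ k ≥ N, ∀ x, ‖a k x - f x‖ ≤ ε)
    (hbg : ∀ ε > 0, ∃ N, ∀ k ≥ N, ∀ x, ‖b k x - g x‖ ≤ ε)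
    (hab : Tendsto (fun k => advect ψ (a k) (b k) - advect ψ (b k) (a k)) atTop (𝓝 0)) :
    Tendsto (fun J : ℕ => advect ψ (moll Φ ((2 : ℝ) ^ (-(J : ℤ))) f)
        (moll Φ ((2 : ℝ) ^ (-(J : ℤ))) g) - advect ψ (moll Φ ((2 : ℝ) ^ (-(J : ℤ))) g)
        (moll Φ ((2 : ℝ) ^ (-(J : ℤ))) f)) atTop (𝓝 0) := by
  obtain ⟨C, hC⟩ := exists_norm_advect_sub_moll_le (ψ := ψ) hΦ hψ hψc hβ hβ1 hH hM
  have hq : Tendsto (fun J : ℕ => 2 * C * ((2 : ℝ) ^ (-(2 * β - 1))) ^ J) atTop (𝓝 0) := by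
    simpa using (tendsto_pow_atTop_nhds_zero_of_lt_one (by positivity)
      (Real.rpow_lt_one_of_one_lt_of_neg one_lt_two (by linarith : -(2 * β - 1) < 0))).const_mul
        (2 * C)
  refine squeeze_zero_norm (fun J => ?_) hq
  have hs := two_zpow_neg_pos J
  have h1 := tendsto_advect_moll_of_unif (Φ := Φ) hs hψ.continuous hψc hf hfc hg hgc
    (fun k => (ha k).continuous) hac (fun k => (hb k).continuous) hbc haM hbM haf hbg
  have h2 := tendsto_advect_moll_of_unif (Φ := Φ) hs hψ.continuous hψc hg hgc hf hfc
    (fun k => (hb k).continuous) hbc (fun k => (ha k).continuous) hac hbM haM hbg haf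
  have h3 := ((h1.sub h2).sub hab).norm
  rw [sub_zero] at h3
  refine le_of_tendsto h3 (Eventually.of_forall fun k => ?_)
  have h4 := hC (a k) (b k) (ha k) (hac k) (hb k) (hbc k) (haH k) (hbH k) (haM k) J
  have h5 := hC (b k) (a k) (hb k) (hbc k) (ha k) (hac k) (hbH k) (haH k) (hbM k) J
  rw [norm_sub_rev] at h4 h5
  rw [sub_sub_sub_comm]
  refine (norm_sub_le _ _).trans ?_
  linarith

end Vanishing

/-! ### The commutator estimate at one point -/

section Commutator

/-- The kernel `y ↦ s⁻ⁿ κ((x - y) / s)`, so that `moll κ s W x = ∫ dilate κ s x • W`. -/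
def dilate (κ : 𝓢(Eucl n, ℝ)) (s : ℝ) (x y : Eucl n) : ℝ :=
  (s ^ n)⁻¹ * κ (s⁻¹ • (x - y))

variable {κ Φ : 𝓢(Eucl n, ℝ)} {s : ℝ} {x : Eucl n}

lemma contDiff_dilate (κ : 𝓢(Eucl n, ℝ)) (s : ℝ) (x : Eucl n) :
    ContDiff ℝ ∞ (dilate κ s x) :=
  contDiff_const.mul ((κ.smooth _).comp (by fun_prop))

lemma hasCompactSupport_dilate (hκ : HasCompactSupport κ) (hs : 0 < s) (x : Eucl n) :
    HasCompactSupport (dilate κ s x) := by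
  have h := (hκ.comp_smul (inv_ne_zero hs.ne')).comp_homeomorph (Homeomorph.subLeft x)
  refine h.mono fun y hy h0 => hy ?_
  have h0' : κ (s⁻¹ • (x - y)) = 0 := h0
  simp only [dilate, h0', mul_zero]

lemma fderiv_dilate (κ : 𝓢(Eucl n, ℝ)) (s : ℝ) (x y : Eucl n) :
    fderiv ℝ (dilate κ s x) y = -((s ^ n)⁻¹ * s⁻¹) • fderiv ℝ κ (s⁻¹ • (x - y)) := by
  have h1 : HasFDerivAt (fun y : Eucl n => s⁻¹ • (x - y))
      (s⁻¹ • -ContinuousLinearMap.id ℝ (Eucl n)) y :=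
    ((hasFDerivAt_id y).const_sub x).const_smul s⁻¹
  have h2 := ((κ.differentiableAt (x := s⁻¹ • (x - y))).hasFDerivAt.comp y h1).const_mul
    (s ^ n)⁻¹
  have h3 : fderiv ℝ (dilate κ s x) y = _ := h2.fderiv
  rw [h3]
  ext u
  simp [mul_assoc]

lemma integral_weight_dilate_le (κ : 𝓢(Eucl n, ℝ)) (hs : 0 < s) (x : Eucl n) :
    ∫ y, (1 + ‖s⁻¹ • (x - y)‖) * ‖dilate κ s x y‖ ≤ mass κ := by
  have h1 : (fun y => (1 + ‖s⁻¹ • (x - y)‖) * ‖dilate κ s x y‖) = fun y =>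
      (s ^ n)⁻¹ * ((1 + ‖s⁻¹ • (x - y)‖) * ‖κ (s⁻¹ • (x - y))‖) := by
    funext y
    rw [dilate, norm_mul, Real.norm_of_nonneg (by positivity)]
    ring
  rw [h1, integral_const_mul, integral_comp_inv_smul_sub (fun z => (1 + ‖z‖) * ‖κ z‖) hs x,
    smul_eq_mul, inv_mul_cancel_left₀ (pow_ne_zero _ hs.ne')]
  refine integral_mono_of_nonneg (Eventually.of_forall fun z => by positivity)
    (integrable_mass κ) (Eventually.of_forall fun z => ?_)
  exact mul_le_mul_of_nonneg_right (one_add_le_weight z) (norm_nonneg _)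

lemma integral_norm_dilate_le (hκ : HasCompactSupport κ) (hs : 0 < s) (x : Eucl n) :
    ∫ y, ‖dilate κ s x y‖ ≤ mass κ := by
  have hc := (contDiff_dilate κ s x).continuous
  refine le_trans (integral_mono_of_nonneg (Eventually.of_forall fun y => norm_nonneg _) ?_
    (Eventually.of_forall fun y => ?_)) (integral_weight_dilate_le κ hs x)
  · refine Continuous.integrable_of_hasCompactSupport (by fun_prop)
      ((hasCompactSupport_dilate hκ hs x).mono fun y hy h0 => hy ?_)
    simp only [h0, norm_zero, mul_zero]
  · exact le_mul_of_one_le_left (norm_nonneg _) (by linarith [norm_nonneg (s⁻¹ • (x - y))])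

lemma integral_weight_fderiv_dilate_le (κ : 𝓢(Eucl n, ℝ)) (hs : 0 < s) (x : Eucl n) :
    ∫ y, (1 + ‖s⁻¹ • (x - y)‖) * ‖fderiv ℝ (dilate κ s x) y‖ ≤
      s⁻¹ * mass (SchwartzMap.fderivCLM ℝ (Eucl n) ℝ κ) := by
  have h1 : (fun y => (1 + ‖s⁻¹ • (x - y)‖) * ‖fderiv ℝ (dilate κ s x) y‖) = fun y =>
      ((s ^ n)⁻¹ * s⁻¹) * ((1 + ‖s⁻¹ • (x - y)‖) * ‖fderiv ℝ κ (s⁻¹ • (x - y))‖) := by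
    funext y
    rw [fderiv_dilate, norm_smul (-((s ^ n)⁻¹ * s⁻¹)), norm_neg, Real.norm_of_nonneg (by positivity)]
    ring
  rw [h1, integral_const_mul, integral_comp_inv_smul_sub
    (fun z => (1 + ‖z‖) * ‖fderiv ℝ κ z‖) hs x, smul_eq_mul]
  have h2 : ∫ z, (1 + ‖z‖) * ‖fderiv ℝ κ z‖ ≤
      mass (SchwartzMap.fderivCLM ℝ (Eucl n) ℝ κ) :=
    integral_mono_of_nonneg (Eventually.of_forall fun z => by positivity)
      (integrable_mass _) (Eventually.of_forall fun z =>
        mul_le_mul_of_nonneg_right (one_add_le_weight z) (norm_nonneg _))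
  have h3 : (s ^ n)⁻¹ * s⁻¹ * (s ^ n * ∫ z, (1 + ‖z‖) * ‖fderiv ℝ κ z‖) =
      s⁻¹ * ∫ z, (1 + ‖z‖) * ‖fderiv ℝ κ z‖ := by
    field_simp
  rw [h3]
  gcongr

/-- For a constant field the derivative in the pairing can be put on the kernel. -/
lemma advect_dilate_const (hκ : HasCompactSupport κ) (hs : 0 < s) (x u : Eucl n)
    {W : Eucl n → Eucl n} (hW : ContDiff ℝ 1 W) :
    advect (dilate κ s x) (fun _ => u) W = s⁻¹ • moll (dirDeriv κ u) s W x := by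
  have hd := (contDiff_dilate κ s x).of_le (m := 1) (by simp)
  have hc := hasCompactSupport_dilate hκ hs x
  have hdc : HasCompactSupport (fderiv ℝ (dilate κ s x)) := hc.fderiv ℝ
  rw [advect, integral_smul_fderiv_eq_neg_fderiv_smul_of_integrable
    (Continuous.integrable_of_hasCompactSupport
      (((hd.continuous_fderiv one_ne_zero).clm_apply continuous_const).smul hW.continuous)
      (hdc.mono fun y hy h0 => hy (by simp only [h0, _root_.zero_apply, zero_smul])))
    (integrable_advect hd.continuous hc continuous_const hW)
    (Continuous.integrable_of_hasCompactSupport (hd.continuous.smul hW.continuous)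
      (hc.mono fun y hy h0 => hy (by simp only [h0, zero_smul])))
    (fun y _ => hd.differentiable one_ne_zero y) (fun y _ => hW.differentiable one_ne_zero y),
    moll_eq_integral_kernel hs, ← integral_neg, smul_smul, ← integral_smul]
  refine integral_congr_ae (Eventually.of_forall fun y => ?_)
  simp only [fderiv_dilate, _root_.smul_apply, dirDeriv_apply, smul_smul, smul_eq_mul]
  rw [← neg_smul]
  congr 1
  ring

/-- The commutator estimate: with the kernel at scale `2^{-ν}`, the pairings with `f_J` centred at
`f x` are `O(2^{-(2α-1)ν})`, uniformly in `J ≥ ν` and `x`. -/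
lemma exists_norm_advect_dilate_le (hΦ : ∫ z, Φ z = 1) {α : ℝ}
    (hα : 1 / 2 < α) (hα1 : α < 1) {H m P : ℝ} (hH : 0 ≤ H) (hP : 0 ≤ P) :
    ∃ C, ∀ f g : Eucl n → Eucl n,
      HasMod (fun r => r ^ α) H f → HasMod (fun r => r ^ α) H g → HasCompactSupport f →
      HasCompactSupport g → ∀ κ : 𝓢(Eucl n, ℝ), HasCompactSupport κ → mass κ ≤ m →
      mass (SchwartzMap.fderivCLM ℝ (Eucl n) ℝ κ) ≤ P → ∀ (ν : ℕ) (x : Eucl n) (J : ℕ), ν ≤ J →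
      ‖advect (dilate κ ((2 : ℝ) ^ (-(ν : ℤ))) x)
        (fun y => moll Φ ((2 : ℝ) ^ (-(J : ℤ))) f y - f x) (moll Φ ((2 : ℝ) ^ (-(J : ℤ))) g)‖ ≤
      C * ((2 : ℝ) ^ (-(2 * α - 1))) ^ ν := by
  have hη := isModulus_rpow (α := α) (by linarith) hα1.le
  set K := mass (SchwartzMap.fderivCLM ℝ (Eucl n) ℝ Φ) with hK
  have hK0 : 0 ≤ K := mass_nonneg _
  have hmΦ := mass_nonneg Φ
  refine ⟨(4 * K * mass Φ * H ^ 2 * m + 2 * n * mass Φ * H *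
    (P * ((mass Φ + 1) * H) + K * H * m)) / (1 - (2 : ℝ) ^ (-(2 * α - 1))) +
      K * H * ((mass Φ + 1) * H) * m,
    fun f g hf hg hfc hgc κ hκ hκm hκP ν x J hJ => ?_⟩
  set s := (2 : ℝ) ^ (-(ν : ℤ)) with hs
  have hs0 : 0 < s := two_zpow_neg_pos ν
  have hψ := (contDiff_dilate κ s x).of_le (m := 1) (by simp)
  have hψc := hasCompactSupport_dilate hκ hs0 x
  obtain ⟨Mf, hMf⟩ := hfc.exists_bound_of_continuous (hf.continuous hη)
  have hle : ∀ L ≥ ν, (2 : ℝ) ^ (-(L : ℤ)) ≤ s := fun L hL =>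
    zpow_le_zpow_right₀ one_le_two (by omega)
  have hcen : ∀ L ≥ ν, ∀ y, ‖moll Φ ((2 : ℝ) ^ (-(L : ℤ))) f y - f x‖ ≤
      (1 + ‖s⁻¹ • (x - y)‖) * ((mass Φ + 1) * H * s ^ α) := by
    intro L hL y
    have h1 := norm_moll_sub_le hΦ hη hH hf hMf (two_zpow_neg_pos L) y
    have h2 := hf.norm_sub_smul_le hη hH hs0 x (s⁻¹ • (x - y))
    rw [smul_inv_smul₀ hs0.ne', sub_sub_cancel] at h2
    have h3 := norm_add_le (moll Φ ((2 : ℝ) ^ (-(L : ℤ))) f y - f y) (f y - f x)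
    rw [sub_add_sub_cancel] at h3
    have h4 : mass Φ * (H * ((2 : ℝ) ^ (-(L : ℤ))) ^ α) ≤ mass Φ * (H * s ^ α) := by
      have := two_zpow_neg_pos L
      gcongr
      exact hle L hL
    have h5 : 0 ≤ ‖s⁻¹ • (x - y)‖ * (mass Φ * (H * s ^ α)) := by positivity
    linarith
  have hB : ∀ L ≥ ν, ∫ y, ‖fderiv ℝ (dilate κ s x) y‖ *
      ‖moll Φ ((2 : ℝ) ^ (-(L : ℤ))) f y - f x‖ ≤
      (P * ((mass Φ + 1) * H)) * (((2 : ℝ) ^ (-(L : ℤ)))⁻¹ * ((2 : ℝ) ^ (-(L : ℤ))) ^ α) := by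
    intro L hL
    have hL0 := two_zpow_neg_pos L
    have hdc := hψ.continuous_fderiv one_ne_zero
    have hi : Integrable fun y => (1 + ‖s⁻¹ • (x - y)‖) * ‖fderiv ℝ (dilate κ s x) y‖ := by
      refine Continuous.integrable_of_hasCompactSupport (by fun_prop)
        ((hψc.fderiv ℝ).mono fun y hy h0 => hy ?_)
      simp only [h0, norm_zero, mul_zero]
    have h1 : ∫ y, ‖fderiv ℝ (dilate κ s x) y‖ * ‖moll Φ ((2 : ℝ) ^ (-(L : ℤ))) f y - f x‖ ≤
        (∫ y, (1 + ‖s⁻¹ • (x - y)‖) * ‖fderiv ℝ (dilate κ s x) y‖) *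
          ((mass Φ + 1) * H * s ^ α) := by
      rw [← integral_mul_const]
      refine integral_mono_of_nonneg (Eventually.of_forall fun y => by positivity)
        (hi.mul_const _) (Eventually.of_forall fun y => ?_)
      have := mul_le_mul_of_nonneg_left (hcen L hL y) (norm_nonneg (fderiv ℝ (dilate κ s x) y))
      simp only
      linarith
    have h2 : s⁻¹ * s ^ α ≤ ((2 : ℝ) ^ (-(L : ℤ)))⁻¹ * ((2 : ℝ) ^ (-(L : ℤ))) ^ α := by
      have e : ∀ {r : ℝ}, 0 < r → r⁻¹ * r ^ α = r ^ (α - 1) := fun hr => by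
        rw [Real.rpow_sub hr, Real.rpow_one]; field_simp
      rw [e hs0, e hL0]
      exact Real.rpow_le_rpow_of_nonpos hL0 (hle L hL) (by linarith)
    calc _ ≤ _ := h1
      _ ≤ (s⁻¹ * P) * ((mass Φ + 1) * H * s ^ α) := by
        gcongr
        exact (integral_weight_fderiv_dilate_le κ hs0 x).trans (by gcongr)
      _ = (P * ((mass Φ + 1) * H)) * (s⁻¹ * s ^ α) := by ring
      _ ≤ _ := by gcongr
  have hI := (integral_norm_dilate_le hκ hs0 x).trans hκm
  have htel := norm_advect_moll_sub_le hΦ hα hα1 hH hf hg hfc hgc hψ hψc (f x) (by positivity)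
    hI hB hJ
  -- the scale `J = ν`, where the telescoping starts, is estimated directly
  have hbase : ‖advect (dilate κ s x) (fun y => moll Φ s f y - f x) (moll Φ s g)‖ ≤
      K * H * ((mass Φ + 1) * H) * m * ((2 : ℝ) ^ (-(2 * α - 1))) ^ ν := by
    have h1 := norm_advect_le_of_bound hψ.continuous hψc
      (w := fun y => 1 + ‖s⁻¹ • (x - y)‖) (by fun_prop)
      (a := s⁻¹ * (K * (H * s ^ α))) (b := (mass Φ + 1) * H * s ^ α) (by positivity)
      (hcen ν le_rfl) (fun y => norm_fderiv_moll_le_of_hasMod hη hH hg hs0 hgc y)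
    have h2 := (integral_weight_dilate_le κ hs0 x).trans hκm
    rw [← two_zpow_neg_rpow, ← inv_mul_rpow_sq hs0]
    calc _ ≤ _ := h1
      _ ≤ s⁻¹ * (K * (H * s ^ α)) * ((mass Φ + 1) * H * s ^ α) * m := by gcongr
      _ = _ := by ring
  have h6 := norm_add_le
    (advect (dilate κ s x) (fun y => moll Φ ((2 : ℝ) ^ (-(J : ℤ))) f y - f x)
      (moll Φ ((2 : ℝ) ^ (-(J : ℤ))) g) -
      advect (dilate κ s x) (fun y => moll Φ s f y - f x) (moll Φ s g))
    (advect (dilate κ s x) (fun y => moll Φ s f y - f x) (moll Φ s g))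
  rw [sub_add_cancel] at h6
  rw [add_mul]
  linarith

/-- If the bracket of the mollified fields vanishes in the limit against `dilate κ 2^{-ν} x`, then
the bracket formed with the mollified gradients and the fields themselves is `O(2^{-(2α-1)ν})`. -/
theorem exists_norm_fderiv_moll_bracket_le (hΦ : ∫ z, Φ z = 1) {α : ℝ}
    (hα : 1 / 2 < α) (hα1 : α < 1) {H m P : ℝ} (hH : 0 ≤ H) (hP : 0 ≤ P) :
    ∃ C, ∀ f g : Eucl n → Eucl n,
      HasMod (fun r => r ^ α) H f → HasMod (fun r => r ^ α) H g → HasCompactSupport f →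
      HasCompactSupport g → ∀ κ : 𝓢(Eucl n, ℝ), HasCompactSupport κ → mass κ ≤ m →
      mass (SchwartzMap.fderivCLM ℝ (Eucl n) ℝ κ) ≤ P → ∀ (ν : ℕ) (x : Eucl n),
      Tendsto (fun J : ℕ =>
        advect (dilate κ ((2 : ℝ) ^ (-(ν : ℤ))) x) (moll Φ ((2 : ℝ) ^ (-(J : ℤ))) f)
          (moll Φ ((2 : ℝ) ^ (-(J : ℤ))) g) -
        advect (dilate κ ((2 : ℝ) ^ (-(ν : ℤ))) x) (moll Φ ((2 : ℝ) ^ (-(J : ℤ))) g)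
          (moll Φ ((2 : ℝ) ^ (-(J : ℤ))) f)) atTop (𝓝 0) →
      ‖fderiv ℝ (moll κ ((2 : ℝ) ^ (-(ν : ℤ))) g) x (f x) -
        fderiv ℝ (moll κ ((2 : ℝ) ^ (-(ν : ℤ))) f) x (g x)‖ ≤
      C * ((2 : ℝ) ^ (-(2 * α - 1))) ^ ν := by
  have hη := isModulus_rpow (α := α) (by linarith) hα1.le
  obtain ⟨C, hC⟩ := exists_norm_advect_dilate_le (n := n) hΦ hα hα1 hH hP
  refine ⟨2 * C, fun f g hf hg hfc hgc κ hκ hκm hκP ν x hlim => ?_⟩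
  set s := (2 : ℝ) ^ (-(ν : ℤ)) with hs
  have hs0 : 0 < s := two_zpow_neg_pos ν
  have hcf := hf.continuous hη
  have hcg := hg.continuous hη
  have hψ := (contDiff_dilate κ s x).continuous
  have hψc := hasCompactSupport_dilate hκ hs0 x
  have hsm : ∀ {h : Eucl n → Eucl n} (J : ℕ), Continuous h → HasCompactSupport h →
      ContDiff ℝ 1 (moll Φ ((2 : ℝ) ^ (-(J : ℤ))) h) := fun J hh hhc =>
    (contDiff_moll (two_zpow_neg_pos J) hh hhc).of_le (by simp)
  have hconv : ∀ {h : Eucl n → Eucl n} (u : Eucl n), HasMod (fun r => r ^ α) H h →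
      HasCompactSupport h → Tendsto (fun J : ℕ => s⁻¹ • moll (dirDeriv κ u) s
        (moll Φ ((2 : ℝ) ^ (-(J : ℤ))) h) x) atTop (𝓝 (fderiv ℝ (moll κ s h) x u)) := by
    intro h u hh hhc
    have hch := hh.continuous hη
    obtain ⟨M, hM⟩ := hhc.exists_bound_of_continuous hch
    rw [fderiv_moll_apply hs0 hch hhc]
    refine Tendsto.const_smul (tendsto_of_forall_norm_sub_le fun ε hε => ?_) _
    have hmu := mass_nonneg (dirDeriv κ u)
    obtain ⟨N, hN⟩ := exists_norm_moll_sub_le hΦ hη hH hh hM (ε / (mass (dirDeriv κ u) + 1))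
      (by positivity)
    refine ⟨N, fun J hJ => ?_⟩
    rw [← moll_sub (hsm J hch hhc).continuous hch (fun y => norm_moll_le hM y) hM]
    refine (norm_moll_le (hN J hJ) x).trans ?_
    rw [mul_div_assoc', div_le_iff₀ (by positivity)]
    nlinarith
  have hsplit : ∀ {f' g' : Eucl n → Eucl n}, Continuous f' → HasCompactSupport f' →
      Continuous g' → HasCompactSupport g' → ∀ J : ℕ,
      s⁻¹ • moll (dirDeriv κ (f' x)) s (moll Φ ((2 : ℝ) ^ (-(J : ℤ))) g') x =
        advect (dilate κ s x) (moll Φ ((2 : ℝ) ^ (-(J : ℤ))) f')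
          (moll Φ ((2 : ℝ) ^ (-(J : ℤ))) g') -
        advect (dilate κ s x) (fun y => moll Φ ((2 : ℝ) ^ (-(J : ℤ))) f' y - f' x)
          (moll Φ ((2 : ℝ) ^ (-(J : ℤ))) g') := by
    intro f' g' hf' hfc' hg' hgc' J
    rw [advect_sub_left hψ hψc (hsm J hf' hfc').continuous continuous_const (hsm J hg' hgc'),
      advect_dilate_const hκ hs0 x (f' x) (hsm J hg' hgc')]
    abel
  -- with the centred pairings written as full pairing minus frozen one, the full pairings cancel
  -- against `hlim` and only the centred ones survive
  have hmain := ((hconv (f x) hg hgc).sub (hconv (g x) hf hfc)).sub hlim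
  rw [sub_zero] at hmain
  refine le_of_tendsto hmain.norm ?_
  filter_upwards [eventually_ge_atTop ν] with J hJ
  rw [hsplit hcf hfc hcg hgc, hsplit hcg hgc hcf hfc]
  have h1 := hC f g hf hg hfc hgc κ hκ hκm hκP ν x J hJ
  have h2 := hC g f hg hf hgc hfc κ hκ hκm hκP ν x J hJ
  have e : ∀ a b c d : Eucl n, a - b - (c - d) - (a - c) = d - b := fun a b c d => by abel
  rw [e]
  refine (norm_sub_le _ _).trans ?_
  linarith

end Commutator

/-! ### The bracket of the mollified fields -/

section Truncation

variable {κ Φ : 𝓢(Eucl n, ℝ)} {s : ℝ}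

lemma mass_le_add {G G₁ G₂ : Type*} [NormedAddCommGroup G] [NormedSpace ℝ G]
    [NormedAddCommGroup G₁] [NormedSpace ℝ G₁] [NormedAddCommGroup G₂] [NormedSpace ℝ G₂]
    {Ψ : 𝓢(Eucl n, G)} {Φ₁ : 𝓢(Eucl n, G₁)} {Φ₂ : 𝓢(Eucl n, G₂)} {a b : ℝ}
    (h : ∀ z, ‖Ψ z‖ ≤ a * ‖Φ₁ z‖ + b * ‖Φ₂ z‖) : mass Ψ ≤ a * mass Φ₁ + b * mass Φ₂ := by
  rw [mass, mass, mass, ← integral_const_mul, ← integral_const_mul, ← integral_add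
    ((integrable_mass Φ₁).const_mul a) ((integrable_mass Φ₂).const_mul b)]
  refine integral_mono (integrable_mass Ψ)
    (((integrable_mass Φ₁).const_mul a).add ((integrable_mass Φ₂).const_mul b)) fun z => ?_
  have := mul_le_mul_of_nonneg_left (h z) (sq_nonneg (1 + ‖z‖))
  simp only
  linarith

/-- A Schwartz kernel cut off at distance `1 / s`, with masses bounded uniformly in `s ≤ 1`. -/
lemma exists_truncation (Φ : 𝓢(Eucl n, ℝ)) {θ : Eucl n → ℝ} (hθ : ContDiff ℝ ∞ θ)
    (hθc : HasCompactSupport θ) :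
    ∃ m P, 0 ≤ P ∧ ∀ s : ℝ, 0 < s → s ≤ 1 → ∃ κ : 𝓢(Eucl n, ℝ), HasCompactSupport κ ∧
      (∀ z, κ z = θ (s • z) * Φ z) ∧ mass κ ≤ m ∧
      mass (SchwartzMap.fderivCLM ℝ (Eucl n) ℝ κ) ≤ P := by
  obtain ⟨B, hB⟩ := hθc.exists_bound_of_continuous hθ.continuous
  obtain ⟨L, hL⟩ := (hθc.fderiv ℝ).exists_bound_of_continuous (hθ.continuous_fderiv (by simp))
  have hB0 : 0 ≤ B := (norm_nonneg _).trans (hB 0)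
  have hL0 : 0 ≤ L := (norm_nonneg _).trans (hL 0)
  have h1 := mass_nonneg Φ
  have h2 := mass_nonneg (SchwartzMap.fderivCLM ℝ (Eucl n) ℝ Φ)
  refine ⟨B * mass Φ + 0 * mass Φ,
    L * mass Φ + B * mass (SchwartzMap.fderivCLM ℝ (Eucl n) ℝ Φ), by positivity,
    fun s hs hs1 => ?_⟩
  have hc : HasCompactSupport fun z => θ (s • z) * Φ z :=
    (hθc.comp_smul hs.ne').mul_right
  have hd : ContDiff ℝ ∞ fun z => θ (s • z) * Φ z :=
    (hθ.comp (contDiff_const_smul s)).mul (Φ.smooth _)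
  refine ⟨hc.toSchwartzMap hd, hc, fun z => rfl, mass_le_add fun z => ?_,
    mass_le_add fun z => ?_⟩
  · change ‖θ (s • z) * Φ z‖ ≤ _
    rw [norm_mul, zero_mul, add_zero]
    exact mul_le_mul_of_nonneg_right (hB _) (norm_nonneg _)
  · change ‖fderiv ℝ (fun z => θ (s • z) * Φ z) z‖ ≤ _ * _ + _ * ‖fderiv ℝ Φ z‖
    have e1 : HasFDerivAt (fun z : Eucl n => θ (s • z))
        ((fderiv ℝ θ (s • z)).comp (s • ContinuousLinearMap.id ℝ (Eucl n))) z :=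
      (hθ.differentiable (by simp) (s • z)).hasFDerivAt.comp z ((hasFDerivAt_id z).const_smul s)
    have e2 : fderiv ℝ (fun z => θ (s • z) * Φ z) z = _ := (e1.mul Φ.differentiableAt.hasFDerivAt).fderiv
    have e3 : ‖(fderiv ℝ θ (s • z)).comp (s • ContinuousLinearMap.id ℝ (Eucl n))‖ ≤ L := by
      rw [ContinuousLinearMap.comp_smul, ContinuousLinearMap.comp_id, norm_smul,
        Real.norm_of_nonneg hs.le]
      nlinarith [hL (s • z), norm_nonneg (fderiv ℝ θ (s • z))]
    rw [e2]
    refine (norm_add_le _ _).trans ?_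
    rw [norm_smul, norm_smul, add_comm]
    have e4 := mul_le_mul_of_nonneg_right (hB (s • z)) (norm_nonneg (fderiv ℝ Φ z))
    have e5 := mul_le_mul_of_nonneg_left e3 (norm_nonneg (Φ z))
    linarith

lemma moll_sub_kernel {f : Eucl n → Eucl n} {M : ℝ} (hf : Continuous f) (hM : ∀ x, ‖f x‖ ≤ M) :
    moll (Φ - κ) s f = fun x => moll Φ s f x - moll κ s f x := by
  funext x
  rw [moll, moll, moll, ← integral_sub (integrable_smul_bounded Φ hf hM s x)
    (integrable_smul_bounded κ hf hM s x)]
  refine integral_congr_ae (Eventually.of_forall fun z => ?_)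
  simp only [sub_apply, sub_smul]

/-- Kernels that agree on a ball of radius `r` have gradients that differ only in the tail, which
the weight `(1 + ‖z‖)²` in `mass` controls by `r⁻²`. -/
lemma norm_fderiv_moll_sub_kernel_le (hs : 0 < s) {f : Eucl n → Eucl n} {M : ℝ}
    (hf : Continuous f) (hfc : HasCompactSupport f) (hM : ∀ x, ‖f x‖ ≤ M) {r : ℝ} (hr : 0 < r)
    (hκ : ∀ z, ‖z‖ < r → κ z = Φ z) (x : Eucl n) :
    ‖fderiv ℝ (moll Φ s f) x - fderiv ℝ (moll κ s f) x‖ ≤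
      s⁻¹ * ((mass (SchwartzMap.fderivCLM ℝ (Eucl n) ℝ Φ) +
        mass (SchwartzMap.fderivCLM ℝ (Eucl n) ℝ κ)) * (r⁻¹ ^ 2 * M)) := by
  have hM0 : 0 ≤ M := (norm_nonneg _).trans (hM 0)
  have hd : ∀ Ψ : 𝓢(Eucl n, ℝ), DifferentiableAt ℝ (moll Ψ s f) x := fun Ψ =>
    (hasFDerivAt_moll hs hf hfc x).differentiableAt
  have h1 : fderiv ℝ (moll (Φ - κ) s f) x =
      fderiv ℝ (moll Φ s f) x - fderiv ℝ (moll κ s f) x := by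
    rw [moll_sub_kernel hf hM]
    exact fderiv_sub (hd Φ) (hd κ)
  have hmass : mass (SchwartzMap.fderivCLM ℝ (Eucl n) ℝ (Φ - κ)) ≤
      1 * mass (SchwartzMap.fderivCLM ℝ (Eucl n) ℝ Φ) +
        1 * mass (SchwartzMap.fderivCLM ℝ (Eucl n) ℝ κ) := by
    refine mass_le_add fun z => ?_
    rw [map_sub, sub_apply, one_mul, one_mul]
    exact norm_sub_le _ _
  rw [one_mul, one_mul] at hmass
  have hz : ∀ z, ‖z‖ < r → fderiv ℝ (Φ - κ : 𝓢(Eucl n, ℝ)) z = 0 := by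
    intro z hz
    have : (Φ - κ : 𝓢(Eucl n, ℝ)) =ᶠ[𝓝 z] fun _ => (0 : ℝ) := by
      filter_upwards [(isOpen_lt continuous_norm continuous_const).mem_nhds hz] with w hw
      rw [sub_apply, hκ w hw, sub_self]
    rw [this.fderiv_eq, fderiv_const_apply]
  rw [← h1, (hasFDerivAt_moll hs hf hfc x).fderiv, norm_smul, norm_inv,
    Real.norm_of_nonneg hs.le]
  refine mul_le_mul_of_nonneg_left ?_ (by positivity)
  refine le_trans (norm_integral_le_mass (SchwartzMap.fderivCLM ℝ (Eucl n) ℝ (Φ - κ))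
    (M := r⁻¹ ^ 2 * M) fun z => ?_) (mul_le_mul_of_nonneg_right hmass (by positivity))
  rw [ContinuousLinearMap.norm_smulRight_apply, SchwartzMap.fderivCLM_apply]
  rcases lt_or_ge ‖z‖ r with h | h
  · rw [hz z h, norm_zero, zero_mul, mul_zero, mul_zero]
  · have h2 : 1 ≤ r⁻¹ ^ 2 * (1 + ‖z‖) ^ 2 := by
      rw [← mul_pow]
      refine one_le_pow₀ ?_
      rw [inv_mul_eq_div, one_le_div hr]
      linarith
    have h3 := mul_le_mul_of_nonneg_left (hM (x - s • z))
      (norm_nonneg (fderiv ℝ (Φ - κ : 𝓢(Eucl n, ℝ)) z))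
    have h4 := mul_le_mul_of_nonneg_right h2
      (mul_nonneg (norm_nonneg (fderiv ℝ (Φ - κ : 𝓢(Eucl n, ℝ)) z)) hM0)
    linarith

end Truncation

/-- Commutator bound for the mollified fields. The kernel is cut off at scale `δ`, so that only
test functions supported in `ball x δ` enter, and the cut-off costs `O(s)`. -/
theorem exists_norm_lieBracket_moll_le {Φ : 𝓢(Eucl n, ℝ)} (hΦ : ∫ z, Φ z = 1) {α : ℝ}
    (hα : 1 / 2 < α) (hα1 : α < 1) {H : ℝ} (hH : 0 ≤ H) {f g : Eucl n → Eucl n}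
    (hf : HasMod (fun r => r ^ α) H f) (hg : HasMod (fun r => r ^ α) H g)
    (hfc : HasCompactSupport f) (hgc : HasCompactSupport g) {S : Set (Eucl n)} {δ : ℝ}
    (hδ : 0 < δ)
    (hlim : ∀ x ∈ S, ∀ ψ : Eucl n → ℝ, IsTestFunction (Metric.ball x δ) ψ →
      Tendsto (fun J : ℕ => advect ψ (moll Φ ((2 : ℝ) ^ (-(J : ℤ))) f)
        (moll Φ ((2 : ℝ) ^ (-(J : ℤ))) g) - advect ψ (moll Φ ((2 : ℝ) ^ (-(J : ℤ))) g)
        (moll Φ ((2 : ℝ) ^ (-(J : ℤ))) f)) atTop (𝓝 0)) :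
    ∃ C, 0 < C ∧ ∀ ν : ℕ, ∀ x ∈ S,
      ‖VectorField.lieBracket ℝ (moll Φ ((2 : ℝ) ^ (-(ν : ℤ))) f)
        (moll Φ ((2 : ℝ) ^ (-(ν : ℤ))) g) x‖ ≤ C * ((2 : ℝ) ^ (-(2 * α - 1))) ^ ν := by
  have hη := isModulus_rpow (α := α) (by linarith) hα1.le
  have hcf := hf.continuous hη
  have hcg := hg.continuous hη
  obtain ⟨Mf, hMf⟩ := hfc.exists_bound_of_continuous hcf
  obtain ⟨Mg, hMg⟩ := hgc.exists_bound_of_continuous hcg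
  have hMf0 : 0 ≤ Mf := (norm_nonneg _).trans (hMf 0)
  have hMg0 : 0 ≤ Mg := (norm_nonneg _).trans (hMg 0)
  obtain ⟨θ, hθ, hθ1⟩ := exists_testFunction_eq_one (isCompact_closedBall (0 : Eucl n) (δ / 2))
    Metric.isOpen_ball (Metric.closedBall_subset_ball (by linarith : δ / 2 < δ))
  obtain ⟨m, P, hP, htr⟩ := exists_truncation Φ hθ.contDiff hθ.hasCompactSupport
  obtain ⟨C, hC⟩ := exists_norm_fderiv_moll_bracket_le (m := m) hΦ hα hα1 hH hP
  set K := mass (SchwartzMap.fderivCLM ℝ (Eucl n) ℝ Φ) with hK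
  have hK0 : 0 ≤ K := mass_nonneg _
  have hm0 := mass_nonneg Φ
  set Q := (δ / 2)⁻¹ ^ 2 with hQ
  have hQ0 : 0 ≤ Q := by positivity
  refine ⟨2 * (K * H * (mass Φ * H)) + 2 * ((K + P) * Q * Mf * Mg) + |C| + 1, by positivity,
    fun ν x hx => ?_⟩
  set s := (2 : ℝ) ^ (-(ν : ℤ)) with hs
  have hs0 : 0 < s := two_zpow_neg_pos ν
  have hs1 : s ≤ 1 := two_zpow_neg_le_one ν
  obtain ⟨κ, hκc, hκ, hκm, hκP⟩ := htr s hs0 hs1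
  have hψ : IsTestFunction (Metric.ball x δ) (dilate κ s x) := by
    refine ⟨contDiff_dilate κ s x, hasCompactSupport_dilate hκc hs0 x, ?_⟩
    have h1 : tsupport (dilate κ s x) ⊆ (fun y => x - y) ⁻¹' tsupport θ := by
      refine closure_minimal (fun y hy => subset_tsupport _ fun h0 => hy ?_)
        ((isClosed_tsupport θ).preimage (by fun_prop))
      simp only [dilate, hκ, smul_inv_smul₀ hs0.ne', h0, zero_mul, mul_zero]
    intro y hy
    have h2 := hθ.tsupport_subset (h1 hy)
    rwa [mem_ball_zero_iff, ← dist_eq_norm, dist_comm] at h2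
  have hmain := hC f g hf hg hfc hgc κ hκc hκm hκP ν x (hlim x hx _ hψ)
  have hagree : ∀ z, ‖z‖ < δ / 2 / s → κ z = Φ z := by
    intro z hz
    rw [hκ, hθ1, one_mul]
    rw [mem_closedBall_zero_iff, norm_smul, Real.norm_of_nonneg hs0.le, mul_comm]
    exact ((lt_div_iff₀ hs0).1 hz).le
  set q := ((2 : ℝ) ^ (-(2 * α - 1))) ^ ν with hq
  have hsq : s ^ (2 * α - 1) = q := two_zpow_neg_rpow ν _
  have hsle : s ≤ q := by
    rw [← hsq]
    calc s = s ^ (1 : ℝ) := (Real.rpow_one s).symm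
      _ ≤ _ := Real.rpow_le_rpow_of_exponent_ge hs0 hs1 (by linarith)
  have htail : ∀ {h : Eucl n → Eucl n} {M : ℝ} (u : Eucl n) {M' : ℝ}, Continuous h →
      HasCompactSupport h → (∀ y, ‖h y‖ ≤ M) → ‖u‖ ≤ M' →
      ‖(fderiv ℝ (moll Φ s h) x - fderiv ℝ (moll κ s h) x) u‖ ≤ (K + P) * Q * M * M' * q := by
    intro h M u M' hh hhc hM hu
    have hM0 : 0 ≤ M := (norm_nonneg _).trans (hM 0)
    have hM'0 : 0 ≤ M' := (norm_nonneg _).trans hu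
    have h1 := norm_fderiv_moll_sub_kernel_le hs0 hh hhc hM (r := δ / 2 / s) (by positivity)
      hagree x
    calc _ ≤ _ := ContinuousLinearMap.le_opNorm _ u
      _ ≤ (s⁻¹ * ((K + P) * ((δ / 2 / s)⁻¹ ^ 2 * M))) * M' := by
        gcongr
        exact h1.trans (by gcongr)
      _ = (K + P) * Q * M * M' * s := by
        rw [hQ]
        field_simp
      _ ≤ _ := by gcongr
  have hfirst : ∀ {h k : Eucl n → Eucl n} {M : ℝ}, HasMod (fun r => r ^ α) H h →
      HasMod (fun r => r ^ α) H k → HasCompactSupport h → (∀ y, ‖k y‖ ≤ M) →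
      ‖fderiv ℝ (moll Φ s h) x (moll Φ s k x - k x)‖ ≤ K * H * (mass Φ * H) * q := by
    intro h k M hh hk hhc hM
    calc _ ≤ _ := ContinuousLinearMap.le_opNorm _ _
      _ ≤ (s⁻¹ * (K * (H * s ^ α))) * (mass Φ * (H * s ^ α)) := by
        gcongr
        · exact norm_fderiv_moll_le_of_hasMod hη hH hh hs0 hhc x
        · exact norm_moll_sub_le hΦ hη hH hk hM hs0 x
      _ = K * H * (mass Φ * H) * (s⁻¹ * (s ^ α) ^ 2) := by ring
      _ = _ := by rw [inv_mul_rpow_sq hs0, hsq]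
  -- freeze the fields at `x`, then replace the kernel by its truncation
  have e : VectorField.lieBracket ℝ (moll Φ s f) (moll Φ s g) x =
      (fderiv ℝ (moll Φ s g) x (moll Φ s f x - f x) -
        fderiv ℝ (moll Φ s f) x (moll Φ s g x - g x)) +
      ((fderiv ℝ (moll Φ s g) x - fderiv ℝ (moll κ s g) x) (f x) -
        (fderiv ℝ (moll Φ s f) x - fderiv ℝ (moll κ s f) x) (g x)) +
      (fderiv ℝ (moll κ s g) x (f x) - fderiv ℝ (moll κ s f) x (g x)) := by
    simp only [VectorField.lieBracket, map_sub, sub_apply]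
    abel
  rw [e]
  have hq0 : 0 ≤ q := by positivity
  have h1 := hfirst hg hf hgc hMf
  have h2 := hfirst hf hg hfc hMg
  have h3 := htail (f x) hcg hgc hMg (hMf x)
  have h4 := htail (g x) hcf hfc hMf (hMg x)
  have h5 : C * q ≤ |C| * q := mul_le_mul_of_nonneg_right (le_abs_self C) hq0
  refine (norm_add₃_le).trans ?_
  have h6 := (norm_sub_le (fderiv ℝ (moll Φ s g) x (moll Φ s f x - f x))
    (fderiv ℝ (moll Φ s f) x (moll Φ s g x - g x)))
  have h7 := norm_sub_le ((fderiv ℝ (moll Φ s g) x - fderiv ℝ (moll κ s g) x) (f x))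
    ((fderiv ℝ (moll Φ s f) x - fderiv ℝ (moll κ s f) x) (g x))
  linarith

/-! ### The distributional bracket tested with mollifications -/

/-- Cutting off smooth Hölder approximations of a field gives, from some index on, uniformly
Hölder fields that converge uniformly. -/
lemma SmoothHolderApprox.exists_cutoff {β : ℝ} (hβ : 0 < β) (hβ1 : β ≤ 1) {Ω : Set (Eucl n)}
    (hΩ : IsOpen Ω) {A : ℕ → Eucl n → Eucl n} {X : Eucl n → Eucl n}
    (hA : SmoothHolderApprox β Ω A X) {χ : Eucl n → ℝ} (hχ : IsTestFunction Ω χ) :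
    ∃ H N₀, 0 ≤ H ∧ (∀ k ≥ N₀, ∀ x, ‖χ x • A k x‖ ≤ H) ∧
      (∀ k ≥ N₀, HasMod (fun r => r ^ β) H (fun x => χ x • A k x)) ∧
      ∀ ε > 0, ∃ N, ∀ k ≥ N, ∀ x, ‖χ x • A k x - χ x • X x‖ ≤ ε := by
  have hη := isModulus_rpow hβ hβ1
  obtain ⟨Ω', hΩ', hΩ'Ω, hχ'⟩ := hχ.exists_compactlyContained hΩ
  obtain ⟨C, hC0, hC⟩ := exists_hasMod_cutoff hη hΩ' hχ'
  have hev : ∀ ε > 0, ∃ N, ∀ k ≥ N, modNorm (fun r => r ^ β) Ω' (fun x => A k x - X x) ≤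
      ENNReal.ofReal ε := fun ε hε =>
    eventually_atTop.1 ((hA.2 Ω' hΩ' hΩ'Ω).eventually_le_const (ENNReal.ofReal_pos.2 hε))
  obtain ⟨N₀, hN₀⟩ := hev 1 one_pos
  have hsm : ∀ k, ContDiff ℝ ∞ fun x => χ x • A k x := fun k => hχ.contDiff.smul (hA.1 k)
  have hcs : ∀ k, HasCompactSupport fun x => χ x • A k x := fun k =>
    hχ.hasCompactSupport.smul_right
  obtain ⟨H₀, hH₀, hmod⟩ := exists_hasMod_of_contDiff hη
    ((hsm N₀).of_le (m := 1) (by simp)) (hcs N₀)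
  obtain ⟨M₀, hM₀⟩ := (hcs N₀).exists_bound_of_continuous (hsm N₀).continuous
  have hM₀0 : 0 ≤ M₀ := (norm_nonneg _).trans (hM₀ 0)
  -- `χ A_k = χ (A_k - X) - χ (A_{N₀} - X) + χ A_{N₀}`
  have hdec : ∀ k x, χ x • A k x =
      χ x • (A k x - X x) - χ x • (A N₀ x - X x) + χ x • A N₀ x := fun k x => by
    simp only [smul_sub]; abel
  refine ⟨C * 1 + C * 1 + H₀ + M₀, N₀, by positivity, fun k hk x => ?_, fun k hk => ?_,
    fun ε hε => ?_⟩
  · have h1 := (hC _ 1 zero_le_one (hN₀ k hk)).1 x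
    have h2 := (hC _ 1 zero_le_one (hN₀ N₀ le_rfl)).1 x
    rw [hdec]
    refine (norm_add_le _ _).trans ?_
    linarith [norm_sub_le (χ x • (A k x - X x)) (χ x • (A N₀ x - X x)), hM₀ x]
  · have h1 := (hC _ 1 zero_le_one (hN₀ k hk)).2
    have h2 := (hC _ 1 zero_le_one (hN₀ N₀ le_rfl)).2
    rw [funext (hdec k)]
    exact ((h1.sub h2).add hmod).mono hη (by linarith)
  · obtain ⟨N, hN⟩ := hev (ε / (C + 1)) (by positivity)
    refine ⟨N, fun k hk x => ?_⟩
    rw [← smul_sub]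
    refine ((hC _ _ (by positivity) (hN k hk)).1 x).trans ?_
    rw [mul_div_assoc', div_le_iff₀ (by positivity)]
    nlinarith

/-- If `[X,Y] = 0` as a distribution, then the brackets of the mollifications of `χX` and `χY`
tend to zero against test functions supported where `χ = 1`. -/
theorem DistribLieBracketEqZero.tendsto_moll {Φ : 𝓢(Eucl n, ℝ)} (hΦ : ∫ z, Φ z = 1)
    {Ω : Set (Eucl n)} (hΩ : IsOpen Ω) {X Y : Eucl n → Eucl n}
    (hXY : DistribLieBracketEqZero Ω X Y) {χ : Eucl n → ℝ} (hχ : IsTestFunction Ω χ)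
    (hX : Continuous fun x => χ x • X x) (hY : Continuous fun x => χ x • Y x)
    {W : Set (Eucl n)} (hW : IsOpen W) (hχW : ∀ x ∈ W, χ x = 1)
    {ψ : Eucl n → ℝ} (hψ : IsTestFunction W ψ) :
    Tendsto (fun J : ℕ => advect ψ (moll Φ ((2 : ℝ) ^ (-(J : ℤ))) fun x => χ x • X x)
        (moll Φ ((2 : ℝ) ^ (-(J : ℤ))) fun x => χ x • Y x) -
      advect ψ (moll Φ ((2 : ℝ) ^ (-(J : ℤ))) fun x => χ x • Y x)
        (moll Φ ((2 : ℝ) ^ (-(J : ℤ))) fun x => χ x • X x)) atTop (𝓝 0) := by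
  obtain ⟨β, hβ, hβ1, A, B, hA, hB, hAB⟩ := hXY
  have hη := isModulus_rpow (α := β) (by linarith) hβ1.le
  obtain ⟨HA, NA, hHA, hAM, hAH, hAlim⟩ := hA.exists_cutoff (by linarith) hβ1.le hΩ hχ
  obtain ⟨HB, NB, hHB, hBM, hBH, hBlim⟩ := hB.exists_cutoff (by linarith) hβ1.le hΩ hχ
  have hWΩ : W ⊆ Ω := fun x hx => hχ.tsupport_subset (subset_tsupport _ (by
    rw [Function.mem_support, hχW x hx]
    exact one_ne_zero))
  have hcs : ∀ V : Eucl n → Eucl n, HasCompactSupport fun x => χ x • V x := fun V =>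
    hχ.hasCompactSupport.smul_right
  have hsA : ∀ k, ContDiff ℝ ∞ fun x => χ x • A k x := fun k => hχ.contDiff.smul (hA.1 k)
  have hsB : ∀ k, ContDiff ℝ ∞ fun x => χ x • B k x := fun k => hχ.contDiff.smul (hB.1 k)
  have hcut : ∀ (V : Eucl n → Eucl n), ∀ x ∈ W, (fun x => χ x • V x) =ᶠ[𝓝 x] V := by
    intro V x hx
    filter_upwards [hW.mem_nhds hx] with y hy
    rw [hχW y hy, one_smul]
  have hbr : ∀ k, advect ψ (fun x => χ x • A k x) (fun x => χ x • B k x) -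
      advect ψ (fun x => χ x • B k x) (fun x => χ x • A k x) =
      ∫ x, ψ x • VectorField.lieBracket ℝ (A k) (B k) x := by
    intro k
    rw [← integral_smul_lieBracket hψ.contDiff.continuous hψ.hasCompactSupport
      ((hsA k).of_le (by simp)) ((hsB k).of_le (by simp))]
    refine integral_congr_ae (Eventually.of_forall fun x => ?_)
    simp only
    by_cases hx : x ∈ tsupport ψ
    · have hx' := hψ.tsupport_subset hx
      rw [(hcut (A k) x hx').lieBracket_vectorField_eq (hcut (B k) x hx')]
    · rw [image_eq_zero_of_notMem_tsupport hx, zero_smul, zero_smul]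
  have hlim := (hAB ψ ⟨hψ.contDiff, hψ.hasCompactSupport, hψ.tsupport_subset.trans hWΩ⟩)
  -- discard the finitely many indices without uniform bounds
  obtain ⟨N, hN, hN'⟩ : ∃ N, NA ≤ N ∧ NB ≤ N := ⟨max NA NB, le_max_left _ _, le_max_right _ _⟩
  have hshift : ∀ {u : ℕ → Eucl n → Eucl n} {v : Eucl n → Eucl n},
      (∀ ε > 0, ∃ N, ∀ k ≥ N, ∀ x, ‖u k x - v x‖ ≤ ε) →
      ∀ ε > 0, ∃ N', ∀ k ≥ N', ∀ x, ‖u (k + N) x - v x‖ ≤ ε := fun h ε hε =>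
    (h ε hε).imp fun N' hN' k hk x => hN' (k + N) (by omega) x
  have hNA : ∀ k, k + N ≥ NA := fun k => by omega
  have hNB : ∀ k, k + N ≥ NB := fun k => by omega
  have hA₁ : ∀ k x, ‖χ x • A (k + N) x‖ ≤ HA + HB := fun k x =>
    (hAM _ (hNA k) x).trans (by linarith)
  have hB₁ : ∀ k x, ‖χ x • B (k + N) x‖ ≤ HA + HB := fun k x =>
    (hBM _ (hNB k) x).trans (by linarith)
  have hA₂ : ∀ k, HasMod (fun r => r ^ β) (HA + HB) fun x => χ x • A (k + N) x := fun k =>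
    (hAH _ (hNA k)).mono hη (by linarith)
  have hB₂ : ∀ k, HasMod (fun r => r ^ β) (HA + HB) fun x => χ x • B (k + N) x := fun k =>
    (hBH _ (hNB k)).mono hη (by linarith)
  have hab : Tendsto (fun k => advect ψ (fun x => χ x • A (k + N) x) (fun x => χ x • B (k + N) x) -
      advect ψ (fun x => χ x • B (k + N) x) (fun x => χ x • A (k + N) x)) atTop (𝓝 0) := by
    simp only [hbr]
    exact (tendsto_add_atTop_iff_nat N).2 hlim
  have hA₃ := hshift (u := fun k x => χ x • A k x) hAlim
  have hB₃ := hshift (u := fun k x => χ x • B k x) hBlim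
  have hH : 0 ≤ HA + HB := by positivity
  exact tendsto_bracket_moll hΦ (hψ.contDiff.of_le (by simp)) hψ.hasCompactSupport hβ hβ1
    hH hH hX (hcs X) hY (hcs Y) (fun k => hsA (k + N)) (fun k => hcs _) (fun k => hsB (k + N))
    (fun k => hcs _) hA₁ hB₁ hA₂ hB₂ hA₃ hB₃ hab

/-! ### Littlewood-Paley sums of cut-off fields -/

/-- The commutator estimate for the mollifications of cut-off fields. -/
theorem exists_c0Norm_lieBracket_moll_le {Φ : 𝓢(Eucl n, ℝ)} (hΦ : ∫ z, Φ z = 1)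
    {U₀ Ω : Set (Eucl n)} (hΩ : IsOpen Ω) {X Y : Eucl n → Eucl n}
    (hXY : DistribLieBracketEqZero Ω X Y) {χ : Eucl n → ℝ} (hχ : IsTestFunction Ω χ)
    {δ : ℝ} (hδ : 0 < δ) (hχ_one : ∀ x ∈ Metric.thickening δ U₀, χ x = 1)
    {γ : ℝ} (hγ : 0 < γ) (hγ1 : γ < 1)
    (hX : MemHolderLoc ((1 + γ) / 2) Ω X) (hY : MemHolderLoc ((1 + γ) / 2) Ω Y) :
    ∃ C : ℝ, 0 < C ∧ ∀ ν : ℕ,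
      c0Norm U₀ (VectorField.lieBracket ℝ
        (moll Φ ((2 : ℝ) ^ (-(ν : ℤ))) fun x => χ x • X x)
        (moll Φ ((2 : ℝ) ^ (-(ν : ℤ))) fun x => χ x • Y x)) ≤
          ENNReal.ofReal (C * (2 : ℝ) ^ (-(γ * (ν : ℝ)))) := by
  have hη := isModulus_rpow (α := (1 + γ) / 2) (by linarith) (by linarith)
  obtain ⟨HX, hHX, -, hX'⟩ := MemModLoc.exists_hasMod hη hΩ hX hχ
  obtain ⟨HY, hHY, -, hY'⟩ := MemModLoc.exists_hasMod hη hΩ hY hχ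
  have hcs : ∀ V : Eucl n → Eucl n, HasCompactSupport fun x => χ x • V x := fun V =>
    hχ.hasCompactSupport.smul_right
  obtain ⟨C, hC0, hC⟩ := exists_norm_lieBracket_moll_le hΦ (α := (1 + γ) / 2) (by linarith)
    (by linarith) (H := HX + HY) (by positivity) (hX'.mono hη (by linarith))
    (hY'.mono hη (by linarith)) (hcs X) (hcs Y) (S := U₀) hδ fun x hx ψ hψ =>
      hXY.tendsto_moll hΦ hΩ hχ (hX'.continuous hη) (hY'.continuous hη) Metric.isOpen_ball
        (fun y hy => hχ_one y (Metric.mem_thickening_iff.2 ⟨x, hx, hy⟩)) hψ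
  refine ⟨C, hC0, fun ν => (c0Norm_le_iff (by positivity)).2 fun x hx => ?_⟩
  have e : (2 : ℝ) ^ (-(γ * (ν : ℝ))) = ((2 : ℝ) ^ (-(2 * ((1 + γ) / 2) - 1))) ^ ν := by
    rw [← Real.rpow_natCast, ← Real.rpow_mul zero_le_two]
    congr 1
    ring
  rw [e]
  exact hC ν x hx

end

end OsgoodLP


theorem proposition3p15 {n : ℕ}
    -- the Littlewood-Paley character function that defines the operators `S_ν`
    (φ : 𝓢(Eucl n, ℝ)) (hφ : IsLPChar φ)
    (U₀ Ω : Set (Eucl n)) (hU₀ : IsOpen U₀) (hΩ : IsOpen Ω) (hU₀Ω : CompactlyContained U₀ Ω)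
    (η : ℝ → ℝ) (hη : IsOsgoodModulus η)
    (X Y : Eucl n → Eucl n) (hX : MemModLoc η Ω X) (hY : MemModLoc η Ω Y)
    (hXY : DistribLieBracketEqZero Ω X Y)
    -- the cut-off function
    (χ : Eucl n → ℝ) (hχ : IsTestFunction Ω χ) (hχ_mem : ∀ x, χ x ∈ Icc (0 : ℝ) 1)
    (δ : ℝ) (hδ : 0 < δ) (hχ_one : ∀ x ∈ Metric.thickening δ U₀, χ x = 1)
    -- the approximants
    (Xs Ys : ℕ → Eucl n → Eucl n)
    (hXs : ∀ ν, Xs ν = lpSum φ ν (fun x => χ x • X x))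
    (hYs : ∀ ν, Ys ν = lpSum φ ν (fun x => χ x • Y x)) :
    (∀ ν : ℕ, 1 ≤ ν → ContDiff ℝ ∞ (Xs ν) ∧ ContDiff ℝ ∞ (Ys ν)) ∧
    -- (i)
    (∃ C : ℝ, 0 < C ∧ ∀ ν : ℕ, 1 ≤ ν →
      c1Norm U₀ (Xs ν) + c1Norm U₀ (Ys ν) ≤
        ENNReal.ofReal (C * (2 : ℝ) ^ ν * η ((2 : ℝ) ^ (-(ν : ℤ))))) ∧
    -- (ii)
    (∀ γ : ℝ, 0 < γ → γ < 1 →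
      MemHolderLoc ((1 + γ) / 2) Ω X → MemHolderLoc ((1 + γ) / 2) Ω Y →
      ∃ C : ℝ, 0 < C ∧ ∀ ν : ℕ, 1 ≤ ν →
        c0Norm U₀ (VectorField.lieBracket ℝ (Xs ν) (Ys ν)) ≤
          ENNReal.ofReal (C * (2 : ℝ) ^ (-(γ * (ν : ℝ))))) ∧
    -- (iii)
    (∃ ζ : ℝ → ℝ, IsOsgoodModulus ζ ∧
      Tendsto (fun ν => modNorm ζ U₀ (fun x => Xs ν x - X x)) atTop (𝓝 0) ∧
      Tendsto (fun ν => modNorm ζ U₀ (fun x => Ys ν x - Y x)) atTop (𝓝 0)) ∧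
    -- (iv)
    (∀ U : Set (Eucl n), CompactlyContained U U₀ →
      ∃ T : ℝ, 0 < T ∧
        Ioo (-T) T ×ˢ U ⊆ flowDomain Ω X ∧ Ioo (-T) T ×ˢ U ⊆ flowDomain Ω Y ∧
        (∀ ν : ℕ, 1 ≤ ν → Ioo (-T) T ×ˢ U ⊆ flowDomain univ (Xs ν) ∧
          Ioo (-T) T ×ˢ U ⊆ flowDomain univ (Ys ν)) ∧
        Tendsto (fun ν => flowDist univ (Xs ν) Ω X T U) atTop (𝓝 0) ∧
        Tendsto (fun ν => flowDist univ (Ys ν) Ω Y T U) atTop (𝓝 0)) := by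
  set Φ := lpKernel hφ with hΦdef
  have hΦ : ∫ z, Φ z = 1 := integral_lpKernel hφ
  have hm := mass_nonneg Φ
  have hχU₀ : ∀ x ∈ U₀, χ x = 1 := fun x hx =>
    hχ_one x (Metric.self_subset_thickening hδ U₀ hx)
  have hU₀Ω' : U₀ ⊆ Ω := subset_closure.trans hU₀Ω.2
  have hcs : ∀ V : Eucl n → Eucl n, HasCompactSupport fun x => χ x • V x := fun V =>
    hχ.hasCompactSupport.smul_right
  have hone : ∀ (V : Eucl n → Eucl n), ∀ x ∈ U₀, χ x • V x = V x := fun V x hx => by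
    rw [hχU₀ x hx, one_smul]
  obtain ⟨HX, hHX, hbX, hmX⟩ := hX.exists_hasMod hη.toIsModulus hΩ hχ
  obtain ⟨HY, hHY, hbY, hmY⟩ := hY.exists_hasMod hη.toIsModulus hΩ hχ
  have hcX := hmX.continuous hη.toIsModulus
  have hcY := hmY.continuous hη.toIsModulus
  obtain rfl : Xs = fun ν : ℕ => moll Φ ((2 : ℝ) ^ (-(ν : ℤ))) fun x => χ x • X x :=
    funext fun ν => (hXs ν).trans (lpSum_eq_moll hφ ν hcX (hcs X))
  obtain rfl : Ys = fun ν : ℕ => moll Φ ((2 : ℝ) ^ (-(ν : ℤ))) fun x => χ x • Y x :=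
    funext fun ν => (hYs ν).trans (lpSum_eq_moll hφ ν hcY (hcs Y))
  have hsX : ∀ ν : ℕ, ContDiff ℝ ∞ (moll Φ ((2 : ℝ) ^ (-(ν : ℤ))) fun x => χ x • X x) :=
    fun ν => contDiff_moll (two_zpow_neg_pos ν) hcX (hcs X)
  have hsY : ∀ ν : ℕ, ContDiff ℝ ∞ (moll Φ ((2 : ℝ) ^ (-(ν : ℤ))) fun x => χ x • Y x) :=
    fun ν => contDiff_moll (two_zpow_neg_pos ν) hcY (hcs Y)
  have hlX := exists_norm_moll_sub_le hΦ hη.toIsModulus hHX hmX hbX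
  have hlY := exists_norm_moll_sub_le hΦ hη.toIsModulus hHY hmY hbY
  have hle : ∀ {H : ℝ}, 0 ≤ H → H ≤ (mass Φ + 1) * H ∧ mass Φ * H ≤ (mass Φ + 1) * H :=
    fun hH => ⟨by nlinarith, by nlinarith⟩
  have hmX' := hmX.mono hη.toIsModulus (hle hHX).1
  have hmY' := hmY.mono hη.toIsModulus (hle hHY).1
  have hGX : ∀ ν : ℕ, HasMod η ((mass Φ + 1) * HX)
      (moll Φ ((2 : ℝ) ^ (-(ν : ℤ))) fun x => χ x • X x) := fun ν =>
    (hasMod_moll hη.toIsModulus hHX hmX hbX).mono hη.toIsModulus (hle hHX).2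
  have hGY : ∀ ν : ℕ, HasMod η ((mass Φ + 1) * HY)
      (moll Φ ((2 : ℝ) ^ (-(ν : ℤ))) fun x => χ x • Y x) := fun ν =>
    (hasMod_moll hη.toIsModulus hHY hmY hbY).mono hη.toIsModulus (hle hHY).2
  have hX0 : 0 ≤ (mass Φ + 1) * HX := by positivity
  have hY0 : 0 ≤ (mass Φ + 1) * HY := by positivity
  refine ⟨fun ν _ => ⟨hsX ν, hsY ν⟩, ?_, fun γ hγ hγ1 hXγ hYγ => ?_, ?_, fun U hU => ?_⟩
  · obtain ⟨C₁, hC₁, h₁⟩ := exists_c1Norm_moll_le Φ hη.toIsModulus hHX hmX (hcs X) hbX U₀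
    obtain ⟨C₂, hC₂, h₂⟩ := exists_c1Norm_moll_le Φ hη.toIsModulus hHY hmY (hcs Y) hbY U₀
    refine ⟨C₁ + C₂, by positivity, fun ν _ => (add_le_add (h₁ ν) (h₂ ν)).trans ?_⟩
    have hp := (hη.pos _ (two_zpow_neg_pos ν)).le
    rw [← ENNReal.ofReal_add (by positivity) (by positivity)]
    exact ENNReal.ofReal_le_ofReal (le_of_eq (by ring))
  · obtain ⟨C, hC, h⟩ := exists_c0Norm_lieBracket_moll_le hΦ hΩ hXY hχ hδ hχ_one hγ hγ1 hXγ hYγ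
    exact ⟨C, hC, fun ν _ => h ν⟩
  · obtain ⟨ζ, hζ, hηζ⟩ := hη.exists_isLittleO
    exact ⟨ζ, hζ, tendsto_modNorm_of_isLittleO hζ.toIsModulus hηζ hX0 hmX' hGX (hone X) hlX,
      tendsto_modNorm_of_isLittleO hζ.toIsModulus hηζ hY0 hmY' hGY (hone Y) hlY⟩
  · obtain ⟨TX, hTX, hFX⟩ := hη.flow_convergence hΩ hU₀ hU₀Ω' hU hX hX0 hmX' hGX
      (fun ν => (hsX ν).of_le (by simp)) (fun x => (hbX x).trans (hle hHX).1)
      (fun ν x => (norm_moll_le hbX x).trans (hle hHX).2) (hone X) hlX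
    obtain ⟨TY, hTY, hFY⟩ := hη.flow_convergence hΩ hU₀ hU₀Ω' hU hY hY0 hmY' hGY
      (fun ν => (hsY ν).of_le (by simp)) (fun x => (hbY x).trans (hle hHY).1)
      (fun ν x => (norm_moll_le hbY x).trans (hle hHY).2) (hone Y) hlY
    have hT : 0 < min TX TY := lt_min hTX hTY
    obtain ⟨a₁, a₂, a₃⟩ := hFX _ hT (min_le_left _ _)
    obtain ⟨b₁, b₂, b₃⟩ := hFY _ hT (min_le_right _ _)
    exact ⟨_, hT, a₁, b₁, fun ν _ => ⟨a₂ ν, b₂ ν⟩, a₃, b₃⟩
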